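/- **Setting.** Let $\Omega\subset\mathbb R^m$ be a bounded domain (nonempty, open, connected) with smooth boundary, $\mathcal B=\overline\Omega$, $\partial\mathcal B=\partial\Omega$, with outward unit normal $n$, volume element $dx$ on $\mathcal B$ and area element $ds$ on $\partial\mathcal B$. For $K=\mathcal B$ or $K=\partial\mathcal B$ let $C^\infty(K)$ be the space of restrictions to $K$ of smooth functions on $\mathbb R^m$, with the final topology of the restriction map $C^\infty(\mathbb R^m)\to C^\infty(K)$ (its Fréchet topology). Put $V=C^\infty(\mathcal B)$, $V^\star=C^\infty(\mathcal B)\times C^\infty(\partial\mathcal B)$, $\langle(\alpha,\alpha_\partial),\varphi\rangle=\int_{\mathcal B}\alpha\varphi\,dx+\int_{\partial\mathcal B}\alpha_\partial\varphi\,ds$, $TV=V\times V$, $T^\star V=V\times V^\star$ and $T^\star(T^\star V)=V\times V^\star\times V^\star\times V$, where the covector $(\beta,\psi)\in V^\star\times V$ acts on $(\delta\varphi,\delta\alpha)\in V\times V^\star$ by $\langle\beta,\delta\varphi\rangle+\langle\delta\alpha,\psi\rangle$. Let $\mathfrak L:\mathbb R\times\mathbb R\times\mathbb R^m\to\mathbb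 R$ be smooth, $L:TV\to\mathbb R$, $L(\varphi,\nu)=\int_{\mathcal B}\mathfrak L(\varphi,\nu,\nabla\varphi)\,dx$, and let $F=(\mathcal F,\mathcal F_\partial):TV\to V^\star$ be continuous. The partial functional derivatives $\frac{\delta L}{\delta\varphi},\frac{\delta L}{\delta\nu}:TV\to V^\star$ are defined by $\langle\frac{\delta L}{\delta\varphi}(\varphi,\nu),\delta\varphi\rangle=\frac{d}{d\epsilon}\big|_{0}L(\varphi+\epsilon\,\delta\varphi,\nu)$ and $\langle\frac{\delta L}{\delta\nu}(\varphi,\nu),\delta\nu\rangle=\frac{d}{d\epsilon}\big|_{0}L(\varphi,\nu+\epsilon\,\delta\nu)$. Let $\mathbb FL(\varphi,\nu)=(\varphi,\frac{\delta L}{\delta\nu})\in T^\star V$, ${\rm d}_DL(\varphi,\nu)=(\varphi,\frac{\delta L}{\delta\nu},-\frac{\delta L}{\delta\varphi},\nu)\in T^\star(T^\star V)$, and let $\widetilde F(\varphi,\nu)$ be the covector $(F(\varphi,\nu),0)\in V^\star\times V$ at $\mathbb FL(\varphi,\nu)$. With the canonical one-form $\Theta(z)\cdot\delta z=\langle z,\delta\varphi\rangle$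 on $T^\star V$ ($\delta z=(\delta\varphi,\delta\alpha,\delta\alpha_\partial)$), the canonical Dirac structure is $D_{T^\star V}=\operatorname{graph}(\Omega_{T^\star V}^\flat)$, $\Omega_{T^\star V}=-{\rm d}\Theta$. Let $t_0<t_1$ and $1\le r\le\infty$. All curves below are curves on $[t_0,t_1]$, differentiated in time in the Fréchet topologies; $\varphi$ and its variations $\delta\varphi$ are of class $C^{r+1}$ in $V$, and $\nu,\alpha$ (in $V$), $\alpha_\partial$ (in $C^\infty(\partial\mathcal B)$) and their variations are of class $C^r$ (for $r=\infty$ everything is smooth). The variation $\delta$ of an integral is the derivative at $\epsilon=0$ along the perturbed curve $\varphi+\epsilon\,\delta\varphi$, etc. **Theorem.** Consider the following statements. (i) $\delta\int_{t_0}^{t_1}L(\varphi,\dot\varphi)\,dt+\int_{t_0}^{t_1}\langle F(\varphi,\dot\varphi),\delta\varphi\rangle\,dt=0$ for all variations $\delta\varphi$ vanishing at $t_0$ and $t_1$. (ii) $\frac{\partial}{\partial t}\frac{\partial\mathfrak L}{\partial\nu}(\varphi,\dot\varphi,\nabla\varphi)=\frac{\partial\mathfrak L}{\partial\varphi}(\varphi,\dot\varphi,\nabla\varphi)-\operatorname{div}\frac{\partial\mathfrak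 L}{\partial\nabla\varphi}(\varphi,\dot\varphi,\nabla\varphi)+\mathcal F(\varphi,\dot\varphi)$ on $\mathcal B$, and $\mathcal F_\partial(\varphi,\dot\varphi)=-\frac{\partial\mathfrak L}{\partial\nabla\varphi}(\varphi,\dot\varphi,\nabla\varphi)\cdot n$ on $\partial\mathcal B$, for all $t\in[t_0,t_1]$. (iii) $\delta\int_{t_0}^{t_1}\big[L(\varphi,\nu)+\langle(\alpha,\alpha_\partial),\dot\varphi-\nu\rangle\big]dt+\int_{t_0}^{t_1}\langle F(\varphi,\nu),\delta\varphi\rangle\,dt=0$ for all variations $\delta\varphi,\delta\nu,\delta\alpha,\delta\alpha_\partial$ with $\delta\varphi$ vanishing at $t_0$ and $t_1$. (iv) For all $t\in[t_0,t_1]$: $\dot\varphi=\nu$, $\ \alpha=\frac{\partial\mathfrak L}{\partial\nu}(\varphi,\nu,\nabla\varphi)$, $\ \dot\alpha=\frac{\partial\mathfrak L}{\partial\varphi}(\varphi,\nu,\nabla\varphi)-\operatorname{div}\frac{\partial\mathfrak L}{\partial\nabla\varphi}(\varphi,\nu,\nabla\varphi)+\mathcal F(\varphi,\nu)$, $\ \alpha_\partial=0$,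 $\ \dot\alpha_\partial=\frac{\partial\mathfrak L}{\partial\nabla\varphi}(\varphi,\nu,\nabla\varphi)\big|_{\partial\mathcal B}\cdot n+\mathcal F_\partial(\varphi,\nu)$. (v) For all $t\in[t_0,t_1]$: $\big((\varphi,\alpha,\alpha_\partial,\dot\varphi,\dot\alpha,\dot\alpha_\partial),\,{\rm d}_DL(\varphi,\nu)-\widetilde F(\varphi,\nu)\big)\in D_{T^\star V}(\varphi,\alpha,\alpha_\partial)$. Then: (a) For a curve $(\varphi,\nu,\alpha,\alpha_\partial)$, the statements (iii), (iv) and (v) are equivalent, and each is equivalent to (i) together with $\nu=\dot\varphi$ and $(\varphi,\alpha,\alpha_\partial)=\mathbb FL(\varphi,\nu)$ on $[t_0,t_1]$, and to (ii) together with the same two conditions. (b) For a curve $\varphi$, the following are equivalent: (i); (ii); (iii) holds for some $\nu,\alpha,\alpha_\partial$; (iv) holds for some $\nu,\alpha,\alpha_\partial$; (v) holds for some $\nu,\alpha,\alpha_\partial$. -/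

import Mathlib

open MeasureTheory Filter Topology
open scoped ContDiff

/-! ### Bounded domains with smooth boundary -/

/-- The space `ℝ^m` with its Euclidean norm. -/
abbrev Eu (m : ℕ) : Type := EuclideanSpace ℝ (Fin m)

/-- The boundary of `Ω` is smooth: near each boundary point, and up to the choice and the
orientation of the coordinate axis `e`, the set `Ω` is the strict subgraph
`{x | x·e < g x}` of a smooth function `g` that does not depend on the coordinate along `e`. -/
def HasSmoothBoundary {m : ℕ} (Ω : Set (Eu m)) : Prop :=
  ∀ p ∈ frontier Ω, ∃ (e : Eu m) (g : Eu m → ℝ) (U : Set (Eu m)),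
    (∃ i : Fin m, e = EuclideanSpace.single i (1 : ℝ) ∨ e = -EuclideanSpace.single i (1 : ℝ)) ∧
    ContDiff ℝ ∞ g ∧ (∀ (x : Eu m) (s : ℝ), g (x + s • e) = g x) ∧
    IsOpen U ∧ p ∈ U ∧ ∀ x ∈ U, (x ∈ Ω ↔ inner ℝ x e < g x)

/-- `Ω` is a bounded domain (nonempty, open, connected) with smooth boundary. The body `𝓑` is the
compact set `closure Ω`, and `∂𝓑` is `frontier Ω`. -/
structure IsSmoothBoundedDomain {m : ℕ} (Ω : Set (Eu m)) : Prop where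
  isOpen : IsOpen Ω
  isConnected : IsConnected Ω
  isBounded : Bornology.IsBounded Ω
  smoothBoundary : HasSmoothBoundary Ω

/-- `n` is the outward-pointing unit normal of `Ω` at the boundary point `p`: directions that make
an obtuse angle with `n` enter `Ω`, directions that make an acute angle with `n` leave its
closure. -/
def IsOutwardUnitNormal {m : ℕ} (Ω : Set (Eu m)) (p n : Eu m) : Prop :=
  ‖n‖ = 1 ∧ ∀ v : Eu m,
    (inner ℝ v n < 0 → ∀ᶠ s : ℝ in 𝓝[>] 0, p + s • v ∈ Ω) ∧
    (0 < inner ℝ v n → ∀ᶠ s : ℝ in 𝓝[>] 0, p + s • v ∉ closure Ω)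

open Classical in
/-- The outward-pointing unit normal field (it exists and is unique on a smooth boundary). -/
noncomputable def outwardNormal {m : ℕ} (Ω : Set (Eu m)) (p : Eu m) : Eu m :=
  if h : ∃ n, IsOutwardUnitNormal Ω p n then h.choose else 0

/-- The volume element `dx` on `𝓑 = closure Ω`. -/
noncomputable def bodyMeasure {m : ℕ} (Ω : Set (Eu m)) : Measure (closure Ω) :=
  Measure.comap (Subtype.val : closure Ω → Eu m) volume

/-- The area element `ds` on `∂𝓑 = frontier Ω`: the `(m-1)`-dimensional Hausdorff measure, normalized
so as to agree with Lebesgue measure on `ℝ^(m-1)`. -/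
noncomputable def areaMeasure {m : ℕ} (Ω : Set (Eu m)) : Measure (frontier Ω) :=
  Measure.comap (Subtype.val : frontier Ω → Eu m) (Measure.euclideanHausdorffMeasure (m - 1))

/-- The inclusion `∂𝓑 ⊆ 𝓑`. -/
def bdryIncl {m : ℕ} {Ω : Set (Eu m)} (x : frontier Ω) : closure Ω :=
  ⟨x.1, frontier_subset_closure x.2⟩

/-! ### The Fréchet spaces `C^∞(𝓑)` and `C^∞(∂𝓑)` -/

/-- The functions on `K ⊆ ℝ^m` that are restrictions of smooth functions on `ℝ^m`. -/
def smoothFunctions {m : ℕ} (K : Set (Eu m)) : Submodule ℝ (K → ℝ) where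
  carrier := {f | ∃ F : Eu m → ℝ, ContDiff ℝ ∞ F ∧ ∀ x : K, F x = f x}
  add_mem' := by
    rintro f g ⟨F, hF, hf⟩ ⟨G, hG, hg⟩
    exact ⟨fun x => F x + G x, hF.add hG, fun x => by simp [hf x, hg x]⟩
  zero_mem' := ⟨fun _ => 0, contDiff_const, fun _ => rfl⟩
  smul_mem' := by
    rintro c f ⟨F, hF, hf⟩
    exact ⟨fun x => c * F x, contDiff_const.mul hF, fun x => by simp [hf x]⟩

/-- `C^∞(K)`, for a closed domain or for a closed hypersurface `K` in `ℝ^m`. -/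
def CInf {m : ℕ} (K : Set (Eu m)) : Type := ↥(smoothFunctions K)

noncomputable instance {m : ℕ} (K : Set (Eu m)) : AddCommGroup (CInf K) :=
  inferInstanceAs (AddCommGroup ↥(smoothFunctions K))

noncomputable instance {m : ℕ} (K : Set (Eu m)) : Module ℝ (CInf K) :=
  inferInstanceAs (Module ℝ ↥(smoothFunctions K))

instance {m : ℕ} (K : Set (Eu m)) : CoeFun (CInf K) (fun _ => K → ℝ) := ⟨fun f => f.1⟩

/-- The Fréchet topology of `C^∞(ℝ^m)`: uniform convergence on compact sets of the derivatives of
every order. -/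
@[reducible] noncomputable def smoothTopology (m : ℕ) : TopologicalSpace {F : Eu m → ℝ // ContDiff ℝ ∞ F} :=
  ⨅ k : ℕ, TopologicalSpace.induced
    (fun F => (⟨iteratedFDeriv ℝ k F.1,
      F.2.continuous_iteratedFDeriv (by exact_mod_cast le_top)⟩ :
        C(Eu m, ContinuousMultilinearMap ℝ (fun _ : Fin k => Eu m) ℝ)))
    ContinuousMap.compactOpen

/-- The restriction map `C^∞(ℝ^m) → C^∞(K)`. -/
def restrictSmooth {m : ℕ} (K : Set (Eu m)) (F : {F : Eu m → ℝ // ContDiff ℝ ∞ F}) : CInf K :=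
  ⟨fun x => F.1 x, F.1, F.2, fun _ => rfl⟩

/-- The Fréchet topology of `C^∞(K)`: the final topology of the restriction map
`C^∞(ℝ^m) → C^∞(K)`. -/
noncomputable instance {m : ℕ} (K : Set (Eu m)) : TopologicalSpace (CInf K) :=
  TopologicalSpace.coinduced (restrictSmooth K) (smoothTopology m)

/-- The configuration space `V = C^∞(𝓑)`. -/
abbrev ConfSpace {m : ℕ} (Ω : Set (Eu m)) : Type := CInf (closure Ω)

/-- The restricted dual `V⋆ = C^∞(𝓑) × C^∞(∂𝓑)`. -/
abbrev RDual {m : ℕ} (Ω : Set (Eu m)) : Type := CInf (closure Ω) × CInf (frontier Ω)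

/-- The restricted cotangent bundle `T⋆V = V × V⋆`. -/
abbrev TStar {m : ℕ} (Ω : Set (Eu m)) : Type := ConfSpace Ω × RDual Ω

/-- The pairing `⟨(α, α_∂), φ⟩ = ∫_𝓑 α φ dx + ∫_∂𝓑 α_∂ φ ds` of `V⋆` with `V`. -/
noncomputable def pairing {m : ℕ} {Ω : Set (Eu m)} (a : RDual Ω) (φ : ConfSpace Ω) : ℝ :=
  (∫ x, a.1 x * φ x ∂(bodyMeasure Ω)) + ∫ x, a.2 x * φ (bdryIncl x) ∂(areaMeasure Ω)

/-! ### Differential calculus on `𝓑` -/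

/-- The differential of a function on `𝓑` (one-sided at the boundary). -/
noncomputable def bodyDeriv {m : ℕ} {Ω : Set (Eu m)} (f : closure Ω → ℝ) (x : closure Ω) :
    Eu m →L[ℝ] ℝ :=
  fderivWithin ℝ (Function.extend Subtype.val f 0) (closure Ω) x

/-- The gradient `∇φ`. -/
noncomputable def grad {m : ℕ} {Ω : Set (Eu m)} (φ : ConfSpace Ω) (x : closure Ω) : Eu m :=
  WithLp.toLp 2 (fun i => bodyDeriv φ x (EuclideanSpace.single i 1))

/-- The divergence `∑ i, ∂X^i/∂x^i`. -/
noncomputable def divergence {m : ℕ} {Ω : Set (Eu m)} (X : closure Ω → Eu m) (x : closure Ω) : ℝ :=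
  ∑ i, bodyDeriv (fun y => X y i) x (EuclideanSpace.single i 1)

/-! ### Curves in topological vector spaces -/

/-- The time derivative of a curve, as the limit in `X` of the difference quotients (one-sided at
the ends of the interval `I`). -/
noncomputable def timeDeriv {X : Type} [AddCommGroup X] [Module ℝ X] [TopologicalSpace X]
    (I : Set ℝ) (c : ℝ → X) (t : ℝ) : X :=
  limUnder (𝓝[I \ {t}] t) (slope c t)

/-- The curve `c` is `k` times continuously differentiable on `I`. -/
def IsCkCurve {X : Type} [AddCommGroup X] [Module ℝ X] [TopologicalSpace X]
    (I : Set ℝ) : ℕ → (ℝ → X) → Prop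
  | 0, c => ContinuousOn c I
  | k + 1, c => (∀ t ∈ I, ∃ v : X, Tendsto (slope c t) (𝓝[I \ {t}] t) (𝓝 v)) ∧
      IsCkCurve I k (timeDeriv I c)

/-- The curve `c` is of class `C^r` on `I`, where `r` is a natural number or `∞`. -/
def IsCurve {X : Type} [AddCommGroup X] [Module ℝ X] [TopologicalSpace X]
    (I : Set ℝ) (r : ℕ∞) (c : ℝ → X) : Prop :=
  ∀ k : ℕ, (k : ℕ∞) ≤ r → IsCkCurve I k c

/-! ### Lagrangians defined through a density -/

/-- `L(φ, ν) = ∫_𝓑 𝔏(φ, ν, ∇φ) dx`. -/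
noncomputable def lagrangian {m : ℕ} {Ω : Set (Eu m)} (𝔏 : ℝ → ℝ → Eu m → ℝ)
    (φ ν : ConfSpace Ω) : ℝ :=
  ∫ x, 𝔏 (φ x) (ν x) (grad φ x) ∂(bodyMeasure Ω)

/-- The function `∂𝔏/∂φ (φ, ν, ∇φ)` on `𝓑`. -/
noncomputable def densityPhi {m : ℕ} {Ω : Set (Eu m)} (𝔏 : ℝ → ℝ → Eu m → ℝ)
    (φ ν : ConfSpace Ω) (x : closure Ω) : ℝ :=
  deriv (fun a => 𝔏 a (ν x) (grad φ x)) (φ x)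

/-- The function `∂𝔏/∂ν (φ, ν, ∇φ)` on `𝓑`. -/
noncomputable def densityNu {m : ℕ} {Ω : Set (Eu m)} (𝔏 : ℝ → ℝ → Eu m → ℝ)
    (φ ν : ConfSpace Ω) (x : closure Ω) : ℝ :=
  deriv (fun b => 𝔏 (φ x) b (grad φ x)) (ν x)

/-- The vector field `∂𝔏/∂∇φ (φ, ν, ∇φ)` on `𝓑`. -/
noncomputable def densityGrad {m : ℕ} {Ω : Set (Eu m)} (𝔏 : ℝ → ℝ → Eu m → ℝ)
    (φ ν : ConfSpace Ω) (x : closure Ω) : Eu m :=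
  gradient (fun c => 𝔏 (φ x) (ν x) c) (grad φ x)

open Classical in
/-- The functional derivative at `φ` of `G : V → ℝ`, as an element of the restricted dual: the
`a ∈ V⋆` such that `d/dε|₀ G(φ + ε δφ) = ⟨a, δφ⟩` for all `δφ ∈ V`. -/
noncomputable def functionalDeriv {m : ℕ} {Ω : Set (Eu m)} (G : ConfSpace Ω → ℝ)
    (φ : ConfSpace Ω) : RDual Ω :=
  if h : ∃ a : RDual Ω, ∀ δφ : ConfSpace Ω,
      HasDerivAt (fun ε : ℝ => G (φ + ε • δφ)) (pairing a δφ) 0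
  then h.choose else 0

/-- The partial functional derivative `δL/δφ (φ, ν)`. -/
noncomputable def deltaPhi {m : ℕ} {Ω : Set (Eu m)} (L : ConfSpace Ω → ConfSpace Ω → ℝ)
    (φ ν : ConfSpace Ω) : RDual Ω :=
  functionalDeriv (fun ψ => L ψ ν) φ

/-- The partial functional derivative `δL/δν (φ, ν)`. -/
noncomputable def deltaNu {m : ℕ} {Ω : Set (Eu m)} (L : ConfSpace Ω → ConfSpace Ω → ℝ)
    (φ ν : ConfSpace Ω) : RDual Ω :=
  functionalDeriv (fun μ => L φ μ) ν

/-- The Legendre transform `𝔽L : TV → T⋆V`. -/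
noncomputable def legendre {m : ℕ} {Ω : Set (Eu m)} (L : ConfSpace Ω → ConfSpace Ω → ℝ)
    (φ ν : ConfSpace Ω) : TStar Ω :=
  (φ, deltaNu L φ ν)

/-! ### Canonical forms and canonical Dirac structure on `T⋆V` -/

/-- The restricted bundle `T⋆(TV)`, as pairs of a base point `(φ, ν)` and a covector in
`V⋆ × V⋆`. -/
abbrev TStarT {m : ℕ} (Ω : Set (Eu m)) : Type :=
  (ConfSpace Ω × ConfSpace Ω) × (RDual Ω × RDual Ω)

/-- The bundle `T(T⋆V)`, as pairs of a base point and a tangent vector. -/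
abbrev TTStar {m : ℕ} (Ω : Set (Eu m)) : Type := TStar Ω × TStar Ω

/-- The restricted bundle `T⋆(T⋆V)`, as pairs of a base point and a covector in
`V⋆ × (V⋆)⋆ = V⋆ × V`. -/
abbrev TStarTStar {m : ℕ} (Ω : Set (Eu m)) : Type := TStar Ω × (RDual Ω × ConfSpace Ω)

/-- The value of the covector `(β, ψ) ∈ V⋆ × V` on the tangent vector `(δφ, δα) ∈ V × V⋆`. -/
noncomputable def covectorApply {m : ℕ} {Ω : Set (Eu m)} (ζ : RDual Ω × ConfSpace Ω)
    (w : TStar Ω) : ℝ :=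
  pairing ζ.1 w.1 + pairing w.2 ζ.2

/-- The canonical one-form `Θ(z)·δz = ⟨z, Tπ_V δz⟩`. -/
noncomputable def canonicalOneForm {m : ℕ} {Ω : Set (Eu m)} (z w : TStar Ω) : ℝ :=
  pairing z.2 w.1

/-- The canonical two-form `Ω = -dΘ`, where
`dΘ(z)(u, w) = d/dε|₀ Θ(z + ε u)·w - d/dε|₀ Θ(z + ε w)·u`. -/
noncomputable def canonicalTwoForm {m : ℕ} {Ω : Set (Eu m)} (z u w : TStar Ω) : ℝ :=
  -(deriv (fun ε : ℝ => canonicalOneForm (z + ε • u) w) 0 -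
    deriv (fun ε : ℝ => canonicalOneForm (z + ε • w) u) 0)

/-- The canonical Dirac structure, the graph in `T(T⋆V) ⊕ T⋆(T⋆V)` of the flat map of the
canonical two-form. Its elements are the `(z, u, z', ζ)` with `z' = z` and
`⟨ζ, w⟩ = Ω(z)(u, w)` for all `w`. -/
def canonicalDirac {m : ℕ} (Ω : Set (Eu m)) : Set (TTStar Ω × TStarTStar Ω) :=
  {p | p.2.1 = p.1.1 ∧
    ∀ w : TStar Ω, covectorApply p.2.2 w = canonicalTwoForm p.1.1 p.1.2 w}

/-- The isomorphism `γ : T⋆(TV) → T⋆(T⋆V)`, `(φ, φ̇, α, α̇) ↦ (φ, α̇, -α, φ̇)` of the Tulczyjew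
triple, where `α, α̇ ∈ V⋆`. -/
noncomputable def tulczyjewGamma {m : ℕ} {Ω : Set (Eu m)} (ξ : TStarT Ω) : TStarTStar Ω :=
  ((ξ.1.1, ξ.2.2), (-ξ.2.1, ξ.1.2))

/-- The differential `dL : TV → T⋆(TV)`. -/
noncomputable def lagDiff {m : ℕ} {Ω : Set (Eu m)} (L : ConfSpace Ω → ConfSpace Ω → ℝ)
    (φ ν : ConfSpace Ω) : TStarT Ω :=
  ((φ, ν), (deltaPhi L φ ν, deltaNu L φ ν))

/-- The Dirac differential `d_D L = γ ∘ dL : TV → T⋆(T⋆V)`. -/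
noncomputable def diracDiff {m : ℕ} {Ω : Set (Eu m)} (L : ConfSpace Ω → ConfSpace Ω → ℝ)
    (φ ν : ConfSpace Ω) : TStarTStar Ω :=
  tulczyjewGamma (lagDiff L φ ν)

/-- The Lagrangian force field `F̃ : TV → T⋆(T⋆V)`: the covector at `𝔽L(φ, ν)` with
`⟨F̃(φ, ν), W⟩ = ⟨F(φ, ν), Tπ_V W⟩`, that is `(F(φ, ν), 0) ∈ V⋆ × V`. -/
noncomputable def forceField {m : ℕ} {Ω : Set (Eu m)} (L : ConfSpace Ω → ConfSpace Ω → ℝ)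
    (F : ConfSpace Ω → ConfSpace Ω → RDual Ω) (φ ν : ConfSpace Ω) : TStarTStar Ω :=
  (legendre L φ ν, (F φ ν, 0))

/-- The difference of two elements of the same fiber of `T⋆(T⋆V)`. -/
noncomputable def fiberSub {m : ℕ} {Ω : Set (Eu m)} (ζ ξ : TStarTStar Ω) : TStarTStar Ω :=
  (ζ.1, ζ.2 - ξ.2)

/-! ### Principles and equations of motion on `[t₀, t₁]` -/

/-- A curve `(φ, ν, α, α_∂) : [t₀, t₁] → TV ⊕ T⋆V` with `φ` of class `C^(r+1)` and `ν, α, α_∂` of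
class `C^r`. -/
def IsPontryaginCurve {m : ℕ} {Ω : Set (Eu m)} (t₀ t₁ : ℝ) (r : ℕ∞)
    (φ ν α : ℝ → CInf (closure Ω)) (αb : ℝ → CInf (frontier Ω)) : Prop :=
  IsCurve (Set.Icc t₀ t₁) (r + 1) φ ∧ IsCurve (Set.Icc t₀ t₁) r ν ∧
    IsCurve (Set.Icc t₀ t₁) r α ∧ IsCurve (Set.Icc t₀ t₁) r αb

/-- Lagrange–d'Alembert principle:
`δ ∫ L(φ, φ̇) dt + ∫ ⟨F(φ, φ̇), δφ⟩ dt = 0` for all variations `δφ` of class `C^(r+1)` that vanish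
at `t₀` and `t₁`. -/
def LdAPrinciple {m : ℕ} {Ω : Set (Eu m)} (L : ConfSpace Ω → ConfSpace Ω → ℝ)
    (F : ConfSpace Ω → ConfSpace Ω → RDual Ω) (t₀ t₁ : ℝ) (r : ℕ∞)
    (φ : ℝ → ConfSpace Ω) : Prop :=
  ∀ δφ : ℝ → ConfSpace Ω, IsCurve (Set.Icc t₀ t₁) (r + 1) δφ → δφ t₀ = 0 → δφ t₁ = 0 →
    ∃ d : ℝ,
      HasDerivAt (fun ε : ℝ => ∫ t in t₀..t₁, L (φ t + ε • δφ t)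
        (timeDeriv (Set.Icc t₀ t₁) (fun s => φ s + ε • δφ s) t)) d 0 ∧
      d + (∫ t in t₀..t₁, pairing (F (φ t) (timeDeriv (Set.Icc t₀ t₁) φ t)) (δφ t)) = 0

/-- Lagrange–d'Alembert equations with body force `(F ·).1` and boundary force `(F ·).2`. -/
def LdAEquations {m : ℕ} {Ω : Set (Eu m)} (𝔏 : ℝ → ℝ → Eu m → ℝ)
    (F : ConfSpace Ω → ConfSpace Ω → RDual Ω) (t₀ t₁ : ℝ) (φ : ℝ → ConfSpace Ω) : Prop :=
  ∀ t ∈ Set.Icc t₀ t₁,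
    (∀ x : closure Ω,
      HasDerivWithinAt (fun s => densityNu 𝔏 (φ s) (timeDeriv (Set.Icc t₀ t₁) φ s) x)
        (densityPhi 𝔏 (φ t) (timeDeriv (Set.Icc t₀ t₁) φ t) x
          - divergence (densityGrad 𝔏 (φ t) (timeDeriv (Set.Icc t₀ t₁) φ t)) x
          + (F (φ t) (timeDeriv (Set.Icc t₀ t₁) φ t)).1 x) (Set.Icc t₀ t₁) t) ∧
    (∀ x : frontier Ω,
      (F (φ t) (timeDeriv (Set.Icc t₀ t₁) φ t)).2 x =
        -inner ℝ (densityGrad 𝔏 (φ t) (timeDeriv (Set.Icc t₀ t₁) φ t) (bdryIncl x))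
          (outwardNormal Ω x))

/-- Lagrange–d'Alembert–Pontryagin principle:
`δ ∫ [L(φ, ν) + ⟨(α, α_∂), φ̇ - ν⟩] dt + ∫ ⟨F(φ, ν), δφ⟩ dt = 0` for all variations
`(δφ, δν, δα, δα_∂)` in the class of the curves, with `δφ` vanishing at `t₀` and `t₁`. -/
def LdAPPrinciple {m : ℕ} {Ω : Set (Eu m)} (L : ConfSpace Ω → ConfSpace Ω → ℝ)
    (F : ConfSpace Ω → ConfSpace Ω → RDual Ω) (t₀ t₁ : ℝ) (r : ℕ∞)
    (φ ν α : ℝ → CInf (closure Ω)) (αb : ℝ → CInf (frontier Ω)) : Prop :=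
  ∀ (δφ δν δα : ℝ → CInf (closure Ω)) (δαb : ℝ → CInf (frontier Ω)),
    IsPontryaginCurve t₀ t₁ r δφ δν δα δαb → δφ t₀ = 0 → δφ t₁ = 0 →
    ∃ d : ℝ,
      HasDerivAt (fun ε : ℝ => ∫ t in t₀..t₁,
        (L (φ t + ε • δφ t) (ν t + ε • δν t) +
          pairing (α t + ε • δα t, αb t + ε • δαb t)
            (timeDeriv (Set.Icc t₀ t₁) (fun s => φ s + ε • δφ s) t - (ν t + ε • δν t)))) d 0 ∧
      d + (∫ t in t₀..t₁, pairing (F (φ t) (ν t)) (δφ t)) = 0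

/-- Lagrange–d'Alembert–Pontryagin equations. -/
def LdAPEquations {m : ℕ} {Ω : Set (Eu m)} (𝔏 : ℝ → ℝ → Eu m → ℝ)
    (F : ConfSpace Ω → ConfSpace Ω → RDual Ω) (t₀ t₁ : ℝ)
    (φ ν α : ℝ → CInf (closure Ω)) (αb : ℝ → CInf (frontier Ω)) : Prop :=
  ∀ t ∈ Set.Icc t₀ t₁,
    timeDeriv (Set.Icc t₀ t₁) φ t = ν t ∧
    (∀ x : closure Ω, α t x = densityNu 𝔏 (φ t) (ν t) x) ∧
    (∀ x : closure Ω, timeDeriv (Set.Icc t₀ t₁) α t x =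
      densityPhi 𝔏 (φ t) (ν t) x - divergence (densityGrad 𝔏 (φ t) (ν t)) x
        + (F (φ t) (ν t)).1 x) ∧
    αb t = 0 ∧
    (∀ x : frontier Ω, timeDeriv (Set.Icc t₀ t₁) αb t x =
      inner ℝ (densityGrad 𝔏 (φ t) (ν t) (bdryIncl x)) (outwardNormal Ω x)
        + (F (φ t) (ν t)).2 x)

/-- Lagrange–Dirac system
`((φ, α, α_∂, φ̇, α̇, α̇_∂), d_D L(φ, ν) - F̃(φ, ν)) ∈ D_{T⋆V}(φ, α, α_∂)`. -/
def LagrangeDirac {m : ℕ} {Ω : Set (Eu m)} (L : ConfSpace Ω → ConfSpace Ω → ℝ)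
    (F : ConfSpace Ω → ConfSpace Ω → RDual Ω) (t₀ t₁ : ℝ)
    (φ ν α : ℝ → CInf (closure Ω)) (αb : ℝ → CInf (frontier Ω)) : Prop :=
  ∀ t ∈ Set.Icc t₀ t₁,
    (((φ t, (α t, αb t)),
        (timeDeriv (Set.Icc t₀ t₁) φ t,
          (timeDeriv (Set.Icc t₀ t₁) α t, timeDeriv (Set.Icc t₀ t₁) αb t))),
      fiberSub (diracDiff L (φ t) (ν t)) (forceField L F (φ t) (ν t))) ∈ canonicalDirac Ω

/-- The curves `ν, α, α_∂` are those reconstructed from `φ`: `ν = φ̇` and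
`(φ, α, α_∂) = 𝔽L(φ, ν)`. -/
def IsReconstructed {m : ℕ} {Ω : Set (Eu m)} (L : ConfSpace Ω → ConfSpace Ω → ℝ) (t₀ t₁ : ℝ)
    (φ ν α : ℝ → CInf (closure Ω)) (αb : ℝ → CInf (frontier Ω)) : Prop :=
  ∀ t ∈ Set.Icc t₀ t₁, ν t = timeDeriv (Set.Icc t₀ t₁) φ t ∧
    ((φ t, (α t, αb t)) : TStar Ω) = legendre L (φ t) (ν t)

/-! # Lagrange–Dirac systems with boundary terms for Lagrangian densities

All the statements are equivalent to one system in `V` and `V⋆` (`IsSolution`):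
`φ̇ = ν`, `(α, α_∂) = δL/δν` and `(α̇, α̇_∂) = δL/δφ + F`. Three facts make this work.

*Functional derivatives.* The divergence theorem on `Ω` moves the derivatives off the variation in
`∫ ∂𝔏/∂∇φ · ∇δφ dx` and gives `δL/δφ = (∂𝔏/∂φ - div ∂𝔏/∂∇φ, ∂𝔏/∂∇φ · n)` and `δL/δν = (∂𝔏/∂ν, 0)`
(`IsSmoothBoundedDomain.deltaPhi_lagrangian`, `IsSmoothBoundedDomain.deltaNu_lagrangian`). Since the
area element is a Hausdorff measure, the divergence theorem
(`IsSmoothBoundedDomain.divergence_theorem`) rests on the area formula for graphs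
(`comap_euclideanHausdorffMeasure`), on a shear that straightens the graph to a half-space, and on a
partition of unity.

*Nondegeneracy.* The pairing of `V⋆` with `V` separates points on both sides
(`IsSmoothBoundedDomain.eq_zero_of_pairing`, `IsSmoothBoundedDomain.eq_zero_of_pairing_right`): smooth
test functions supported in `Ω` detect the body part, and then arbitrary ones detect the boundary
part, because the area element charges every open piece of the boundary. Hence functional derivatives
are unique, the condition `(u, ζ) ∈ D` for the canonical Dirac structure splits into its components,
and the fundamental lemma of the calculus of variations holds for curves in `V` and `V⋆`.

*Calculus in time.* The Fréchet topology of `C^∞(K)` makes superposition operators `(φ_j) ↦ g ∘ (φ_j)`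
continuous (`CInf.continuous_nem`). By Hadamard's lemma the difference quotient of such an operator
along a curve is again a superposition operator, of the curve and of its difference quotients, which
gives the chain rule and the class `C^k` (`CInf.hasTimeDeriv_nem`, `CInf.isCurve_nem`). As the integral
is a continuous linear functional, the same chain rule, applied to lines `φ + ε δφ`, yields the first
variation of `L`. Integration by parts in time then turns the two variational principles into the
equations above.

For the equations on `𝓑` and `∂𝓑`, pointwise time derivatives are the evaluations of derivatives in
the Fréchet topology, and `α_∂ = 0` forces `α̇_∂ = 0`, so that the boundary momentum equation becomes
the boundary condition `F_∂ = -∂𝔏/∂∇φ · n`.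
-/

/-! ### Convergence of jets -/

/-- Continuous convergence of the maps `u a` to `f` along `l`, together with their derivatives of
order at most `n`. Continuous convergence, `u a y → f x` as `(a, y) → (l, x)`, is locally uniform
convergence when `f` is continuous, and passes through compositions without any uniformity. -/
def JetTendsto {E : Type} [NormedAddCommGroup E] [NormedSpace ℝ E] {α : Type} (l : Filter α) :
    ∀ (_ : ℕ) {F : Type} [NormedAddCommGroup F] [NormedSpace ℝ F], (α → E → F) → (E → F) → Prop
  | 0, _, _, _, u, f => ∀ x, Tendsto (fun p : α × E => u p.1 p.2) (l ×ˢ 𝓝 x) (𝓝 (f x))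
  | n + 1, _, _, _, u, f =>
    (∀ x, Tendsto (fun p : α × E => u p.1 p.2) (l ×ˢ 𝓝 x) (𝓝 (f x))) ∧
      JetTendsto l n (fun a => fderiv ℝ (u a)) (fderiv ℝ f)

namespace JetTendsto

variable {E F G H : Type} [NormedAddCommGroup E] [NormedSpace ℝ E]
  [NormedAddCommGroup F] [NormedSpace ℝ F] [NormedAddCommGroup G] [NormedSpace ℝ G]
  [NormedAddCommGroup H] [NormedSpace ℝ H] {α : Type} {l : Filter α} {n : ℕ}

theorem tendsto {u : α → E → F} {f : E → F} (h : JetTendsto l n u f) (x : E) :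
    Tendsto (fun p : α × E => u p.1 p.2) (l ×ˢ 𝓝 x) (𝓝 (f x)) := by
  cases n with
  | zero => exact h x
  | succ n => exact h.1 x

theorem of_succ {u : α → E → F} {f : E → F} (h : JetTendsto l (n + 1) u f) :
    JetTendsto l n u f := by
  induction n generalizing F with
  | zero => exact h.1
  | succ n ih => exact ⟨h.1, ih h.2⟩

theorem iff_iteratedFDeriv {u : α → E → F} {f : E → F} :
    JetTendsto l n u f ↔ ∀ k ≤ n, ∀ x, Tendsto
      (fun p : α × E => iteratedFDeriv ℝ k (u p.1) p.2) (l ×ˢ 𝓝 x) (𝓝 (iteratedFDeriv ℝ k f x)) := by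
  have h0 : ∀ {F : Type} [NormedAddCommGroup F] [NormedSpace ℝ F] {u : α → E → F} {f : E → F},
      (∀ x, Tendsto (fun p : α × E => u p.1 p.2) (l ×ˢ 𝓝 x) (𝓝 (f x))) ↔
      ∀ x, Tendsto (fun p : α × E => iteratedFDeriv ℝ 0 (u p.1) p.2) (l ×ˢ 𝓝 x)
        (𝓝 (iteratedFDeriv ℝ 0 f x)) := by
    intro F _ _ u f
    simp only [iteratedFDeriv_zero_eq_comp, Function.comp_apply]
    refine forall_congr' fun x => ?_
    exact (continuousMultilinearCurryFin0 ℝ E F).symm.toHomeomorph.isInducing.tendsto_nhds_iff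
  induction n generalizing F with
  | zero =>
    simp only [Nat.le_zero, forall_eq]
    exact h0
  | succ n ih =>
    simp only [JetTendsto, ih]
    rw [h0]
    have h1 : ∀ k x, Tendsto (fun p : α × E => iteratedFDeriv ℝ (k + 1) (u p.1) p.2) (l ×ˢ 𝓝 x)
        (𝓝 (iteratedFDeriv ℝ (k + 1) f x)) ↔ Tendsto
        (fun p : α × E => iteratedFDeriv ℝ k (fderiv ℝ (u p.1)) p.2) (l ×ˢ 𝓝 x)
        (𝓝 (iteratedFDeriv ℝ k (fderiv ℝ f) x)) := by
      intro k x
      simp only [iteratedFDeriv_succ_eq_comp_right, Function.comp_apply]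
      exact ((continuousMultilinearCurryRightEquiv' ℝ k E
        F).symm.toHomeomorph.isInducing.tendsto_nhds_iff).symm
    constructor
    · rintro ⟨ha, hb⟩ k hk
      cases k with
      | zero => exact ha
      | succ k => exact fun x => (h1 k x).2 (hb k (by omega) x)
    · intro h
      exact ⟨h 0 (by omega), fun k hk x => (h1 k x).1 (h (k + 1) (by omega) x)⟩

theorem congr {u u' : α → E → F} {f f' : E → F} (h : JetTendsto l n u f)
    (hu : ∀ a x, u' a x = u a x) (hf : ∀ x, f' x = f x) : JetTendsto l n u' f' := by
  have h1 : u' = u := funext fun a => funext (hu a)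
  have h2 : f' = f := funext hf
  rwa [h1, h2]

theorem const (f : E → F) (hf : ContDiff ℝ ∞ f) : JetTendsto l n (fun _ => f) f := by
  induction n generalizing F with
  | zero => exact fun x => hf.continuous.continuousAt.tendsto.comp tendsto_snd
  | succ n ih =>
    exact ⟨fun x => hf.continuous.continuousAt.tendsto.comp tendsto_snd,
      ih _ (contDiff_infty_iff_fderiv.1 hf).2⟩

theorem add {u v : α → E → F} {f g : E → F} (hu : ∀ a, ContDiff ℝ ∞ (u a)) (hf : ContDiff ℝ ∞ f)
    (hv : ∀ a, ContDiff ℝ ∞ (v a)) (hg : ContDiff ℝ ∞ g)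
    (h : JetTendsto l n u f) (h' : JetTendsto l n v g) :
    JetTendsto l n (fun a x => u a x + v a x) (fun x => f x + g x) := by
  induction n generalizing F with
  | zero => exact fun x => (h x).add (h' x)
  | succ n ih =>
    refine ⟨fun x => (h.1 x).add (h'.1 x), ?_⟩
    refine (ih (fun a => (contDiff_infty_iff_fderiv.1 (hu a)).2) (contDiff_infty_iff_fderiv.1 hf).2
      (fun a => (contDiff_infty_iff_fderiv.1 (hv a)).2) (contDiff_infty_iff_fderiv.1 hg).2
      h.2 h'.2).congr (fun a x => ?_) (fun x => ?_)
    · exact fderiv_fun_add ((contDiff_infty_iff_fderiv.1 (hu a)).1 x)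
        ((contDiff_infty_iff_fderiv.1 (hv a)).1 x)
    · exact fderiv_fun_add ((contDiff_infty_iff_fderiv.1 hf).1 x)
        ((contDiff_infty_iff_fderiv.1 hg).1 x)

theorem sum {ι : Type*} (s : Finset ι) {u : ι → α → E → F} {f : ι → E → F}
    (hu : ∀ i a, ContDiff ℝ ∞ (u i a)) (hf : ∀ i, ContDiff ℝ ∞ (f i))
    (h : ∀ i, JetTendsto l n (u i) (f i)) :
    JetTendsto l n (fun a x => ∑ i ∈ s, u i a x) (fun x => ∑ i ∈ s, f i x) := by
  classical
  induction s using Finset.induction_on with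
  | empty => simpa using const (l := l) (n := n) (fun _ : E => (0 : F)) contDiff_const
  | insert i s hi ih =>
    simp only [Finset.sum_insert hi]
    exact (h i).add (hu i) (hf i) (fun a => ContDiff.sum fun j _ => hu j a)
      (ContDiff.sum fun j _ => hf j) ih

theorem tendsto_bilin (B : F →L[ℝ] G →L[ℝ] H) {u : α → E → F} {f : E → F} {v : α → E → G}
    {g : E → G} (h : JetTendsto l n u f) (h' : JetTendsto l n v g) (x : E) :
    Tendsto (fun p : α × E => B (u p.1 p.2) (v p.1 p.2)) (l ×ˢ 𝓝 x) (𝓝 (B (f x) (g x))) :=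
  (B.isBoundedBilinearMap.continuous.tendsto (f x, g x)).comp
    ((h.tendsto x).prodMk_nhds (h'.tendsto x))

theorem bilin (B : F →L[ℝ] G →L[ℝ] H) {u : α → E → F} {f : E → F} {v : α → E → G} {g : E → G}
    (hu : ∀ a, ContDiff ℝ ∞ (u a)) (hf : ContDiff ℝ ∞ f)
    (hv : ∀ a, ContDiff ℝ ∞ (v a)) (hg : ContDiff ℝ ∞ g)
    (h : JetTendsto l n u f) (h' : JetTendsto l n v g) :
    JetTendsto l n (fun a x => B (u a x) (v a x)) (fun x => B (f x) (g x)) := by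
  induction n generalizing F G H with
  | zero => exact h.tendsto_bilin B h'
  | succ n ih =>
    refine ⟨h.tendsto_bilin B h', ?_⟩
    have hfd : ∀ {F : Type} [NormedAddCommGroup F] [NormedSpace ℝ F] {f : E → F},
      ContDiff ℝ ∞ f → ContDiff ℝ ∞ (fderiv ℝ f) := fun hf => (contDiff_infty_iff_fderiv.1 hf).2
    have hd : ∀ {F : Type} [NormedAddCommGroup F] [NormedSpace ℝ F] {f : E → F},
      ContDiff ℝ ∞ f → Differentiable ℝ f := fun hf => (contDiff_infty_iff_fderiv.1 hf).1
    have hB : ∀ {F G H : Type} [NormedAddCommGroup F] [NormedSpace ℝ F] [NormedAddCommGroup G]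
      [NormedSpace ℝ G] [NormedAddCommGroup H] [NormedSpace ℝ H] (B : F →L[ℝ] G →L[ℝ] H)
      {f : E → F} {g : E → G}, ContDiff ℝ ∞ f → ContDiff ℝ ∞ g →
      ContDiff ℝ ∞ (fun x => B (f x) (g x)) := fun B f g hf hg =>
        B.isBoundedBilinearMap.contDiff.comp (hf.prodMk hg)
    have h1 := ih (B.precompR E) hu hf (fun a => hfd (hv a)) (hfd hg) h.of_succ h'.2
    have h2 := ih (B.precompL E) (fun a => hfd (hu a)) (hfd hf) hv hg h.2 h'.of_succ
    refine (h1.add (fun a => hB _ (hu a) (hfd (hv a))) (hB _ hf (hfd hg))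
      (fun a => hB _ (hfd (hu a)) (hv a)) (hB _ (hfd hf) hg) h2).congr (fun a x => ?_) (fun x => ?_)
    · exact B.fderiv_of_bilinear (hd (hu a) x) (hd (hv a) x)
    · exact B.fderiv_of_bilinear (hd hf x) (hd hg x)

theorem comp {u : α → E → F} {f : E → F} {g : F → G} (hg : ContDiff ℝ ∞ g)
    (hu : ∀ a, ContDiff ℝ ∞ (u a)) (hf : ContDiff ℝ ∞ f) (h : JetTendsto l n u f) :
    JetTendsto l n (fun a x => g (u a x)) (fun x => g (f x)) := by
  induction n generalizing G with
  | zero => exact fun x => (hg.continuous.tendsto _).comp (h x)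
  | succ n ih =>
    refine ⟨fun x => (hg.continuous.tendsto _).comp (h.1 x), ?_⟩
    have hd := (contDiff_infty_iff_fderiv.1 hg)
    refine (bilin (ContinuousLinearMap.compL ℝ E F G) (fun a => hd.2.comp (hu a)) (hd.2.comp hf)
      (fun a => (contDiff_infty_iff_fderiv.1 (hu a)).2) (contDiff_infty_iff_fderiv.1 hf).2
      (ih hd.2 h.of_succ) h.2).congr (fun a x => ?_) (fun x => ?_)
    · exact fderiv_comp x (hd.1 _) ((contDiff_infty_iff_fderiv.1 (hu a)).1 x)
    · exact fderiv_comp x (hd.1 _) ((contDiff_infty_iff_fderiv.1 hf).1 x)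

theorem pi {ι : Type} [Fintype ι] {u : α → E → ι → ℝ} {f : E → ι → ℝ}
    (hu : ∀ a, ContDiff ℝ ∞ (u a)) (hf : ContDiff ℝ ∞ f)
    (h : ∀ j, JetTendsto l n (fun a x => u a x j) (fun x => f x j)) : JetTendsto l n u f := by
  classical
  have hu' := fun a => contDiff_pi.1 (hu a)
  have hf' := contDiff_pi.1 hf
  refine (sum (l := l) (n := n) Finset.univ (F := ι → ℝ)
    (u := fun j a x => ContinuousLinearMap.single ℝ (fun _ : ι => ℝ) j (u a x j))
    (f := fun j x => ContinuousLinearMap.single ℝ (fun _ : ι => ℝ) j (f x j))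
    (fun j a => (ContinuousLinearMap.contDiff _).comp (hu' a j))
    (fun j => (ContinuousLinearMap.contDiff _).comp (hf' j))
    (fun j => comp (ContinuousLinearMap.contDiff _) (fun a => hu' a j) (hf' j) (h j))).congr
      (fun a x => ?_) (fun x => ?_)
  · exact (Finset.univ_sum_single (u a x)).symm
  · exact (Finset.univ_sum_single (f x)).symm

end JetTendsto

/-! ### Nemytskii operators and the linear topology of `C^∞(K)` -/

/-- The Fréchet space `C^∞(ℝ^m)`. It is a synonym of the subtype of smooth functions, which would
otherwise carry the topology of pointwise convergence. -/
def SmoothFun (m : ℕ) : Type := {F : Eu m → ℝ // ContDiff ℝ ∞ F}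

/-- The continuous map of derivatives of order `k`. -/
noncomputable def SmoothFun.iteratedDeriv {m : ℕ} (k : ℕ) (F : SmoothFun m) :
    C(Eu m, ContinuousMultilinearMap ℝ (fun _ : Fin k => Eu m) ℝ) :=
  ⟨iteratedFDeriv ℝ k F.1, F.2.continuous_iteratedFDeriv (by exact_mod_cast le_top)⟩

noncomputable instance (m : ℕ) : TopologicalSpace (SmoothFun m) :=
  ⨅ k : ℕ, TopologicalSpace.induced (SmoothFun.iteratedDeriv k) ContinuousMap.compactOpen

/-- The constant function `c`. -/
def SmoothFun.const (m : ℕ) (c : ℝ) : SmoothFun m := ⟨fun _ => c, contDiff_const⟩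

theorem SmoothFun.tendsto_iff {m : ℕ} {α : Type} {l : Filter α} {u : α → SmoothFun m}
    {F : SmoothFun m} : Tendsto u l (𝓝 F) ↔
      ∀ n, JetTendsto l n (fun a => (u a).1) F.1 := by
  have h1 : 𝓝 F = ⨅ k : ℕ, comap (SmoothFun.iteratedDeriv k) (𝓝 (F.iteratedDeriv k)) := by
    simp only [nhds_iInf, nhds_induced]
  rw [h1, tendsto_iInf]
  simp only [tendsto_comap_iff]
  have h2 : ∀ k : ℕ, Tendsto (SmoothFun.iteratedDeriv k ∘ u) l (𝓝 (F.iteratedDeriv k)) ↔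
      ∀ x, Tendsto (fun p : α × Eu m => iteratedFDeriv ℝ k (u p.1).1 p.2) (l ×ˢ 𝓝 x)
        (𝓝 (iteratedFDeriv ℝ k F.1 x)) := by
    intro k
    rw [ContinuousMap.tendsto_iff_tendstoLocallyUniformly,
      tendstoLocallyUniformly_iff_forall_tendsto]
    refine forall_congr' fun x => ?_
    have hc : Continuous (iteratedFDeriv ℝ k F.1) :=
      F.2.continuous_iteratedFDeriv (by exact_mod_cast le_top)
    have hc' : Tendsto (fun y : α × Eu m => iteratedFDeriv ℝ k F.1 y.2) (l ×ˢ 𝓝 x)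
        (𝓝 (iteratedFDeriv ℝ k F.1 x)) := (hc.tendsto x).comp tendsto_snd
    constructor
    · intro h
      exact hc'.congr_uniformity h
    · intro h
      exact (hc'.prodMk_nhds h).mono_right (nhds_le_uniformity _)
  constructor
  · intro h n
    exact JetTendsto.iff_iteratedFDeriv.2 fun k _ => (h2 k).1 (h k)
  · intro h k
    exact (h2 k).2 (JetTendsto.iff_iteratedFDeriv.1 (h k) k le_rfl)

/-- The operator `(F_j) ↦ g ∘ (F_j)` on smooth functions on `ℝ^m`. -/
def SmoothFun.nem {m : ℕ} {ι : Type} [Fintype ι] (g : (ι → ℝ) → ℝ) (hg : ContDiff ℝ ∞ g)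
    (F : ι → SmoothFun m) : SmoothFun m :=
  ⟨fun x => g fun j => (F j).1 x, hg.comp (contDiff_pi.2 fun j => (F j).2)⟩

theorem SmoothFun.continuous_nem {m : ℕ} {ι : Type} [Fintype ι] (g : (ι → ℝ) → ℝ)
    (hg : ContDiff ℝ ∞ g) : Continuous (SmoothFun.nem (m := m) g hg) := by
  refine continuous_iff_continuousAt.2 fun F => ?_
  refine SmoothFun.tendsto_iff.2 fun n => ?_
  refine JetTendsto.comp (u := fun (a : ι → SmoothFun m) x j => (a j).1 x) hg
    (fun a => contDiff_pi.2 fun j => (a j).2) (contDiff_pi.2 fun j => (F j).2) ?_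
  refine JetTendsto.pi (fun a => contDiff_pi.2 fun j => (a j).2) (contDiff_pi.2 fun j => (F j).2) ?_
  intro j
  exact SmoothFun.tendsto_iff.1 (tendsto_pi_nhds.1 tendsto_id j) n

/-- The constant functions depend continuously on their value. -/
theorem SmoothFun.continuous_const (m : ℕ) :
    Continuous (SmoothFun.const m) := by
  refine continuous_iff_continuousAt.2 fun c => SmoothFun.tendsto_iff.2 fun n => ?_
  cases n with
  | zero => exact fun x => tendsto_fst
  | succ n =>
    refine ⟨fun x => tendsto_fst, ?_⟩
    refine (JetTendsto.const (fun _ => (0 : Eu m →L[ℝ] ℝ)) contDiff_const).congr ?_ ?_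
    · intro a x; exact fderiv_const_apply _
    · intro x; exact fderiv_const_apply _

theorem SmoothFun.continuous_eval (m : ℕ) :
    Continuous (fun p : SmoothFun m × Eu m => p.1.1 p.2) := by
  refine continuous_iff_continuousAt.2 fun p => ?_
  have h := (SmoothFun.tendsto_iff.1 (tendsto_id (x := 𝓝 p.1)) 0) p.2
  rwa [ContinuousAt, show p = (p.1, p.2) from rfl, nhds_prod_eq]

namespace CInf

variable {m : ℕ} {K : Set (Eu m)}

@[ext] theorem ext {φ ψ : CInf K} (h : ∀ x, φ x = ψ x) : φ = ψ := Subtype.ext (funext h)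

@[simp] theorem add_apply (φ ψ : CInf K) (x : K) : (φ + ψ) x = φ x + ψ x := rfl
@[simp] theorem sub_apply (φ ψ : CInf K) (x : K) : (φ - ψ) x = φ x - ψ x := rfl
@[simp] theorem neg_apply (φ : CInf K) (x : K) : (-φ) x = -φ x := rfl
@[simp] theorem smul_apply (c : ℝ) (φ : CInf K) (x : K) : (c • φ) x = c * φ x := rfl
@[simp] theorem zero_apply (x : K) : (0 : CInf K) x = 0 := rfl

/-- The restriction map `C^∞(ℝ^m) → C^∞(K)`. -/
def res (K : Set (Eu m)) : SmoothFun m → CInf K := restrictSmooth K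

@[simp] theorem res_apply (F : SmoothFun m) (x : K) : res K F x = F.1 x := rfl

theorem res_surjective : Function.Surjective (res K) := by
  rintro ⟨f, F, hF, h⟩
  exact ⟨⟨F, hF⟩, CInf.ext h⟩

/-- The quotient topology is linear because the restriction map is open: the saturation of an open
set is a union of translates. -/
theorem isOpenQuotientMap_res : IsOpenQuotientMap (res K) := by
  have hq : IsQuotientMap (res K) := ⟨⟨rfl⟩, res_surjective⟩
  refine ⟨res_surjective, hq.continuous, fun U hU => ?_⟩
  rw [← hq.isOpen_preimage]
  have hg : ContDiff ℝ ∞ (fun u : Fin 2 → ℝ => u 0 - u 1) := by fun_prop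
  have h : res K ⁻¹' (res K '' U) = ⋃ h ∈ {h : SmoothFun m | ∀ x : K, h.1 x = 0},
      (fun F : SmoothFun m => SmoothFun.nem _ hg ![F, h]) ⁻¹' U := by
    ext F
    simp only [Set.mem_preimage, Set.mem_image, Set.mem_iUnion, Set.mem_ofPred_eq, exists_prop]
    constructor
    · rintro ⟨G, hG, h⟩
      refine ⟨⟨fun x => F.1 x - G.1 x, F.2.sub G.2⟩, fun x => ?_, ?_⟩
      · have := congrArg (fun φ : CInf K => φ x) h
        simp only [res_apply] at this
        simp [this]
      · convert hG using 1
        apply Subtype.ext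
        funext x
        simp [SmoothFun.nem]
    · rintro ⟨h, h0, hU⟩
      refine ⟨_, hU, CInf.ext fun x => ?_⟩
      change F.1 x - h.1 x = F.1 x
      rw [h0 x, sub_zero]
  rw [h]
  refine isOpen_biUnion fun h _ => hU.preimage ?_
  refine (SmoothFun.continuous_nem _ hg).comp (continuous_pi fun j => ?_)
  fin_cases j
  · exact continuous_id
  · exact continuous_const

/-- The Nemytskii operator `(φ_j) ↦ g ∘ (φ_j)` on `C^∞(K)`. -/
def nem {ι : Type} [Fintype ι] (g : (ι → ℝ) → ℝ) (hg : ContDiff ℝ ∞ g) (φ : ι → CInf K) : CInf K :=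
  ⟨fun x => g fun j => φ j x, by
    choose F hF h using fun j => (φ j).2
    exact ⟨fun x => g fun j => F j x, hg.comp (contDiff_pi.2 hF), fun x => by simp only [h]⟩⟩

@[simp] theorem nem_apply {ι : Type} [Fintype ι] (g : (ι → ℝ) → ℝ) (hg : ContDiff ℝ ∞ g)
    (φ : ι → CInf K) (x : K) : nem g hg φ x = g fun j => φ j x := rfl

theorem continuous_nem {ι : Type} [Fintype ι] (g : (ι → ℝ) → ℝ) (hg : ContDiff ℝ ∞ g) :
    Continuous (nem (K := K) g hg) := by
  refine (IsOpenQuotientMap.piMap fun _ : ι => isOpenQuotientMap_res (K := K)).continuous_comp_iff.1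
    ?_
  exact isOpenQuotientMap_res.continuous.comp (SmoothFun.continuous_nem g hg)

theorem continuous_eval : Continuous (fun p : CInf K × K => p.1 p.2) := by
  refine ((isOpenQuotientMap_res (K := K)).prodMap IsOpenQuotientMap.id).continuous_comp_iff.1 ?_
  exact (SmoothFun.continuous_eval m).comp (continuous_fst.prodMk
    (continuous_subtype_val.comp continuous_snd))

theorem continuous_apply (x : K) : Continuous (fun φ : CInf K => φ x) :=
  continuous_eval.comp (continuous_id.prodMk continuous_const)

theorem continuous_coe (φ : CInf K) : Continuous φ.1 :=
  continuous_eval.comp (continuous_const.prodMk continuous_id)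

instance : T2Space (CInf K) :=
  T2Space.of_injective_continuous (f := fun (φ : CInf K) x => φ x) (fun _ _ h => CInf.ext (congrFun h))
    (continuous_pi continuous_apply)

instance : ContinuousAdd (CInf K) := by
  refine ⟨?_⟩
  have hg : ContDiff ℝ ∞ (fun u : Fin 2 → ℝ => u 0 + u 1) := by fun_prop
  have : (fun p : CInf K × CInf K => p.1 + p.2) = fun p => nem _ hg ![p.1, p.2] := rfl
  rw [this]
  refine (continuous_nem _ hg).comp (continuous_pi fun j => ?_)
  fin_cases j
  · exact continuous_fst
  · exact continuous_snd

instance : ContinuousSMul ℝ (CInf K) := by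
  refine ⟨?_⟩
  have hg : ContDiff ℝ ∞ (fun u : Fin 2 → ℝ => u 0 * u 1) := by fun_prop
  have : (fun p : ℝ × CInf K => p.1 • p.2) =
    fun p => nem _ hg ![res K (SmoothFun.const m p.1), p.2] := rfl
  rw [this]
  refine (continuous_nem _ hg).comp (continuous_pi fun j => ?_)
  fin_cases j
  · exact isOpenQuotientMap_res.continuous.comp
      ((SmoothFun.continuous_const m).comp continuous_fst)
  · exact continuous_snd

instance : IsTopologicalAddGroup (CInf K) where
  continuous_neg := by
    have : (fun φ : CInf K => -φ) = fun φ => (-1 : ℝ) • φ := by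
      funext φ; simp
    rw [this]
    exact continuous_const_smul _

end CInf

/-! ### Hadamard's lemma -/

theorem contDiff_integral_unitInterval {E F : Type} [NormedAddCommGroup E] [NormedSpace ℝ E]
    [FiniteDimensional ℝ E] [NormedAddCommGroup F] [NormedSpace ℝ F] {f : E → ℝ → F}
    (hf : ContDiff ℝ ∞ (fun p : E × ℝ => f p.1 p.2)) :
    ContDiff ℝ ∞ (fun x => ∫ s in (0 : ℝ)..1, f x s) := by
  refine contDiff_infty.2 fun n => ?_
  induction n generalizing F with
  | zero =>
    exact contDiff_zero.2
      (intervalIntegral.continuous_parametric_intervalIntegral_of_continuous' hf.continuous 0 1)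
  | succ n ih =>
    have hd := contDiff_infty_iff_fderiv.1 hf
    set f' : E → ℝ → E →L[ℝ] F := fun x s =>
      (fderiv ℝ (fun p : E × ℝ => f p.1 p.2) (x, s)).comp (ContinuousLinearMap.inl ℝ E ℝ) with hf'
    have hf'c : ContDiff ℝ ∞ (fun p : E × ℝ => f' p.1 p.2) := hd.2.clm_comp contDiff_const
    have hder : ∀ x s, HasFDerivAt (fun x => f x s) (f' x s) x := by
      intro x s
      have h1 : HasFDerivAt (fun x : E => (x, s)) (ContinuousLinearMap.inl ℝ E ℝ) x :=
        hasFDerivAt_prodMk_left x s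
      exact HasFDerivAt.comp x (hd.1 (x, s)).hasFDerivAt h1
    refine contDiff_succ_iff_hasFDerivAt.2 ⟨fun x => ∫ s in (0 : ℝ)..1, f' x s, ih hf'c, ?_⟩
    intro x
    obtain ⟨C, hC⟩ := ((isCompact_closedBall x 1).prod (isCompact_Icc (a := (0 : ℝ)) (b := 1))
      ).exists_bound_of_continuousOn hf'c.continuous.continuousOn
    have hcs : ∀ x, Continuous (f x) := fun x =>
      hf.continuous.comp (continuous_const.prodMk continuous_id)
    have hcs' : ∀ x, Continuous (f' x) := fun x =>
      hf'c.continuous.comp (continuous_const.prodMk continuous_id)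
    refine intervalIntegral.hasFDerivAt_integral_of_dominated_of_fderiv_le (𝕜 := ℝ)
      (s := Metric.closedBall x 1) (bound := fun _ => C) (Metric.closedBall_mem_nhds x one_pos)
      (Eventually.of_forall fun y => (hcs y).aestronglyMeasurable)
      ((hcs x).intervalIntegrable _ _) (hcs' x).aestronglyMeasurable ?_
      intervalIntegrable_const ?_
    · refine Eventually.of_forall fun s hs y hy => hC (y, s) ⟨hy, ?_⟩
      rw [Set.uIoc_of_le zero_le_one] at hs
      exact ⟨hs.1.le, hs.2⟩
    · exact Eventually.of_forall fun s _ y _ => hder y s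

/-- The averaged differential `∫₀¹ Dg(u + s (v - u)) d ds`, so that
`g v - g u = hadamard g u v (v - u)`. -/
noncomputable def hadamard {ι : Type} [Fintype ι] (g : (ι → ℝ) → ℝ) (u v d : ι → ℝ) : ℝ :=
  ∫ s in (0 : ℝ)..1, fderiv ℝ g (u + s • (v - u)) d

section Hadamard

variable {ι : Type} [Fintype ι] {g : (ι → ℝ) → ℝ}

theorem hadamard_sub (hg : ContDiff ℝ ∞ g) (u v : ι → ℝ) :
    hadamard g u v (v - u) = g v - g u := by
  have hd := contDiff_infty_iff_fderiv.1 hg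
  have h := intervalIntegral.integral_eq_sub_of_hasDerivAt (a := 0) (b := 1)
    (f := fun s : ℝ => g (u + s • (v - u)))
    (f' := fun s : ℝ => fderiv ℝ g (u + s • (v - u)) (v - u)) (fun s _ => by
      have h1 : HasDerivAt (fun s : ℝ => u + s • (v - u)) (v - u) s := by
        simpa using ((hasDerivAt_id s).smul_const (v - u)).const_add u
      exact (hd.1 _).hasFDerivAt.comp_hasDerivAt s h1)
    (Continuous.intervalIntegrable (by
      have := hd.2.continuous
      fun_prop) _ _)
  simpa [hadamard] using h

theorem hadamard_smul (u v d : ι → ℝ) (c : ℝ) : hadamard g u v (c • d) = c * hadamard g u v d := by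
  simp [hadamard, intervalIntegral.integral_const_mul]

theorem hadamard_self (u d : ι → ℝ) : hadamard g u u d = fderiv ℝ g u d := by
  simp [hadamard]

theorem contDiff_hadamard (hg : ContDiff ℝ ∞ g) :
    ContDiff ℝ ∞ (fun w : ι ⊕ ι ⊕ ι → ℝ => hadamard g (fun j => w (.inl j))
      (fun j => w (.inr (.inl j))) (fun j => w (.inr (.inr j)))) := by
  have hd := contDiff_infty_iff_fderiv.1 hg
  refine contDiff_integral_unitInterval (E := ι ⊕ ι ⊕ ι → ℝ) (F := ℝ) (f := fun w s =>
    fderiv ℝ g ((fun j => w (.inl j)) + s • ((fun j => w (.inr (.inl j))) - fun j => w (.inl j)))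
      (fun j => w (.inr (.inr j)))) ?_
  refine ContDiff.clm_apply (hd.2.comp ?_) ?_
  · refine contDiff_pi.2 fun j => ?_
    simp only [Pi.add_apply, Pi.smul_apply, Pi.sub_apply, smul_eq_mul]
    fun_prop
  · fun_prop

end Hadamard

/-! ### Curves in topological vector spaces -/

/-- The curve `c` has the derivative `v` at `t`, relative to the time set `I`. -/
def HasTimeDeriv {X : Type} [AddCommGroup X] [Module ℝ X] [TopologicalSpace X]
    (I : Set ℝ) (c : ℝ → X) (v : X) (t : ℝ) : Prop :=
  Tendsto (slope c t) (𝓝[I \ {t}] t) (𝓝 v)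

theorem nhdsWithin_Icc_diff_neBot {t₀ t₁ : ℝ} (ht : t₀ < t₁) :
    ∀ t ∈ Set.Icc t₀ t₁, (𝓝[Set.Icc t₀ t₁ \ {t}] t).NeBot := fun t h =>
  accPt_principal_iff_nhdsWithin.1 (uniqueDiffWithinAt_iff_accPt.1 (uniqueDiffOn_Icc ht t h))

section Curves

set_option linter.unusedSectionVars false

variable {X Y : Type} [AddCommGroup X] [Module ℝ X] [TopologicalSpace X] [T2Space X]
  [IsTopologicalAddGroup X] [ContinuousSMul ℝ X]
  [AddCommGroup Y] [Module ℝ Y] [TopologicalSpace Y]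
  {I : Set ℝ} {c c' : ℝ → X} {v w : X} {t : ℝ} {k : ℕ} {r : ℕ∞}

theorem HasTimeDeriv.timeDeriv_eq (h : HasTimeDeriv I c v t) (hn : (𝓝[I \ {t}] t).NeBot) :
    timeDeriv I c t = v :=
  Tendsto.limUnder_eq h

theorem HasTimeDeriv.congr (h : HasTimeDeriv I c v t) (ht : t ∈ I) (hc : Set.EqOn c c' I) :
    HasTimeDeriv I c' v t := by
  refine Tendsto.congr' ?_ h
  filter_upwards [self_mem_nhdsWithin] with s hs
  simp [slope_def_module, hc ht, hc hs.1]

theorem HasTimeDeriv.continuousWithinAt (h : HasTimeDeriv I c v t) : ContinuousWithinAt c I t := by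
  rw [← continuousWithinAt_sdiff_self]
  have h1 : Tendsto (fun s => c t + (s - t) • slope c t s) (𝓝[I \ {t}] t)
      (𝓝 (c t + (t - t) • v)) := by
    refine tendsto_const_nhds.add (Tendsto.smul ?_ h)
    exact ((continuous_id.sub continuous_const).tendsto t).mono_left nhdsWithin_le_nhds
  rw [sub_self, zero_smul, add_zero] at h1
  refine h1.congr fun s => ?_
  rw [sub_smul_slope, vsub_eq_sub, add_sub_cancel]

theorem HasTimeDeriv.add (h : HasTimeDeriv I c v t) (h' : HasTimeDeriv I c' w t) :
    HasTimeDeriv I (fun s => c s + c' s) (v + w) t := by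
  refine (Tendsto.add h h').congr fun s => ?_
  simp only [slope_def_module, ← smul_add]
  congr 1
  abel

theorem HasTimeDeriv.const_smul (h : HasTimeDeriv I c v t) (a : ℝ) :
    HasTimeDeriv I (fun s => a • c s) (a • v) t := by
  refine (Tendsto.const_smul h a).congr fun s => ?_
  simp only [slope_def_module, ← smul_sub, smul_comm a]

theorem HasTimeDeriv.smul_const {χ : ℝ → ℝ} {a : ℝ} (h : HasDerivAt χ a t) (x : X) :
    HasTimeDeriv I (fun s => χ s • x) (a • x) t := by
  have h1 : Tendsto (slope χ t) (𝓝[I \ {t}] t) (𝓝 a) :=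
    hasDerivWithinAt_iff_tendsto_slope.1 h.hasDerivWithinAt
  refine (h1.smul_const x).congr fun s => ?_
  simp only [slope_def_module, ← sub_smul, smul_assoc]

theorem HasTimeDeriv.map (h : HasTimeDeriv I c v t) (T : X →L[ℝ] Y) :
    HasTimeDeriv I (fun s => T (c s)) (T v) t := by
  refine ((T.continuous.tendsto v).comp h).congr fun s => ?_
  simp [slope_def_module]

theorem IsCkCurve.hasTimeDeriv (h : IsCkCurve I (k + 1) c) (ht : t ∈ I)
    (hn : (𝓝[I \ {t}] t).NeBot) : HasTimeDeriv I c (timeDeriv I c t) t := by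
  obtain ⟨v, hv⟩ := h.1 t ht
  have h1 : HasTimeDeriv I c v t := hv
  rwa [h1.timeDeriv_eq hn]

theorem IsCkCurve.congr (hI : ∀ t ∈ I, (𝓝[I \ {t}] t).NeBot) (h : IsCkCurve I k c)
    (hc : Set.EqOn c c' I) : IsCkCurve I k c' := by
  induction k generalizing c c' with
  | zero => exact ContinuousOn.congr h fun t ht => (hc ht).symm
  | succ k ih =>
    have h1 : ∀ t ∈ I, HasTimeDeriv I c' (timeDeriv I c t) t := fun t ht =>
      (h.hasTimeDeriv ht (hI t ht)).congr ht hc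
    exact ⟨fun t ht => ⟨_, h1 t ht⟩, ih h.2 fun t ht => ((h1 t ht).timeDeriv_eq (hI t ht)).symm⟩

theorem IsCkCurve.of_hasTimeDeriv (hI : ∀ t ∈ I, (𝓝[I \ {t}] t).NeBot)
    (h : ∀ t ∈ I, HasTimeDeriv I c (c' t) t) (h' : IsCkCurve I k c') : IsCkCurve I (k + 1) c :=
  ⟨fun t ht => ⟨_, h t ht⟩, h'.congr hI fun t ht => ((h t ht).timeDeriv_eq (hI t ht)).symm⟩

theorem IsCkCurve.continuousOn (hI : ∀ t ∈ I, (𝓝[I \ {t}] t).NeBot) (h : IsCkCurve I k c) :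
    ContinuousOn c I := by
  cases k with
  | zero => exact h
  | succ k => exact fun t ht => (h.hasTimeDeriv ht (hI t ht)).continuousWithinAt

theorem IsCkCurve.of_succ (hI : ∀ t ∈ I, (𝓝[I \ {t}] t).NeBot) (h : IsCkCurve I (k + 1) c) :
    IsCkCurve I k c := by
  induction k generalizing c with
  | zero => exact h.continuousOn hI
  | succ k ih => exact ⟨h.1, ih h.2⟩

theorem IsCkCurve.const_zero (hI : ∀ t ∈ I, (𝓝[I \ {t}] t).NeBot) :
    IsCkCurve I k (fun _ => (0 : X)) := by
  induction k with
  | zero => exact continuousOn_const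
  | succ k ih =>
    refine IsCkCurve.of_hasTimeDeriv hI (fun t _ => ?_) ih
    simpa using HasTimeDeriv.smul_const (I := I) (hasDerivAt_const t (0 : ℝ)) (0 : X)

theorem IsCkCurve.smul_const (hI : ∀ t ∈ I, (𝓝[I \ {t}] t).NeBot) {χ : ℝ → ℝ}
    (hχ : ContDiff ℝ ∞ χ) (x : X) : IsCkCurve I k (fun t => χ t • x) := by
  induction k generalizing χ with
  | zero => exact (hχ.continuous.smul continuous_const).continuousOn
  | succ k ih =>
    have hd := contDiff_infty_iff_deriv.1 hχ
    exact IsCkCurve.of_hasTimeDeriv hI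
      (fun t _ => HasTimeDeriv.smul_const (hd.1 t).hasDerivAt x) (ih hd.2)

theorem IsCkCurve.map [T2Space Y] [IsTopologicalAddGroup Y] [ContinuousSMul ℝ Y]
    (hI : ∀ t ∈ I, (𝓝[I \ {t}] t).NeBot) (h : IsCkCurve I k c) (T : X →L[ℝ] Y) :
    IsCkCurve I k (fun t => T (c t)) := by
  induction k generalizing c with
  | zero => exact T.continuous.comp_continuousOn h
  | succ k ih =>
    exact IsCkCurve.of_hasTimeDeriv hI (fun t ht => (h.hasTimeDeriv ht (hI t ht)).map T) (ih h.2)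

theorem IsCurve.const_zero (hI : ∀ t ∈ I, (𝓝[I \ {t}] t).NeBot) :
    IsCurve I r (fun _ => (0 : X)) := fun _ _ => IsCkCurve.const_zero hI

theorem IsCurve.smul_const (hI : ∀ t ∈ I, (𝓝[I \ {t}] t).NeBot) {χ : ℝ → ℝ}
    (hχ : ContDiff ℝ ∞ χ) (x : X) : IsCurve I r (fun t => χ t • x) :=
  fun _ _ => IsCkCurve.smul_const hI hχ x

theorem IsCurve.map [T2Space Y] [IsTopologicalAddGroup Y] [ContinuousSMul ℝ Y]
    (hI : ∀ t ∈ I, (𝓝[I \ {t}] t).NeBot) (h : IsCurve I r c) (T : X →L[ℝ] Y) :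
    IsCurve I r (fun t => T (c t)) := fun k hk => (h k hk).map hI T

theorem IsCurve.timeDeriv (h : IsCurve I (r + 1) c) : IsCurve I r (timeDeriv I c) :=
  fun k hk => (h (k + 1) (by push_cast; gcongr)).2

theorem IsCurve.of_succ (h : IsCurve I (r + 1) c) : IsCurve I r c :=
  fun k hk => h k (hk.trans le_self_add)

theorem IsCurve.continuousOn (h : IsCurve I r c) : ContinuousOn c I := h 0 (by simp)

theorem IsCurve.hasTimeDeriv (h : IsCurve I r c) (hr : 1 ≤ r) (ht : t ∈ I)
    (hn : (𝓝[I \ {t}] t).NeBot) : HasTimeDeriv I c (_root_.timeDeriv I c t) t :=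
  IsCkCurve.hasTimeDeriv (k := 0) (h 1 (by simpa using hr)) ht hn

theorem IsCurve.continuousOn_timeDeriv (h : IsCurve I r c) (hr : 1 ≤ r) :
    ContinuousOn (_root_.timeDeriv I c) I :=
  (h 1 (by simpa using hr)).2

end Curves

/-! ### Nemytskii operators along curves -/

namespace CInf

variable {m : ℕ} {K : Set (Eu m)} {ι : Type} [Fintype ι] {g : (ι → ℝ) → ℝ} {I : Set ℝ} {t : ℝ}

theorem contDiff_fderiv_apply (hg : ContDiff ℝ ∞ g) : ContDiff ℝ ∞ (fun w : ι ⊕ ι → ℝ =>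
    fderiv ℝ g (fun j => w (.inl j)) (fun j => w (.inr j))) := by
  have hd := contDiff_infty_iff_fderiv.1 hg
  exact ContDiff.clm_apply (hd.2.comp (by fun_prop)) (by fun_prop)

/-- The chain rule in the Fréchet topology: by Hadamard's lemma the difference quotient is a
Nemytskii operator of `c t`, `c s` and the difference quotient of `c`. -/
theorem hasTimeDeriv_nem (hg : ContDiff ℝ ∞ g) {c : ι → ℝ → CInf K} {v : ι → CInf K}
    (h : ∀ j, HasTimeDeriv I (c j) (v j) t) :
    HasTimeDeriv I (fun s => nem g hg fun j => c j s)
      (nem _ (contDiff_fderiv_apply hg) (Sum.elim (fun j => c j t) v)) t := by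
  have h1 : Tendsto (fun s => nem _ (contDiff_hadamard hg) (Sum.elim (fun j => c j t)
      (Sum.elim (fun j => c j s) (fun j => slope (c j) t s)))) (𝓝[I \ {t}] t)
      (𝓝 (nem _ (contDiff_hadamard hg) (Sum.elim (fun j => c j t)
        (Sum.elim (fun j => c j t) v)))) := by
    refine ((continuous_nem _ (contDiff_hadamard hg)).tendsto _).comp (tendsto_pi_nhds.2 ?_)
    rintro (j | j | j)
    · exact tendsto_const_nhds
    · exact continuousWithinAt_sdiff_self.2 (h j).continuousWithinAt
    · exact h j
  have h2 : nem _ (contDiff_hadamard hg) (Sum.elim (fun j => c j t)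
        (Sum.elim (fun j => c j t) v)) =
      nem _ (contDiff_fderiv_apply hg) (Sum.elim (fun j => c j t) v) := by
    ext x
    simp [hadamard_self]
  rw [h2] at h1
  refine h1.congr fun s => ?_
  ext x
  have h3 : (fun j => slope (c j) t s x) =
      (s - t)⁻¹ • ((fun j => c j s x) - fun j => c j t x) := by
    funext j
    simp [slope_def_module]
  simp only [nem_apply, Sum.elim_inl, Sum.elim_inr]
  rw [h3, hadamard_smul, hadamard_sub hg]
  simp [slope_def_module]

theorem isCkCurve_nem (hI : ∀ t ∈ I, (𝓝[I \ {t}] t).NeBot) (hg : ContDiff ℝ ∞ g)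
    {c : ι → ℝ → CInf K} {k : ℕ} (h : ∀ j, IsCkCurve I k (c j)) :
    IsCkCurve I k (fun s => nem g hg fun j => c j s) := by
  induction k generalizing ι with
  | zero =>
    exact (continuous_nem g hg).comp_continuousOn (continuousOn_pi.2 h)
  | succ k ih =>
    refine IsCkCurve.of_hasTimeDeriv hI (fun t ht =>
      hasTimeDeriv_nem hg fun j => (h j).hasTimeDeriv ht (hI t ht)) ?_
    have h1 := ih (contDiff_fderiv_apply hg)
      (c := Sum.elim c (fun j => timeDeriv I (c j))) (by
        rintro (j | j)
        · exact (h j).of_succ hI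
        · exact (h j).2)
    refine h1.congr hI fun t _ => ?_
    congr 1
    funext j
    cases j <;> rfl

theorem isCurve_nem (hI : ∀ t ∈ I, (𝓝[I \ {t}] t).NeBot) (hg : ContDiff ℝ ∞ g)
    {c : ι → ℝ → CInf K} {r : ℕ∞} (h : ∀ j, IsCurve I r (c j)) :
    IsCurve I r (fun s => nem g hg fun j => c j s) :=
  fun k hk => isCkCurve_nem hI hg fun j => h j k hk

end CInf

/-! ### Graph charts of the boundary and the outward normal -/

/-- In the open set `U`, the set `Ω` is the strict subgraph of `g` in the direction `e`. -/
structure IsGraphChart {m : ℕ} (Ω : Set (Eu m)) (e : Eu m) (g : Eu m → ℝ) (U : Set (Eu m)) :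
    Prop where
  axis : ∃ i : Fin m, e = EuclideanSpace.single i (1 : ℝ) ∨ e = -EuclideanSpace.single i (1 : ℝ)
  smooth : ContDiff ℝ ∞ g
  apply_add_smul : ∀ (x : Eu m) (s : ℝ), g (x + s • e) = g x
  isOpen : IsOpen U
  mem_iff : ∀ x ∈ U, (x ∈ Ω ↔ inner ℝ x e < g x)

theorem HasSmoothBoundary.exists_isGraphChart {m : ℕ} {Ω : Set (Eu m)} (h : HasSmoothBoundary Ω)
    {p : Eu m} (hp : p ∈ frontier Ω) : ∃ e g U, IsGraphChart Ω e g U ∧ p ∈ U := by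
  obtain ⟨e, g, U, h1, h2, h3, h4, h5, h6⟩ := h p hp
  exact ⟨e, g, U, ⟨h1, h2, h3, h4, h6⟩, h5⟩

/-- The (unnormalized) outward conormal `e - ∇g` of the subgraph `{x | x·e < g x}`. -/
noncomputable def conormal {m : ℕ} (e : Eu m) (g : Eu m → ℝ) (x : Eu m) : Eu m := e - gradient g x

theorem inner_conormal {m : ℕ} (e : Eu m) (g : Eu m → ℝ) (x v : Eu m) :
    inner ℝ v (conormal e g x) = inner ℝ v e - fderiv ℝ g x v := by
  rw [conormal, inner_sub_right, real_inner_comm (gradient g x) v, gradient,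
    InnerProductSpace.toDual_symm_apply]

theorem eventually_neg_of_hasDerivAt {h : ℝ → ℝ} {d : ℝ} (hd : HasDerivAt h d 0) (h0 : h 0 = 0)
    (hneg : d < 0) : ∀ᶠ s in 𝓝[>] (0 : ℝ), h s < 0 := by
  have h1 : Tendsto (slope h 0) (𝓝[>] 0) (𝓝 d) :=
    (hasDerivWithinAt_iff_tendsto_slope' (by simp)).1 hd.hasDerivWithinAt
  filter_upwards [h1.eventually (gt_mem_nhds hneg), self_mem_nhdsWithin] with s hs hs'
  have hs' : 0 < s := hs'
  rw [slope_def_field, h0, sub_zero, sub_zero, div_lt_iff₀ hs', zero_mul] at hs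
  exact hs

namespace IsGraphChart

variable {m : ℕ} {Ω : Set (Eu m)} {e : Eu m} {g : Eu m → ℝ} {U : Set (Eu m)}

theorem norm_dir (h : IsGraphChart Ω e g U) : ‖e‖ = 1 := by
  obtain ⟨i, rfl | rfl⟩ := h.axis <;> simp

theorem inner_dir (h : IsGraphChart Ω e g U) : inner ℝ e e = (1 : ℝ) := by
  rw [real_inner_self_eq_norm_sq, h.norm_dir, one_pow]

theorem fderiv_dir (h : IsGraphChart Ω e g U) (x : Eu m) : fderiv ℝ g x e = 0 := by
  have h1 : HasDerivAt (fun s : ℝ => g (x + s • e)) (fderiv ℝ g (x + (0 : ℝ) • e) e) 0 := by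
    have h2 : HasDerivAt (fun s : ℝ => x + s • e) e 0 := by
      simpa using ((hasDerivAt_id (0 : ℝ)).smul_const e).const_add x
    exact ((contDiff_infty_iff_fderiv.1 h.smooth).1 _).hasFDerivAt.comp_hasDerivAt _ h2
  simp only [h.apply_add_smul, zero_smul, add_zero] at h1
  exact h1.unique (hasDerivAt_const _ _)

theorem conormal_ne_zero (h : IsGraphChart Ω e g U) (x : Eu m) : conormal e g x ≠ 0 := by
  intro h0
  have := inner_conormal e g x e
  rw [h0, h.inner_dir, h.fderiv_dir] at this
  simp at this

theorem contDiff_conormal (h : IsGraphChart Ω e g U) : ContDiff ℝ ∞ (conormal e g) :=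
  contDiff_const.sub ((InnerProductSpace.toDual ℝ (Eu m)).symm.contDiff.comp
    (contDiff_infty_iff_fderiv.1 h.smooth).2)

theorem le_of_mem_closure (h : IsGraphChart Ω e g U) {x : Eu m} (hx : x ∈ U)
    (hc : x ∈ closure Ω) : inner ℝ x e ≤ g x := by
  by_contra! hlt
  have hcont : Continuous fun y : Eu m => inner ℝ y e := by fun_prop
  have h1 : ∀ᶠ y in 𝓝 x, y ∈ U ∧ g y < inner ℝ y e :=
    (h.isOpen.eventually_mem hx).and ((h.smooth.continuous.tendsto x).eventually_lt
      (hcont.tendsto x) hlt)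
  obtain ⟨y, ⟨hyU, hy⟩, hyΩ⟩ := mem_closure_iff_nhds.1 hc _ h1
  exact (((h.mem_iff y hyU).1 hyΩ).trans hy).false

theorem hasDerivAt_height (h : IsGraphChart Ω e g U) (p v : Eu m) :
    HasDerivAt (fun s : ℝ => inner ℝ (p + s • v) e - g (p + s • v))
      (inner ℝ v (conormal e g p)) 0 := by
  have h2 : HasDerivAt (fun s : ℝ => p + s • v) v 0 := by
    simpa using ((hasDerivAt_id (0 : ℝ)).smul_const v).const_add p
  have h3 : HasFDerivAt g (fderiv ℝ g p) (p + (0 : ℝ) • v) := by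
    simpa using ((contDiff_infty_iff_fderiv.1 h.smooth).1 p).hasFDerivAt
  rw [inner_conormal]
  have h4 := h2.inner ℝ (hasDerivAt_const (0 : ℝ) e)
  simp only [inner_zero_right, zero_add] at h4
  exact h4.sub (h3.comp_hasDerivAt _ h2)

theorem eventually_mem_chart (h : IsGraphChart Ω e g U) {p : Eu m} (hp : p ∈ U) (v : Eu m) :
    ∀ᶠ s : ℝ in 𝓝[>] 0, p + s • v ∈ U := by
  have hc : Continuous fun s : ℝ => p + s • v := by fun_prop
  refine nhdsWithin_le_nhds (hc.tendsto 0 (h.isOpen.mem_nhds (by simpa using hp)))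

theorem eventually_mem (h : IsGraphChart Ω e g U) {p : Eu m} (hp : p ∈ U)
    (hg : inner ℝ p e = g p) {v : Eu m} (hv : inner ℝ v (conormal e g p) < 0) :
    ∀ᶠ s : ℝ in 𝓝[>] 0, p + s • v ∈ Ω := by
  filter_upwards [eventually_neg_of_hasDerivAt (h.hasDerivAt_height p v) (by simp [hg]) hv,
    h.eventually_mem_chart hp v] with s hs hU
  exact (h.mem_iff _ hU).2 (by linarith)

theorem eventually_notMem_closure (h : IsGraphChart Ω e g U) {p : Eu m} (hp : p ∈ U)
    (hg : inner ℝ p e = g p) {v : Eu m} (hv : 0 < inner ℝ v (conormal e g p)) :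
    ∀ᶠ s : ℝ in 𝓝[>] 0, p + s • v ∉ closure Ω := by
  filter_upwards [eventually_neg_of_hasDerivAt (h.hasDerivAt_height p v).neg (by simp [hg])
    (by simpa using hv), h.eventually_mem_chart hp v] with s hs hU hc
  have := h.le_of_mem_closure hU hc
  simp only [Pi.neg_apply] at hs
  linarith

theorem mem_frontier_iff (h : IsGraphChart Ω e g U) (hΩ : IsOpen Ω) {x : Eu m} (hx : x ∈ U) :
    x ∈ frontier Ω ↔ inner ℝ x e = g x := by
  rw [frontier, hΩ.interior_eq, Set.mem_sdiff, h.mem_iff x hx, not_lt]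
  constructor
  · rintro ⟨h1, h2⟩
    exact le_antisymm (h.le_of_mem_closure hx h1) h2
  · intro hg
    refine ⟨?_, hg.ge⟩
    have h1 := h.eventually_mem hx hg (v := -e) (by
      rw [inner_conormal, inner_neg_left, h.inner_dir, map_neg, h.fderiv_dir]; norm_num)
    have hc : Tendsto (fun s : ℝ => x + s • (-e)) (𝓝[>] 0) (𝓝 x) := by
      have hc : Continuous fun s : ℝ => x + s • (-e) := by fun_prop
      simpa using (hc.tendsto 0).mono_left nhdsWithin_le_nhds
    exact mem_closure_of_tendsto hc h1

end IsGraphChart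

theorem IsOutwardUnitNormal.unique {m : ℕ} {Ω : Set (Eu m)} {p n n' : Eu m}
    (h : IsOutwardUnitNormal Ω p n) (h' : IsOutwardUnitNormal Ω p n') : n = n' := by
  by_contra hne
  have h1 : inner ℝ n n' < (1 : ℝ) := (inner_lt_one_iff_real_of_norm_eq_one h.1 h'.1).2 hne
  have h2 := (h.2 (n' - n)).1 (by
    rw [inner_sub_left, real_inner_self_eq_norm_sq, h.1, real_inner_comm]; linarith)
  have h3 := (h'.2 (n' - n)).2 (by
    rw [inner_sub_left, real_inner_self_eq_norm_sq, h'.1]; linarith)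
  obtain ⟨s, hs, hs'⟩ := (h2.and h3).exists
  exact hs' (subset_closure hs)

theorem IsGraphChart.outwardNormal_eq {m : ℕ} {Ω : Set (Eu m)} {e : Eu m} {g : Eu m → ℝ}
    {U : Set (Eu m)} (h : IsGraphChart Ω e g U) (hΩ : IsOpen Ω) {p : Eu m} (hp : p ∈ U)
    (hpf : p ∈ frontier Ω) : outwardNormal Ω p = ‖conormal e g p‖⁻¹ • conormal e g p := by
  have hN : 0 < ‖conormal e g p‖ := norm_pos_iff.2 (h.conormal_ne_zero p)
  have hg := (h.mem_frontier_iff hΩ hp).1 hpf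
  have h1 : IsOutwardUnitNormal Ω p (‖conormal e g p‖⁻¹ • conormal e g p) := by
    refine ⟨by rw [norm_smul, norm_inv, norm_norm, inv_mul_cancel₀ hN.ne'], fun v => ?_⟩
    rw [real_inner_smul_right]
    refine ⟨fun hv => h.eventually_mem hp hg ?_, fun hv => h.eventually_notMem_closure hp hg ?_⟩
    · exact (pos_iff_neg_of_mul_neg hv).1 (inv_pos.2 hN)
    · exact pos_of_mul_pos_right hv (inv_pos.2 hN).le
  have h2 : ∃ n, IsOutwardUnitNormal Ω p n := ⟨_, h1⟩
  rw [outwardNormal, dif_pos h2]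
  exact h2.choose_spec.unique h1

/-- A finite smooth partition of unity on a compact set. -/
theorem exists_finite_partition {m : ℕ} {K : Set (Eu m)} (hK : IsCompact K) {U : Eu m → Set (Eu m)}
    (hU : ∀ x ∈ K, IsOpen (U x) ∧ x ∈ U x) :
    ∃ (s : Finset (Eu m)) (ρ : Eu m → Eu m → ℝ), (∀ q ∈ s, q ∈ K ∧ ContDiff ℝ ∞ (ρ q) ∧
      HasCompactSupport (ρ q) ∧ tsupport (ρ q) ⊆ U q) ∧ ∀ x ∈ K, ∑ q ∈ s, ρ q x = 1 := by
  classical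
  obtain ⟨s, hs, hsK⟩ := hK.elim_nhds_subcover (fun x => U x ∩ Metric.ball x 1) fun x hx =>
    inter_mem ((hU x hx).1.mem_nhds (hU x hx).2) (Metric.ball_mem_nhds x one_pos)
  obtain ⟨f, hf⟩ := SmoothPartitionOfUnity.exists_isSubordinate (modelWithCornersSelf ℝ (Eu m))
    hK.isClosed (fun q : s => U q ∩ Metric.ball q.1 1)
    (fun q => (hU q (hs q q.2)).1.inter Metric.isOpen_ball) (by
      intro x hx
      obtain ⟨q, hq, h⟩ := Set.mem_iUnion₂.1 (hsK hx)
      exact Set.mem_iUnion.2 ⟨⟨q, hq⟩, h⟩)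
  refine ⟨s, fun q => if h : q ∈ s then f ⟨q, h⟩ else 0, fun q hq => ?_, fun x hx => ?_⟩
  · simp only [hq, dif_pos]
    refine ⟨hs q hq, contMDiff_iff_contDiff.1 (f ⟨q, hq⟩).contMDiff, ?_,
      (hf ⟨q, hq⟩).trans Set.inter_subset_left⟩
    exact Metric.isCompact_of_isClosed_isBounded (isClosed_tsupport _)
      (Metric.isBounded_ball.subset ((hf ⟨q, hq⟩).trans Set.inter_subset_right))
  · rw [← f.sum_eq_one hx, finsum_eq_sum_of_fintype, ← Finset.sum_attach]
    refine Finset.sum_congr rfl fun q _ => ?_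
    simp

namespace IsSmoothBoundedDomain

variable {m : ℕ} {Ω : Set (Eu m)}

theorem isCompact_closure (hΩ : IsSmoothBoundedDomain Ω) : IsCompact (closure Ω) :=
  hΩ.isBounded.isCompact_closure

theorem isCompact_frontier (hΩ : IsSmoothBoundedDomain Ω) : IsCompact (frontier Ω) :=
  hΩ.isCompact_closure.of_isClosed_subset isClosed_frontier frontier_subset_closure

theorem exists_smooth_normal (hΩ : IsSmoothBoundedDomain Ω) :
    ∃ n : Eu m → Eu m, ContDiff ℝ ∞ n ∧ ∀ x ∈ frontier Ω, n x = outwardNormal Ω x := by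
  classical
  have h : ∀ p : Eu m, ∃ e g U, p ∈ frontier Ω → IsGraphChart Ω e g U ∧ p ∈ U := by
    intro p
    by_cases hp : p ∈ frontier Ω
    · obtain ⟨e, g, U, h⟩ := hΩ.smoothBoundary.exists_isGraphChart hp
      exact ⟨e, g, U, fun _ => h⟩
    · exact ⟨0, 0, ∅, fun h => absurd h hp⟩
  choose e g U h using h
  obtain ⟨s, ρ, hρ, hsum⟩ := exists_finite_partition hΩ.isCompact_frontier (U := U)
    fun x hx => ⟨(h x hx).1.isOpen, (h x hx).2⟩
  refine ⟨fun x => ∑ q ∈ s, ρ q x • ‖conormal (e q) (g q) x‖⁻¹ • conormal (e q) (g q) x,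
    ContDiff.sum fun q hq => ?_, fun x hx => ?_⟩
  · have hc := (h q (hρ q hq).1).1
    exact (hρ q hq).2.1.smul (((hc.contDiff_conormal.norm ℝ hc.conormal_ne_zero).inv
      fun x => norm_ne_zero_iff.2 (hc.conormal_ne_zero x)).smul hc.contDiff_conormal)
  · rw [← one_smul ℝ (outwardNormal Ω x), ← hsum x hx, Finset.sum_smul]
    refine Finset.sum_congr rfl fun q hq => ?_
    by_cases hx0 : ρ q x = 0
    · simp [hx0]
    · rw [(h q (hρ q hq).1).1.outwardNormal_eq hΩ.isOpen
        ((hρ q hq).2.2.2 (subset_tsupport _ hx0)) hx]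

theorem uniqueDiffOn (hΩ : IsSmoothBoundedDomain Ω) : UniqueDiffOn ℝ (closure Ω) := by
  intro p hp
  rw [uniqueDiffWithinAt_closure]
  by_cases hpΩ : p ∈ Ω
  · exact hΩ.isOpen.uniqueDiffWithinAt hpΩ
  have hpf : p ∈ frontier Ω := by rw [hΩ.isOpen.frontier_eq]; exact ⟨hp, hpΩ⟩
  obtain ⟨e, g, U, h, hpU⟩ := hΩ.smoothBoundary.exists_isGraphChart hpf
  refine ⟨?_, hp⟩
  have hg := (h.mem_frontier_iff hΩ.isOpen hpU).1 hpf
  -- the tangent cone contains the open half-space of the inward directions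
  have hsub : {v : Eu m | inner ℝ v (conormal e g p) < 0} ⊆ tangentConeAt ℝ Ω p := by
    intro v hv
    refine mem_tangentConeAt_of_add_smul_mem (l := 𝓝[>] (0 : ℝ)) (c := fun s : ℝ => s)
      (tendsto_nhdsWithin_mono_right (fun s hs => ne_of_gt hs) tendsto_id)
      (h.eventually_mem hpU hg hv)
  have htop : Submodule.span ℝ (tangentConeAt ℝ Ω p) = ⊤ := by
    refine Submodule.eq_top_of_nonempty_interior' _ ⟨-conormal e g p, ?_⟩
    refine interior_mono (hsub.trans Submodule.subset_span) ?_
    have ho : IsOpen {v : Eu m | inner ℝ v (conormal e g p) < 0} :=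
      isOpen_lt (by fun_prop) continuous_const
    rw [ho.interior_eq]
    change inner ℝ (-conormal e g p) (conormal e g p) < 0
    rw [inner_neg_left, real_inner_self_eq_norm_sq]
    have := norm_pos_iff.2 (h.conormal_ne_zero p)
    exact neg_lt_zero.2 (by positivity)
  rw [htop]
  exact dense_univ

theorem bodyDeriv_eq (hΩ : IsSmoothBoundedDomain Ω) {f : closure Ω → ℝ} {F : Eu m → ℝ}
    (hF : Differentiable ℝ F) (h : ∀ x : closure Ω, F x = f x) (x : closure Ω) :
    bodyDeriv f x = fderiv ℝ F x := by
  rw [bodyDeriv, ← (hF x.1).fderivWithin (hΩ.uniqueDiffOn x.1 x.2)]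
  refine fderivWithin_congr (fun y hy => ?_) ?_
  · have := Subtype.val_injective.extend_apply f 0 ⟨y, hy⟩
    exact this.trans (h ⟨y, hy⟩).symm
  · exact (Subtype.val_injective.extend_apply f 0 x).trans (h x).symm

/-- The partial derivative `∂/∂x^i` as a continuous operator on `C^∞(𝓑)`. -/
noncomputable def partialDeriv (hΩ : IsSmoothBoundedDomain Ω) (i : Fin m) :
    CInf (closure Ω) →L[ℝ] CInf (closure Ω) where
  toFun φ := ⟨fun x => bodyDeriv φ x (EuclideanSpace.single i 1), by
    obtain ⟨F, hF, h⟩ := φ.2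
    have hd := contDiff_infty_iff_fderiv.1 hF
    exact ⟨fun x => fderiv ℝ F x (EuclideanSpace.single i 1), hd.2.clm_apply contDiff_const,
      fun x => (congrArg (fun T : Eu m →L[ℝ] ℝ => T (EuclideanSpace.single i 1))
        (hΩ.bodyDeriv_eq hd.1 h x)).symm⟩⟩
  map_add' φ ψ := by
    obtain ⟨F, hF, h⟩ := φ.2
    obtain ⟨G, hG, h'⟩ := ψ.2
    have hd := (contDiff_infty_iff_fderiv.1 hF).1
    have hd' := (contDiff_infty_iff_fderiv.1 hG).1
    refine CInf.ext fun x => ?_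
    change bodyDeriv _ x _ = bodyDeriv _ x _ + bodyDeriv _ x _
    rw [hΩ.bodyDeriv_eq hd h, hΩ.bodyDeriv_eq hd' h', hΩ.bodyDeriv_eq (F := fun x => F x + G x)
      (hd.add hd') (fun x => by rw [h, h']; rfl), fderiv_fun_add (hd _) (hd' _)]
    rfl
  map_smul' c φ := by
    obtain ⟨F, hF, h⟩ := φ.2
    have hd := (contDiff_infty_iff_fderiv.1 hF).1
    refine CInf.ext fun x => ?_
    change bodyDeriv _ x _ = c * bodyDeriv _ x _
    rw [hΩ.bodyDeriv_eq hd h, hΩ.bodyDeriv_eq (F := fun x => c * F x)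
      (hd.const_mul c) (fun x => by rw [h]; rfl), fderiv_const_mul (hd _)]
    rfl
  cont := by
    refine CInf.isOpenQuotientMap_res.continuous_comp_iff.1 ?_
    set P : SmoothFun m → SmoothFun m := fun F =>
      ⟨fun x => fderiv ℝ F.1 x (EuclideanSpace.single i 1),
        (contDiff_infty_iff_fderiv.1 F.2).2.clm_apply contDiff_const⟩ with hP
    have hPc : Continuous P := by
      refine continuous_iff_continuousAt.2 fun F => SmoothFun.tendsto_iff.2 fun n => ?_
      have h1 := (SmoothFun.tendsto_iff.1 (tendsto_id (x := 𝓝 F)) (n + 1)).2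
      exact h1.comp (ContinuousLinearMap.apply ℝ ℝ (EuclideanSpace.single i (1 : ℝ))).contDiff
        (fun a => (contDiff_infty_iff_fderiv.1 a.2).2) (contDiff_infty_iff_fderiv.1 F.2).2
    refine (CInf.isOpenQuotientMap_res.continuous.comp hPc).congr fun F => ?_
    refine CInf.ext fun x => ?_
    change fderiv ℝ F.1 x _ = bodyDeriv _ x _
    exact (congrArg (fun T : Eu m →L[ℝ] ℝ => T (EuclideanSpace.single i 1))
        (hΩ.bodyDeriv_eq (contDiff_infty_iff_fderiv.1 F.2).1 (fun _ => rfl) x)).symm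

theorem partialDeriv_apply (hΩ : IsSmoothBoundedDomain Ω) (i : Fin m) (φ : CInf (closure Ω))
    (x : closure Ω) :
    hΩ.partialDeriv i φ x = bodyDeriv φ x (EuclideanSpace.single i 1) := rfl

theorem grad_apply (hΩ : IsSmoothBoundedDomain Ω) (φ : CInf (closure Ω)) (x : closure Ω)
    (i : Fin m) : grad φ x i = hΩ.partialDeriv i φ x := rfl

end IsSmoothBoundedDomain

/-! ### The area formula -/

section AreaFormula

variable {E F : Type} [NormedAddCommGroup E] [InnerProductSpace ℝ E] [FiniteDimensional ℝ E]
  [MeasurableSpace E] [BorelSpace E] [NormedAddCommGroup F] [InnerProductSpace ℝ F]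
  [MeasurableSpace F] [BorelSpace F]

theorem euclideanHausdorffMeasure_image_le_of_dist_le {α X Y : Type} [MetricSpace X]
    [MeasurableSpace X] [BorelSpace X] [MetricSpace Y] [MeasurableSpace Y] [BorelSpace Y]
    {f : α → X} {h : α → Y} {S : Set α} {C : NNReal}
    (hfh : ∀ y ∈ S, ∀ y' ∈ S, dist (f y) (f y') ≤ C * dist (h y) (h y')) (d : ℕ) :
    μHE[d] (f '' S) ≤ (C : ENNReal) ^ d * μHE[d] (h '' S) := by
  rcases S.eq_empty_or_nonempty with rfl | ⟨y₀, _⟩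
  · simp
  have : Nonempty α := ⟨y₀⟩
  set φ : Y → X := fun z => f (Function.invFunOn h S z) with hφ
  have hmem : ∀ z ∈ h '' S, Function.invFunOn h S z ∈ S ∧ h (Function.invFunOn h S z) = z :=
    fun z hz => ⟨Function.invFunOn_mem hz, Function.invFunOn_eq hz⟩
  have hlip : LipschitzOnWith C φ (h '' S) := by
    refine LipschitzOnWith.of_dist_le_mul fun z hz z' hz' => ?_
    have := hfh _ (hmem z hz).1 _ (hmem z' hz').1
    rwa [(hmem z hz).2, (hmem z' hz').2] at this
  have himg : φ '' (h '' S) = f '' S := by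
    rw [Set.image_image]
    refine Set.image_congr fun y hy => ?_
    have h1 := hmem (h y) ⟨y, hy, rfl⟩
    have h2 := hfh _ h1.1 y hy
    rw [h1.2, dist_self, mul_zero] at h2
    exact dist_le_zero.1 h2
  have h3 := hlip.hausdorffMeasure_image_le (d := d) (by positivity)
  rw [himg, ENNReal.rpow_natCast] at h3
  simp only [Measure.euclideanHausdorffMeasure_def, Measure.smul_apply, Measure.nnreal_smul_coe_apply]
  calc _ ≤ _ := mul_le_mul_right h3 _
    _ = _ := mul_left_comm _ _ _

/-- Near a point with injective differential `T`, the map `G` distorts distances by factors close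
to those of `T`, so that the measures of small images are controlled by the Jacobian of `T`. -/
theorem exists_nhds_image_measure_bounds {G : E → F} {T : E →L[ℝ] F} {y₀ : E}
    (hG : HasStrictFDerivAt G T y₀) (hT : Function.Injective T) {a b : NNReal}
    (ha : (a : ℝ) < T.toLinearMap.normDet) (hb : T.toLinearMap.normDet < b) :
    ∃ W ∈ 𝓝 y₀, ∀ S ⊆ W, a * volume S ≤ μHE[Module.finrank ℝ E] (G '' S) ∧
      μHE[Module.finrank ℝ E] (G '' S) ≤ b * volume S := by
  set k := Module.finrank ℝ E
  set J := T.toLinearMap.normDet with hJ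
  obtain ⟨C, hC0, hC⟩ := T.toLinearMap.exists_antilipschitzWith (LinearMap.ker_eq_bot.2 hT)
  have hTC : ∀ v, ‖v‖ ≤ C * ‖T v‖ := fun v => hC.le_mul_norm (map_zero _) v
  -- the tolerance `ε` is chosen so that `(1 + ε) ^ k * J` and `(1 - ε) ^ k * J` stay in `(a, b)`
  have hε : ∃ ε : ℝ, 0 < ε ∧ ε < 1 ∧ (1 + ε) ^ k * J < b ∧ a < (1 - ε) ^ k * J := by
    have h1 : Tendsto (fun ε : ℝ => (1 + ε) ^ k * J) (𝓝[>] 0) (𝓝 J) := by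
      have : Continuous fun ε : ℝ => (1 + ε) ^ k * J := by fun_prop
      simpa using (this.tendsto 0).mono_left nhdsWithin_le_nhds
    have h2 : Tendsto (fun ε : ℝ => (1 - ε) ^ k * J) (𝓝[>] 0) (𝓝 J) := by
      have : Continuous fun ε : ℝ => (1 - ε) ^ k * J := by fun_prop
      simpa using (this.tendsto 0).mono_left nhdsWithin_le_nhds
    have h0 : ∀ᶠ ε in 𝓝[>] (0 : ℝ), ε ∈ Set.Ioo 0 1 := Ioo_mem_nhdsGT one_pos
    obtain ⟨ε, h3, h4, h5⟩ := (h0.and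
      ((h1.eventually (gt_mem_nhds hb)).and (h2.eventually (lt_mem_nhds ha)))).exists
    exact ⟨ε, h3.1, h3.2, h4, h5⟩
  obtain ⟨ε, hε0, hε1, hεb, hεa⟩ := hε
  have hstrict := hG.isLittleO.def (c := ε / C) (by positivity)
  rw [nhds_prod_eq] at hstrict
  obtain ⟨W, hW, hWW⟩ := mem_prod_same_iff.1 hstrict
  refine ⟨W, hW, fun S hS => ?_⟩
  have key : ∀ y ∈ S, ∀ y' ∈ S, ‖G y - G y' - (T y - T y')‖ ≤ ε * ‖T y - T y'‖ := by
    intro y hy y' hy'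
    have h1 : ‖G y - G y' - T (y - y')‖ ≤ ε / C * ‖y - y'‖ :=
      hWW (Set.mk_mem_prod (hS hy) (hS hy'))
    rw [map_sub] at h1
    refine h1.trans ?_
    have h2 := hTC (y - y')
    rw [map_sub] at h2
    calc ε / C * ‖y - y'‖ ≤ ε / C * (C * ‖T y - T y'‖) := by gcongr
      _ = ε * ‖T y - T y'‖ := by
        have : (C : ℝ) ≠ 0 := by positivity
        field_simp
  have hup := euclideanHausdorffMeasure_image_le_of_dist_le (f := G) (h := T) (S := S)
    (C := (1 + ε).toNNReal) (fun y hy y' hy' => by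
      rw [dist_eq_norm, dist_eq_norm]
      have h1 := key y hy y' hy'
      have h2 := norm_add_le (G y - G y' - (T y - T y')) (T y - T y')
      rw [sub_add_cancel] at h2
      rw [Real.coe_toNNReal _ (by positivity)]
      linarith) k
  have hlow := euclideanHausdorffMeasure_image_le_of_dist_le (f := T) (h := G) (S := S)
    (C := (1 - ε)⁻¹.toNNReal) (fun y hy y' hy' => by
      rw [dist_eq_norm, dist_eq_norm]
      have h1 := key y hy y' hy'
      have h2 := norm_sub_le (G y - G y') (G y - G y' - (T y - T y'))
      rw [sub_sub_cancel] at h2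
      rw [Real.coe_toNNReal _ (inv_nonneg.2 (by linarith)), inv_mul_eq_div, le_div_iff₀ (by linarith)]
      linarith) k
  have hTS : μHE[k] (T '' S) = ENNReal.ofReal J * volume S :=
    T.toLinearMap.euclideanHausdorffMeasure_image_eq_normDet_mul_volume S
  rw [hTS] at hup hlow
  constructor
  · have h1 : (a : ENNReal) ≤ ENNReal.ofReal ((1 - ε) ^ k) * ENNReal.ofReal J := by
      rw [← ENNReal.ofReal_mul (by have : 0 ≤ 1 - ε := by linarith
                                   positivity), ← ENNReal.ofReal_coe_nnreal]
      exact ENNReal.ofReal_le_ofReal hεa.le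
    have h2 : ENNReal.ofReal ((1 - ε) ^ k) * ENNReal.ofReal ((1 - ε)⁻¹) ^ k = 1 := by
      rw [← ENNReal.ofReal_pow (inv_nonneg.2 (by linarith)), ← ENNReal.ofReal_mul (by
        have : 0 ≤ 1 - ε := by linarith
        positivity), ← mul_pow, mul_inv_cancel₀ (by linarith)]
      simp
    calc (a : ENNReal) * volume S
        ≤ ENNReal.ofReal ((1 - ε) ^ k) * ENNReal.ofReal J * volume S := by gcongr
      _ = ENNReal.ofReal ((1 - ε) ^ k) * (ENNReal.ofReal J * volume S) := mul_assoc _ _ _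
      _ ≤ ENNReal.ofReal ((1 - ε) ^ k) * _ := mul_le_mul_right hlow _
      _ = _ := by
        change _ * (ENNReal.ofReal ((1 - ε)⁻¹) ^ k * _) = _
        rw [← mul_assoc, h2, one_mul]
  · refine hup.trans ?_
    rw [← mul_assoc]
    gcongr
    change ENNReal.ofReal (1 + ε) ^ k * _ ≤ _
    rw [← ENNReal.ofReal_pow (by positivity), ← ENNReal.ofReal_mul (by positivity),
      ← ENNReal.ofReal_coe_nnreal]
    exact ENNReal.ofReal_le_ofReal hεb.le

/-- The area formula for an injective immersion `G`. The pulled back Hausdorff measure is absolutely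
continuous and its density is computed as the limit of the ratios of measures of small balls. -/
theorem comap_euclideanHausdorffMeasure {G : E → F} (hG : ContDiff ℝ ∞ G)
    (hinj : Function.Injective G) (hd : ∀ y, Function.Injective (fderiv ℝ G y)) :
    Measure.comap G (μHE[Module.finrank ℝ E] : Measure F) = (volume : Measure E).withDensity
      fun y => ENNReal.ofReal (fderiv ℝ G y).toLinearMap.normDet := by
  have hemb : MeasurableEmbedding G := hG.continuous.measurableEmbedding hinj
  set ν := Measure.comap G (μHE[Module.finrank ℝ E] : Measure F) with hν
  have hstrict : ∀ y, HasStrictFDerivAt G (fderiv ℝ G y) y := fun y =>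
    hG.contDiffAt.hasStrictFDerivAt (by simp)
  have hup : ∀ y, ∀ b : NNReal, (fderiv ℝ G y).toLinearMap.normDet < b →
      ∃ W ∈ 𝓝 y, ∀ S ⊆ W, ν S ≤ b * volume S := by
    intro y b hb
    -- the lower bound is not needed here, and the determinant is positive
    have hpos : 0 < (fderiv ℝ G y).toLinearMap.normDet := by
      refine lt_of_le_of_ne (LinearMap.normDet_nonneg _) fun h0 => ?_
      exact LinearMap.normDet_eq_zero_iff_ker_ne_bot.1 h0.symm (LinearMap.ker_eq_bot.2 (hd y))
    obtain ⟨W, hW, h⟩ := exists_nhds_image_measure_bounds (hstrict y) (hd y) (a := 0)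
      (by simpa using hpos) hb
    exact ⟨W, hW, fun S hS => by rw [hν, hemb.comap_apply]; exact (h S hS).2⟩
  have hlow : ∀ y, ∀ a : NNReal, (a : ℝ) < (fderiv ℝ G y).toLinearMap.normDet →
      ∃ W ∈ 𝓝 y, ∀ S ⊆ W, a * volume S ≤ ν S := by
    intro y a ha
    obtain ⟨b, hb⟩ := exists_gt (fderiv ℝ G y).toLinearMap.normDet.toNNReal
    obtain ⟨W, hW, h⟩ := exists_nhds_image_measure_bounds (hstrict y) (hd y) ha
      ((Real.le_coe_toNNReal _).trans_lt (NNReal.coe_lt_coe.2 hb))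
    exact ⟨W, hW, fun S hS => by rw [hν, hemb.comap_apply]; exact (h S hS).1⟩
  have hup' : ∀ y, ∃ b : NNReal, ∃ W ∈ 𝓝 y, ∀ S ⊆ W, ν S ≤ b * volume S := by
    intro y
    obtain ⟨b, hb⟩ := exists_gt (fderiv ℝ G y).toLinearMap.normDet.toNNReal
    exact ⟨b, hup y b ((Real.le_coe_toNNReal _).trans_lt (NNReal.coe_lt_coe.2 hb))⟩
  have : IsLocallyFiniteMeasure ν := by
    refine ⟨fun y => ?_⟩
    obtain ⟨b, W, hW, h⟩ := hup' y
    refine ⟨W ∩ Metric.ball y 1, inter_mem hW (Metric.ball_mem_nhds y one_pos), ?_⟩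
    refine (h _ Set.inter_subset_left).trans_lt (ENNReal.mul_lt_top (by simp) ?_)
    exact (measure_mono Set.inter_subset_right).trans_lt measure_ball_lt_top
  have hac : ν ≪ volume := by
    intro S hS
    refine measure_null_of_locally_null S fun y _ => ?_
    obtain ⟨b, W, hW, h⟩ := hup' y
    refine ⟨W ∩ S, inter_mem (nhdsWithin_le_nhds hW) self_mem_nhdsWithin, ?_⟩
    refine le_antisymm ((h _ Set.inter_subset_left).trans ?_) bot_le
    rw [measure_mono_null Set.inter_subset_right hS, mul_zero]
  rw [← Measure.withDensity_rnDeriv_eq ν volume hac]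
  refine withDensity_congr_ae ?_
  filter_upwards [Besicovitch.ae_tendsto_rnDeriv ν (volume : Measure E)] with y hy
  refine tendsto_nhds_unique hy ?_
  have hball : ∀ W ∈ 𝓝 y, ∀ᶠ r in 𝓝[>] (0 : ℝ), 0 < r ∧ Metric.closedBall y r ⊆ W := by
    intro W hW
    obtain ⟨δ, hδ, h⟩ := Metric.nhds_basis_closedBall.mem_iff.1 hW
    filter_upwards [Ioo_mem_nhdsGT hδ] with r hr
    exact ⟨hr.1, (Metric.closedBall_subset_closedBall hr.2.le).trans h⟩
  refine tendsto_order.2 ⟨fun a' ha' => ?_, fun b' hb' => ?_⟩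
  · obtain ⟨a, ha, haJ⟩ := ENNReal.lt_iff_exists_nnreal_btwn.1 ha'
    obtain ⟨W, hW, h⟩ := hlow y a (by
      rw [← ENNReal.ofReal_coe_nnreal] at haJ
      exact (ENNReal.ofReal_lt_ofReal_iff_of_nonneg a.2).1 haJ)
    filter_upwards [hball W hW] with r hr
    refine ha.trans_le ?_
    rw [ENNReal.le_div_iff_mul_le (.inl (Metric.measure_closedBall_pos _ _ hr.1).ne')
      (.inl measure_closedBall_lt_top.ne)]
    exact h _ hr.2
  · obtain ⟨b, hbJ, hb⟩ := ENNReal.lt_iff_exists_nnreal_btwn.1 hb'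
    obtain ⟨W, hW, h⟩ := hup y b (by
      rw [← ENNReal.ofReal_coe_nnreal] at hbJ
      exact (ENNReal.ofReal_lt_ofReal_iff_of_nonneg (LinearMap.normDet_nonneg _)).1 hbJ)
    filter_upwards [hball W hW] with r hr
    refine lt_of_le_of_lt ?_ hb
    rw [ENNReal.div_le_iff_le_mul (.inl (Metric.measure_closedBall_pos _ _ hr.1).ne')
      (.inl measure_closedBall_lt_top.ne)]
    exact h _ hr.2

end AreaFormula

/-! ### The divergence theorem on half-spaces and subgraphs -/

section HalfSpace

variable {n : ℕ} {f : Fin (n + 1) → (Fin (n + 1) → ℝ) → ℝ}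

theorem exists_box_of_hasCompactSupport (hc : ∀ l, HasCompactSupport (f l)) :
    ∃ R : ℝ, 0 < R ∧ ∀ l, ∀ x ∈ tsupport (f l), ∀ j, |x j| < R := by
  have hK : IsCompact (⋃ l, tsupport (f l)) := isCompact_iUnion hc
  obtain ⟨R, hR⟩ := hK.isBounded.exists_norm_le
  refine ⟨|R| + 1, by positivity, fun l x hx j => ?_⟩
  have h1 := hR x (Set.mem_iUnion.2 ⟨l, hx⟩)
  have h2 := norm_le_pi_norm x j
  rw [Real.norm_eq_abs] at h2
  linarith [le_abs_self R]

theorem fderiv_eq_zero_of_notMem_tsupport {E F : Type} [NormedAddCommGroup E] [NormedSpace ℝ E]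
    [NormedAddCommGroup F] [NormedSpace ℝ F] {f : E → F} {x : E} (hx : x ∉ tsupport f) :
    fderiv ℝ f x = 0 := by
  by_contra h
  exact hx (support_fderiv_subset ℝ h)

theorem integrable_divergence_pi (hf : ∀ l, ContDiff ℝ ∞ (f l))
    (hc : ∀ l, HasCompactSupport (f l)) :
    Integrable (fun x => ∑ l, fderiv ℝ (f l) x (Pi.single l 1)) := by
  refine integrable_finsetSum _ fun l _ => Continuous.integrable_of_hasCompactSupport
    ((contDiff_infty_iff_fderiv.1 (hf l)).2.continuous.clm_apply continuous_const) ?_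
  exact ((hc l).fderiv ℝ).comp_left (g := fun T : (Fin (n + 1) → ℝ) →L[ℝ] ℝ => T (Pi.single l 1)) rfl

theorem integral_divergence_halfSpace_neg (hf : ∀ l, ContDiff ℝ ∞ (f l))
    (hc : ∀ l, HasCompactSupport (f l)) (i : Fin (n + 1)) :
    ∫ x in {x : Fin (n + 1) → ℝ | x i < 0}, ∑ l, fderiv ℝ (f l) x (Pi.single l 1) =
      ∫ y : Fin n → ℝ, f i (i.insertNth 0 y) := by
  obtain ⟨R, hR, hbox⟩ := exists_box_of_hasCompactSupport hc
  have hzero : ∀ l x j, R ≤ |x j| → f l x = 0 := fun l x j h =>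
    image_eq_zero_of_notMem_tsupport fun hx => (hbox l x hx j).not_ge h
  have hdzero : ∀ x j, R ≤ |x j| → ∑ l, fderiv ℝ (f l) x (Pi.single l 1) = 0 := fun x j h =>
    Finset.sum_eq_zero fun l _ => by
      rw [fderiv_eq_zero_of_notMem_tsupport fun hx => (hbox l x hx j).not_ge h]; rfl
  set a : Fin (n + 1) → ℝ := fun _ => -R
  set b : Fin (n + 1) → ℝ := Function.update (fun _ => R) i 0 with hb
  have hbi : b i = 0 := Function.update_self _ _ _
  have hbl : ∀ l, l ≠ i → b l = R := fun l hl => Function.update_of_ne hl _ _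
  have hab : a ≤ b := by
    intro l
    by_cases hl : l = i
    · rw [hl, hbi]; exact neg_nonpos.2 hR.le
    · rw [hbl l hl]; exact neg_le_self hR.le
  have hae : ({x : Fin (n + 1) → ℝ | x i < 0} : Set _) =ᵐ[volume]
      {x : Fin (n + 1) → ℝ | x i ≤ 0} := by
    have h0 : volume {x : Fin (n + 1) → ℝ | x i = 0} = 0 := Measure.pi_hyperplane _ i 0
    filter_upwards [measure_eq_zero_iff_ae_notMem.1 h0] with x hx
    exact propext ⟨fun h => le_of_lt h, fun h => lt_of_le_of_ne h hx⟩
  have hset : ∫ x in {x : Fin (n + 1) → ℝ | x i ≤ 0}, ∑ l, fderiv ℝ (f l) x (Pi.single l 1) =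
      ∫ x in Set.Icc a b, ∑ l, fderiv ℝ (f l) x (Pi.single l 1) := by
    refine setIntegral_eq_of_subset_of_forall_sdiff_eq_zero
      (measurableSet_le (measurable_pi_apply i) measurable_const)
      (fun x hx => (hx.2 i).trans hbi.le) ?_
    rintro x ⟨hx, hx'⟩
    by_contra h
    have h1 : ∀ j, |x j| < R := fun j => not_le.1 fun hj => h (hdzero x j hj)
    refine hx' ⟨fun j => (abs_lt.1 (h1 j)).1.le, fun j => ?_⟩
    by_cases hj : j = i
    · rw [hj, hbi]; exact hx
    · rw [hbl j hj]; exact (abs_lt.1 (h1 j)).2.le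
  rw [setIntegral_congr_set hae, hset,
    integral_divergence_of_hasFDerivAt_off_countable' a b hab f (fun l => fderiv ℝ (f l)) ∅
      Set.countable_empty (fun l => (hf l).continuous.continuousOn)
      (fun x _ l => ((contDiff_infty_iff_fderiv.1 (hf l)).1 x).hasFDerivAt)
      (integrable_divergence_pi hf hc).integrableOn]
  have hback : ∀ l (y : Fin n → ℝ), f l (l.insertNth (a l) y) = 0 := fun l y =>
    hzero l _ l (by rw [Fin.insertNth_apply_same, abs_neg, abs_of_pos hR])
  have hfront : ∀ l, l ≠ i → ∀ (y : Fin n → ℝ), f l (l.insertNth (b l) y) = 0 := fun l hl y =>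
    hzero l _ l (by rw [Fin.insertNth_apply_same, hbl l hl, abs_of_pos hR])
  rw [Finset.sum_eq_single i]
  · simp only [hback, integral_zero, sub_zero, hbi]
    refine setIntegral_eq_integral_of_forall_compl_eq_zero fun y hy => ?_
    by_contra h
    have h1 : ∀ j, |(i.insertNth 0 y : Fin (n + 1) → ℝ) j| < R :=
      fun j => not_le.1 fun hj => h (hzero i _ j hj)
    refine hy ⟨fun j => ?_, fun j => ?_⟩
    · have := (abs_lt.1 (h1 (i.succAbove j))).1
      rw [Fin.insertNth_apply_succAbove] at this
      exact this.le
    · have := (abs_lt.1 (h1 (i.succAbove j))).2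
      rw [Fin.insertNth_apply_succAbove] at this
      rw [Function.comp_apply, hbl _ (Fin.succAbove_ne i j)]
      exact this.le
  · intro l _ hl
    simp [hback, hfront l hl]
  · simp

theorem integral_divergence_pi_eq_zero (hf : ∀ l, ContDiff ℝ ∞ (f l))
    (hc : ∀ l, HasCompactSupport (f l)) :
    ∫ x, ∑ l, fderiv ℝ (f l) x (Pi.single l 1) = 0 := by
  obtain ⟨R, hR, hbox⟩ := exists_box_of_hasCompactSupport hc
  have hzero : ∀ l x j, R ≤ |x j| → f l x = 0 := fun l x j h =>
    image_eq_zero_of_notMem_tsupport fun hx => (hbox l x hx j).not_ge h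
  have hset : ∫ x in Set.Icc (fun _ => -R) (fun _ => R), ∑ l, fderiv ℝ (f l) x (Pi.single l 1) =
      ∫ x, ∑ l, fderiv ℝ (f l) x (Pi.single l 1) := by
    refine setIntegral_eq_integral_of_forall_compl_eq_zero fun x hx =>
      Finset.sum_eq_zero fun l _ => ?_
    rw [fderiv_eq_zero_of_notMem_tsupport fun h => ?_]
    · rfl
    · exact hx ⟨fun j => (abs_lt.1 (hbox l x h j)).1.le, fun j => (abs_lt.1 (hbox l x h j)).2.le⟩
  rw [← hset, integral_divergence_of_hasFDerivAt_off_countable' _ _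
      (fun _ => neg_le_self hR.le) f (fun l => fderiv ℝ (f l)) ∅
      Set.countable_empty (fun l => (hf l).continuous.continuousOn)
      (fun x _ l => ((contDiff_infty_iff_fderiv.1 (hf l)).1 x).hasFDerivAt)
      (integrable_divergence_pi hf hc).integrableOn]
  refine Finset.sum_eq_zero fun l _ => ?_
  have hback : ∀ (y : Fin n → ℝ), f l (l.insertNth (-R) y) = 0 := fun y =>
    hzero l _ l (by rw [Fin.insertNth_apply_same, abs_neg, abs_of_pos hR])
  have hfront : ∀ (y : Fin n → ℝ), f l (l.insertNth R y) = 0 := fun y =>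
    hzero l _ l (by rw [Fin.insertNth_apply_same, abs_of_pos hR])
  simp [hback, hfront]

theorem integral_divergence_halfSpace_pos (hf : ∀ l, ContDiff ℝ ∞ (f l))
    (hc : ∀ l, HasCompactSupport (f l)) (i : Fin (n + 1)) :
    ∫ x in {x : Fin (n + 1) → ℝ | 0 < x i}, ∑ l, fderiv ℝ (f l) x (Pi.single l 1) =
      -∫ y : Fin n → ℝ, f i (i.insertNth 0 y) := by
  have hae : ({x : Fin (n + 1) → ℝ | 0 < x i} : Set _) =ᵐ[volume]
      ({x : Fin (n + 1) → ℝ | x i < 0}ᶜ : Set _) := by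
    have h0 : volume {x : Fin (n + 1) → ℝ | x i = 0} = 0 := Measure.pi_hyperplane _ i 0
    filter_upwards [measure_eq_zero_iff_ae_notMem.1 h0] with x hx
    exact propext ⟨fun h => not_lt.2 (le_of_lt h), fun h => lt_of_le_of_ne (not_lt.1 h) (Ne.symm hx)⟩
  have h1 := integral_add_compl (s := {x : Fin (n + 1) → ℝ | x i < 0})
    (measurableSet_lt (measurable_pi_apply i) measurable_const) (integrable_divergence_pi hf hc)
  rw [integral_divergence_pi_eq_zero hf hc, integral_divergence_halfSpace_neg hf hc i] at h1
  rw [setIntegral_congr_set hae]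
  linarith

end HalfSpace

/-- The divergence of a vector field on `ℝ^m`. -/
noncomputable def euDiv {m : ℕ} (X : Eu m → Eu m) (x : Eu m) : ℝ :=
  ∑ l, fderiv ℝ (fun y => X y l) x (EuclideanSpace.single l 1)

theorem contDiff_component {m : ℕ} {E : Type} [NormedAddCommGroup E] [NormedSpace ℝ E]
    {X : E → Eu m} {k : WithTop ℕ∞} (hX : ContDiff ℝ k X) (l : Fin m) :
    ContDiff ℝ k (fun y => X y l) :=
  (EuclideanSpace.proj (𝕜 := ℝ) l).contDiff.comp hX

section Transfer

variable {n : ℕ} {W : Eu (n + 1) → Eu (n + 1)}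

theorem hasCompactSupport_component {m : ℕ} {W : Eu m → Eu m} (hc : HasCompactSupport W)
    (l : Fin m) : HasCompactSupport (fun y => W y l) :=
  hc.comp_left (g := fun v : Eu m => v l) rfl

theorem fderiv_comp_toLp {m : ℕ} {f : Eu m → ℝ} (hf : Differentiable ℝ f) (x : Fin m → ℝ)
    (l : Fin m) : fderiv ℝ (fun x : Fin m → ℝ => f (WithLp.toLp 2 x)) x (Pi.single l 1) =
      fderiv ℝ f (WithLp.toLp 2 x) (EuclideanSpace.single l 1) := by
  have h1 := (PiLp.continuousLinearEquiv 2 ℝ (fun _ : Fin m => ℝ)).symm.hasFDerivAt (x := x)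
  have h2 := (hf (WithLp.toLp 2 x)).hasFDerivAt.comp x h1
  have h3 := h2.fderiv
  change fderiv ℝ (f ∘ WithLp.toLp 2) x _ = _
  refine (congrArg (fun T : (Fin m → ℝ) →L[ℝ] ℝ => T (Pi.single l 1)) h3).trans ?_
  rfl

/-- The hyperplane of vectors with vanishing `i`-th coordinate, parametrized by `ℝ^n`. -/
noncomputable def hyperplaneMap (i : Fin (n + 1)) : Eu n →ₗᵢ[ℝ] Eu (n + 1) where
  toFun y := WithLp.toLp 2 (i.insertNth (0 : ℝ) (fun j => y j))
  map_add' y z := by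
    ext l
    refine Fin.succAboveCases i ?_ (fun j => ?_) l <;> simp
  map_smul' c y := by
    ext l
    refine Fin.succAboveCases i ?_ (fun j => ?_) l <;> simp
  norm_map' y := by
    simp [EuclideanSpace.norm_eq, Fin.sum_univ_succAbove _ i]

@[simp] theorem hyperplaneMap_apply_same (i : Fin (n + 1)) (y : Eu n) :
    hyperplaneMap i y i = 0 := by simp [hyperplaneMap]

@[simp] theorem hyperplaneMap_apply_succAbove (i : Fin (n + 1)) (y : Eu n) (j : Fin n) :
    hyperplaneMap i y (i.succAbove j) = y j := by simp [hyperplaneMap]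

theorem integral_euDiv_halfSpace (hW : ContDiff ℝ ∞ W) (hc : HasCompactSupport W)
    (i : Fin (n + 1)) {e : Eu (n + 1)}
    (he : e = EuclideanSpace.single i (1 : ℝ) ∨ e = -EuclideanSpace.single i (1 : ℝ)) :
    ∫ x in {x : Eu (n + 1) | inner ℝ x e < 0}, euDiv W x =
      ∫ y : Eu n, inner ℝ (W (hyperplaneMap i y)) e := by
  set f : Fin (n + 1) → (Fin (n + 1) → ℝ) → ℝ := fun l x => W (WithLp.toLp 2 x) l with hf
  have hto : ContDiff ℝ ∞ (fun x : Fin (n + 1) → ℝ => (WithLp.toLp 2 x : Eu (n + 1))) :=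
    (PiLp.continuousLinearEquiv 2 ℝ (fun _ : Fin (n + 1) => ℝ)).symm.contDiff
  have hfs : ∀ l, ContDiff ℝ ∞ (f l) := fun l => (contDiff_component hW l).comp hto
  have hfc : ∀ l, HasCompactSupport (f l) := fun l =>
    (hasCompactSupport_component hc l).comp_homeomorph
      (PiLp.continuousLinearEquiv 2 ℝ (fun _ : Fin (n + 1) => ℝ)).symm.toHomeomorph
  have hdiv : ∀ x, euDiv W (WithLp.toLp 2 x) = ∑ l, fderiv ℝ (f l) x (Pi.single l 1) := fun x =>
    Finset.sum_congr rfl fun l _ => (fderiv_comp_toLp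
      (contDiff_infty_iff_fderiv.1 (contDiff_component hW l)).1 x l).symm
  have hvol := PiLp.volume_preserving_toLp (Fin (n + 1))
  have hemb : MeasurableEmbedding (WithLp.toLp 2 : (Fin (n + 1) → ℝ) → Eu (n + 1)) :=
    (MeasurableEquiv.toLp 2 (Fin (n + 1) → ℝ)).measurableEmbedding
  have hvol' := PiLp.volume_preserving_toLp (Fin n)
  have hemb' : MeasurableEmbedding (WithLp.toLp 2 : (Fin n → ℝ) → Eu n) :=
    (MeasurableEquiv.toLp 2 (Fin n → ℝ)).measurableEmbedding
  rw [← hvol.setIntegral_preimage_emb hemb, ← hvol'.integral_comp hemb']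
  simp only [hdiv]
  rcases he with rfl | rfl
  · have hs : (WithLp.toLp 2 : (Fin (n + 1) → ℝ) → Eu (n + 1)) ⁻¹'
        {x | inner ℝ x (EuclideanSpace.single i (1 : ℝ)) < 0} = {x | x i < 0} := by
      ext x; simp [EuclideanSpace.inner_single_right]
    rw [hs, integral_divergence_halfSpace_neg hfs hfc i]
    simp [hf, hyperplaneMap, EuclideanSpace.inner_single_right]
  · have hs : (WithLp.toLp 2 : (Fin (n + 1) → ℝ) → Eu (n + 1)) ⁻¹'
        {x | inner ℝ x (-EuclideanSpace.single i (1 : ℝ)) < 0} = {x | 0 < x i} := by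
      ext x; simp [EuclideanSpace.inner_single_right]
    rw [hs, integral_divergence_halfSpace_pos hfs hfc i, ← integral_neg]
    simp [hf, hyperplaneMap, EuclideanSpace.inner_single_right]

theorem integral_euDiv_eq_zero {m : ℕ} {W : Eu m → Eu m} (hW : ContDiff ℝ ∞ W)
    (hc : HasCompactSupport W) : ∫ x, euDiv W x = 0 := by
  rcases m with _ | n
  · simp [euDiv]
  set f : Fin (n + 1) → (Fin (n + 1) → ℝ) → ℝ := fun l x => W (WithLp.toLp 2 x) l with hf
  have hto : ContDiff ℝ ∞ (fun x : Fin (n + 1) → ℝ => (WithLp.toLp 2 x : Eu (n + 1))) :=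
    (PiLp.continuousLinearEquiv 2 ℝ (fun _ : Fin (n + 1) => ℝ)).symm.contDiff
  have hfs : ∀ l, ContDiff ℝ ∞ (f l) := fun l => (contDiff_component hW l).comp hto
  have hfc : ∀ l, HasCompactSupport (f l) := fun l =>
    (hasCompactSupport_component hc l).comp_homeomorph
      (PiLp.continuousLinearEquiv 2 ℝ (fun _ : Fin (n + 1) => ℝ)).symm.toHomeomorph
  have hdiv : ∀ x, euDiv W (WithLp.toLp 2 x) = ∑ l, fderiv ℝ (f l) x (Pi.single l 1) := fun x =>
    Finset.sum_congr rfl fun l _ => (fderiv_comp_toLp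
      (contDiff_infty_iff_fderiv.1 (contDiff_component hW l)).1 x l).symm
  rw [← (PiLp.volume_preserving_toLp (Fin (n + 1))).integral_comp
    (MeasurableEquiv.toLp 2 (Fin (n + 1) → ℝ)).measurableEmbedding]
  simp only [hdiv]
  exact integral_divergence_pi_eq_zero hfs hfc

end Transfer

namespace IsGraphChart

section Shear

variable {m : ℕ} {Ω : Set (Eu m)} {e : Eu m} {g : Eu m → ℝ} {U : Set (Eu m)}

theorem fderiv_add_smul (h : IsGraphChart Ω e g U) (x : Eu m) (s : ℝ) :
    fderiv ℝ g (x + s • e) = fderiv ℝ g x := by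
  rw [← fderiv_comp_add_right]
  simp only [h.apply_add_smul]

theorem conormal_add_smul (h : IsGraphChart Ω e g U) (x : Eu m) (s : ℝ) :
    conormal e g (x + s • e) = conormal e g x := by
  rw [conormal, conormal, gradient, gradient, h.fderiv_add_smul]

/-- The shear `x ↦ x + g x e`, which maps the half-space `{x·e < 0}` onto the subgraph of `g`. -/
theorem hasFDerivAt_shear (h : IsGraphChart Ω e g U) (x : Eu m) :
    HasFDerivAt (fun x => x + g x • e)
      (ContinuousLinearMap.id ℝ (Eu m) + (fderiv ℝ g x).smulRight e) x :=
  (hasFDerivAt_id x).add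
    (((contDiff_infty_iff_fderiv.1 h.smooth).1 x).hasFDerivAt.smul_const e)

theorem contDiff_shear (h : IsGraphChart Ω e g U) : ContDiff ℝ ∞ (fun x => x + g x • e) :=
  contDiff_id.add (h.smooth.smul contDiff_const)

theorem det_shear (h : IsGraphChart Ω e g U) (x : Eu m) :
    (ContinuousLinearMap.id ℝ (Eu m) + (fderiv ℝ g x).smulRight e).det = 1 := by
  have h1 := LinearMap.transvection.det (fderiv ℝ g x).toLinearMap e
  have h2 : LinearMap.transvection (fderiv ℝ g x).toLinearMap e =
    (ContinuousLinearMap.id ℝ (Eu m) + (fderiv ℝ g x).smulRight e).toLinearMap := by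
    ext v; simp [LinearMap.transvection]
  rw [ContinuousLinearMap.det, ← h2, h1]
  simp [h.fderiv_dir]

theorem shear_leftInverse (h : IsGraphChart Ω e g U) (x : Eu m) :
    (x + g x • e) - g (x + g x • e) • e = x := by
  rw [h.apply_add_smul, add_sub_cancel_right]

theorem apply_sub_smul (h : IsGraphChart Ω e g U) (x : Eu m) (s : ℝ) : g (x - s • e) = g x := by
  rw [sub_eq_add_neg, ← neg_smul, h.apply_add_smul]

theorem setIntegral_subgraph (h : IsGraphChart Ω e g U) (f : Eu m → ℝ) :
    ∫ x in {x | inner ℝ x e < g x}, f x = ∫ x in {x | inner ℝ x e < 0}, f (x + g x • e) := by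
  have himg : (fun x => x + g x • e) '' {x | inner ℝ x e < 0} = {x | inner ℝ x e < g x} := by
    ext x
    simp only [Set.mem_image, Set.mem_ofPred_eq]
    constructor
    · rintro ⟨y, hy, rfl⟩
      rw [h.apply_add_smul, inner_add_left, real_inner_smul_left, h.inner_dir]
      linarith
    · intro hx
      refine ⟨x - g x • e, ?_, ?_⟩
      · rw [inner_sub_left, real_inner_smul_left, h.inner_dir]
        linarith
      · rw [h.apply_sub_smul, sub_add_cancel]
  have hinj : Function.Injective (fun x => x + g x • e) :=
    Function.LeftInverse.injective (g := fun x => x - g x • e) h.shear_leftInverse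
  rw [← himg, integral_image_eq_integral_abs_det_fderiv_smul volume
    (measurableSet_lt (by fun_prop) measurable_const)
    (fun x _ => (h.hasFDerivAt_shear x).hasFDerivWithinAt) hinj.injOn]
  simp [h.det_shear]

/-- The Piola transform of `Y` under the shear. -/
noncomputable def pullback (e : Eu m) (g : Eu m → ℝ) (Y : Eu m → Eu m) (x : Eu m) : Eu m :=
  Y (x + g x • e) - fderiv ℝ g x (Y (x + g x • e)) • e

theorem contDiff_pullback (h : IsGraphChart Ω e g U) {Y : Eu m → Eu m} (hY : ContDiff ℝ ∞ Y) :
    ContDiff ℝ ∞ (pullback e g Y) := by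
  have h1 := hY.comp h.contDiff_shear
  exact h1.sub (((contDiff_infty_iff_fderiv.1 h.smooth).2.clm_apply h1).smul contDiff_const)

theorem hasCompactSupport_pullback (h : IsGraphChart Ω e g U) {Y : Eu m → Eu m}
    (hc : HasCompactSupport Y) : HasCompactSupport (pullback e g Y) := by
  have hcont : Continuous fun x => x - g x • e :=
    continuous_id.sub (h.smooth.continuous.smul continuous_const)
  refine HasCompactSupport.intro (IsCompact.image hc hcont) fun x hx => ?_
  have h0 : Y (x + g x • e) = 0 := by
    by_contra hne
    exact hx ⟨x + g x • e, subset_tsupport _ hne, h.shear_leftInverse x⟩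
  simp [pullback, h0]

theorem inner_pullback (h : IsGraphChart Ω e g U) (Y : Eu m → Eu m) (x : Eu m) :
    inner ℝ (pullback e g Y x) e = inner ℝ (Y (x + g x • e)) (conormal e g x) := by
  rw [pullback, inner_sub_left, real_inner_smul_left, h.inner_dir, mul_one, inner_conormal]

theorem fderiv_eq_sum {m : ℕ} (T : Eu m →L[ℝ] ℝ) (v : Eu m) :
    T v = ∑ l, v l * T (EuclideanSpace.single l 1) := by
  conv_lhs => rw [← (EuclideanSpace.basisFun (Fin m) ℝ).sum_repr v]
  simp [map_sum]

/-- The Piola identity: the shear has determinant one. -/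
theorem euDiv_pullback (h : IsGraphChart Ω e g U) {Y : Eu m → Eu m} (hY : ContDiff ℝ ∞ Y)
    (x : Eu m) : euDiv (pullback e g Y) x = euDiv Y (x + g x • e) := by
  have hYd := (contDiff_infty_iff_fderiv.1 hY).1
  have hYl : ∀ l, Differentiable ℝ (fun y => Y y l) := fun l =>
    (contDiff_infty_iff_fderiv.1 (contDiff_component hY l)).1
  set S : Eu m → Eu m := fun x => x + g x • e with hS
  set D := ContinuousLinearMap.id ℝ (Eu m) + (fderiv ℝ g x).smulRight e with hD
  have hSd : HasFDerivAt S D x := h.hasFDerivAt_shear x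
  set ψ : Eu m → ℝ := fun x => fderiv ℝ g x (Y (S x)) with hψ
  have hψs : ContDiff ℝ ∞ ψ :=
    (contDiff_infty_iff_fderiv.1 h.smooth).2.clm_apply (hY.comp h.contDiff_shear)
  have hψd := (contDiff_infty_iff_fderiv.1 hψs).1
  -- along `e` the differential of `g` is constant
  have hψe : fderiv ℝ ψ x e = fderiv ℝ g x (fderiv ℝ Y (S x) e) := by
    have h2 : HasDerivAt (fun s : ℝ => x + s • e) e 0 := by
      simpa using ((hasDerivAt_id (0 : ℝ)).smul_const e).const_add x
    have h3 : HasDerivAt (fun s : ℝ => ψ (x + s • e)) (fderiv ℝ ψ x e) 0 := by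
      have h4 : HasFDerivAt ψ (fderiv ℝ ψ x) (x + (0 : ℝ) • e) := by
        simpa using (hψd x).hasFDerivAt
      exact h4.comp_hasDerivAt _ h2
    have h5 : (fun s : ℝ => ψ (x + s • e)) = fun s : ℝ => fderiv ℝ g x (Y (S x + s • e)) := by
      funext s
      simp only [hψ, hS, h.fderiv_add_smul, h.apply_add_smul]
      congr 2
      abel
    rw [h5] at h3
    have h6 : HasDerivAt (fun s : ℝ => S x + s • e) e 0 := by
      simpa using ((hasDerivAt_id (0 : ℝ)).smul_const e).const_add (S x)
    have h7 : HasFDerivAt Y (fderiv ℝ Y (S x)) (S x + (0 : ℝ) • e) := by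
      simpa using (hYd _).hasFDerivAt
    exact h3.unique ((fderiv ℝ g x).hasFDerivAt.comp_hasDerivAt _ (h7.comp_hasDerivAt _ h6))
  have hcomp : ∀ l, fderiv ℝ (fun y => pullback e g Y y l) x (EuclideanSpace.single l 1) =
      fderiv ℝ (fun y => Y y l) (S x) (EuclideanSpace.single l 1) +
      (fderiv ℝ g x (EuclideanSpace.single l 1) * fderiv ℝ (fun y => Y y l) (S x) e -
        e l * fderiv ℝ ψ x (EuclideanSpace.single l 1)) := by
    intro l
    have h1 : HasFDerivAt (fun y => Y (S y) l) ((fderiv ℝ (fun y => Y y l) (S x)).comp D) x :=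
      HasFDerivAt.comp x (hYl l (S x)).hasFDerivAt hSd
    have h2 : HasFDerivAt (fun y => ψ y * e l) (e l • fderiv ℝ ψ x) x :=
      (hψd x).hasFDerivAt.mul_const (e l)
    have h3 : HasFDerivAt (fun y => pullback e g Y y l) _ x := h1.sub h2
    rw [h3.fderiv]
    simp [hD]
    ring
  have hYe : ∀ l, fderiv ℝ (fun y => Y y l) (S x) e = fderiv ℝ Y (S x) e l := by
    intro l
    have h1 : HasFDerivAt (fun y => Y y l)
        ((EuclideanSpace.proj (𝕜 := ℝ) l).comp (fderiv ℝ Y (S x))) (S x) :=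
      (EuclideanSpace.proj (𝕜 := ℝ) l).hasFDerivAt.comp _ (hYd _).hasFDerivAt
    rw [h1.fderiv]
    rfl
  simp only [euDiv, hcomp, Finset.sum_add_distrib, Finset.sum_sub_distrib, hYe]
  rw [← fderiv_eq_sum (fderiv ℝ ψ x) e, hψe, fderiv_eq_sum (fderiv ℝ g x) (fderiv ℝ Y (S x) e)]
  simp [mul_comm]
  rfl

end Shear

section Graph

variable {n : ℕ} {Ω : Set (Eu (n + 1))} {e : Eu (n + 1)} {g : Eu (n + 1) → ℝ} {U : Set (Eu (n + 1))}
  {i : Fin (n + 1)}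

/-- The parametrization of the graph of `g` over the coordinate hyperplane orthogonal to `e`. -/
noncomputable def graphMap (e : Eu (n + 1)) (g : Eu (n + 1) → ℝ) (i : Fin (n + 1)) (y : Eu n) :
    Eu (n + 1) :=
  hyperplaneMap i y + g (hyperplaneMap i y) • e

theorem integral_euDiv_subgraph (h : IsGraphChart Ω e g U)
    (he : e = EuclideanSpace.single i (1 : ℝ) ∨ e = -EuclideanSpace.single i (1 : ℝ))
    {Y : Eu (n + 1) → Eu (n + 1)} (hY : ContDiff ℝ ∞ Y) (hc : HasCompactSupport Y) :
    ∫ x in {x | inner ℝ x e < g x}, euDiv Y x =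
      ∫ y : Eu n, inner ℝ (Y (graphMap e g i y)) (conormal e g (hyperplaneMap i y)) := by
  rw [h.setIntegral_subgraph]
  simp only [← h.euDiv_pullback hY]
  rw [integral_euDiv_halfSpace (h.contDiff_pullback hY) (h.hasCompactSupport_pullback hc) i he]
  simp only [h.inner_pullback]
  rfl

theorem inner_hyperplaneMap_dir
    (he : e = EuclideanSpace.single i (1 : ℝ) ∨ e = -EuclideanSpace.single i (1 : ℝ)) (y : Eu n) :
    inner ℝ (hyperplaneMap i y) e = 0 := by
  rcases he with rfl | rfl <;> simp [EuclideanSpace.inner_single_right]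

theorem contDiff_graphMap (h : IsGraphChart Ω e g U) : ContDiff ℝ ∞ (graphMap e g i) :=
  h.contDiff_shear.comp (hyperplaneMap i).contDiff

theorem graphMap_injective (h : IsGraphChart Ω e g U) : Function.Injective (graphMap e g i) := by
  intro y z hyz
  have hinj : Function.Injective (fun x => x + g x • e) :=
    Function.LeftInverse.injective (g := fun x => x - g x • e) h.shear_leftInverse
  exact (hyperplaneMap i).injective (hinj hyz)

theorem fderiv_graphMap (h : IsGraphChart Ω e g U) (y v : Eu n) :
    fderiv ℝ (graphMap e g i) y v =
      hyperplaneMap i v + fderiv ℝ g (hyperplaneMap i y) (hyperplaneMap i v) • e := by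
  have h1 := (h.hasFDerivAt_shear (hyperplaneMap i y)).comp y
    (hyperplaneMap i).toContinuousLinearMap.hasFDerivAt
  have h2 : HasFDerivAt (graphMap e g i) _ y := h1
  rw [h2.fderiv]
  simp

theorem fderiv_graphMap_injective (h : IsGraphChart Ω e g U)
    (he : e = EuclideanSpace.single i (1 : ℝ) ∨ e = -EuclideanSpace.single i (1 : ℝ)) (y : Eu n) :
    Function.Injective (fderiv ℝ (graphMap e g i) y) := by
  refine (injective_iff_map_eq_zero _).2 fun v hv => ?_
  rw [h.fderiv_graphMap] at hv
  have h1 := congrArg (fun w => inner ℝ w e) hv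
  simp only [inner_add_left, real_inner_smul_left, h.inner_dir, inner_hyperplaneMap_dir he,
    inner_zero_left, mul_one, zero_add] at h1
  rw [h1, zero_smul, add_zero] at hv
  exact (hyperplaneMap i).injective (hv.trans (map_zero _).symm)

theorem range_graphMap (h : IsGraphChart Ω e g U)
    (he : e = EuclideanSpace.single i (1 : ℝ) ∨ e = -EuclideanSpace.single i (1 : ℝ)) :
    Set.range (graphMap e g i) = {x | inner ℝ x e = g x} := by
  ext x
  simp only [Set.mem_range, Set.mem_ofPred_eq]
  constructor
  · rintro ⟨y, rfl⟩
    rw [graphMap, h.apply_add_smul, inner_add_left, inner_hyperplaneMap_dir he,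
      real_inner_smul_left, h.inner_dir]
    ring
  · intro hx
    have hproj : hyperplaneMap i (WithLp.toLp 2 fun j => x (i.succAbove j)) =
        x - (inner ℝ x e : ℝ) • e := by
      ext l
      refine Fin.succAboveCases i ?_ (fun j => ?_) l
      · rcases he with rfl | rfl <;> simp [EuclideanSpace.inner_single_right]
      · rcases he with rfl | rfl <;> simp [Fin.succAbove_ne]
    refine ⟨WithLp.toLp 2 fun j => x (i.succAbove j), ?_⟩
    rw [graphMap, hproj, h.apply_sub_smul, hx, sub_add_cancel]

/-- The Jacobian of the graph parametrization is the length of the conormal `e - ∇g`. -/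
theorem normDet_graphMap (h : IsGraphChart Ω e g U)
    (he : e = EuclideanSpace.single i (1 : ℝ) ∨ e = -EuclideanSpace.single i (1 : ℝ)) (y : Eu n) :
    (fderiv ℝ (graphMap e g i) y).toLinearMap.normDet = ‖conormal e g (hyperplaneMap i y)‖ := by
  set x := hyperplaneMap i y with hx
  set a : Fin n → ℝ := fun j => fderiv ℝ g x (EuclideanSpace.single (i.succAbove j) 1) with ha
  have hbasis : ∀ j, hyperplaneMap i (EuclideanSpace.single j (1 : ℝ)) =
      EuclideanSpace.single (i.succAbove j) (1 : ℝ) := by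
    intro j
    ext l
    refine Fin.succAboveCases i ?_ (fun k => ?_) l
    · simp [(Fin.succAbove_ne i j).symm]
    · simp
  refine (pow_left_inj₀ (LinearMap.normDet_nonneg _) (norm_nonneg _) two_ne_zero).1 ?_
  have h1 := (fderiv ℝ (graphMap e g i) y).toLinearMap.normDet_sq_eq_det_gram
    (EuclideanSpace.basisFun (Fin n) ℝ)
  have h2 : Matrix.gram ℝ (fun j => (fderiv ℝ (graphMap e g i) y).toLinearMap
      (EuclideanSpace.basisFun (Fin n) ℝ j)) =
      1 + Matrix.replicateCol Unit a * Matrix.replicateRow Unit a := by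
    ext j k
    have h3 : inner ℝ (EuclideanSpace.single (i.succAbove j) (1 : ℝ)) e = 0 := by
      rw [← hbasis]; exact inner_hyperplaneMap_dir he _
    have h4 : inner ℝ e (EuclideanSpace.single (i.succAbove k) (1 : ℝ)) = 0 := by
      rw [← hbasis, real_inner_comm]; exact inner_hyperplaneMap_dir he _
    simp only [Matrix.gram_apply, EuclideanSpace.basisFun_apply, ContinuousLinearMap.coe_coe,
      h.fderiv_graphMap, hbasis, inner_add_left, inner_add_right, real_inner_smul_left,
      real_inner_smul_right, h3, h4, h.inner_dir]
    simp [Matrix.mul_apply, Matrix.one_apply, ha, hx, EuclideanSpace.inner_single_left, eq_comm]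
    exact mul_comm _ _
  rw [h2, Matrix.det_one_add_replicateCol_mul_replicateRow] at h1
  have h5 : ‖conormal e g x‖ ^ 2 = 1 + ∑ j, a j * a j := by
    have h6' : ∀ l, inner ℝ (gradient g x) (EuclideanSpace.single l (1 : ℝ)) = gradient g x l := by
      intro l
      rw [EuclideanSpace.inner_single_right]
      simp
    have h6 : ∀ l, gradient g x l = fderiv ℝ g x (EuclideanSpace.single l 1) := by
      intro l
      have h7 : inner ℝ (gradient g x) (EuclideanSpace.single l (1 : ℝ)) =
          fderiv ℝ g x (EuclideanSpace.single l 1) := by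
        rw [gradient, InnerProductSpace.toDual_symm_apply]
      rw [← h7, h6']
    have h8 : inner ℝ (gradient g x) e = (0 : ℝ) := by
      rw [gradient, InnerProductSpace.toDual_symm_apply, h.fderiv_dir]
    have h9 : gradient g x i = 0 := by
      rw [← h6' i]
      rcases he with rfl | rfl
      · exact h8
      · rwa [inner_neg_right, neg_eq_zero] at h8
    rw [conormal, norm_sub_sq_real, h.norm_dir, real_inner_comm, h8, EuclideanSpace.real_norm_sq_eq,
      Fin.sum_univ_succAbove _ i, h9]
    simp [h6, ha, sq]
  rw [h5]
  simpa [dotProduct] using h1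

theorem comap_graphMap (h : IsGraphChart Ω e g U)
    (he : e = EuclideanSpace.single i (1 : ℝ) ∨ e = -EuclideanSpace.single i (1 : ℝ)) :
    Measure.comap (graphMap e g i) (μHE[n] : Measure (Eu (n + 1))) =
      (volume : Measure (Eu n)).withDensity
        fun y => ENNReal.ofReal ‖conormal e g (hyperplaneMap i y)‖ := by
  have h1 := comap_euclideanHausdorffMeasure (h.contDiff_graphMap (i := i)) h.graphMap_injective
    (h.fderiv_graphMap_injective he)
  rw [finrank_euclideanSpace_fin] at h1
  rw [h1]
  simp only [h.normDet_graphMap he]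

theorem measurableEmbedding_graphMap (h : IsGraphChart Ω e g U) :
    MeasurableEmbedding (graphMap e g i) :=
  h.contDiff_graphMap.continuous.measurableEmbedding h.graphMap_injective

theorem setIntegral_graph (h : IsGraphChart Ω e g U)
    (he : e = EuclideanSpace.single i (1 : ℝ) ∨ e = -EuclideanSpace.single i (1 : ℝ))
    (f : Eu (n + 1) → ℝ) :
    ∫ x in {x | inner ℝ x e = g x}, f x ∂μHE[n] =
      ∫ y : Eu n, ‖conormal e g (hyperplaneMap i y)‖ * f (graphMap e g i y) := by
  have hc : Continuous fun y : Eu n => ‖conormal e g (hyperplaneMap i y)‖ :=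
    (h.contDiff_conormal.continuous.comp (hyperplaneMap i).continuous).norm
  rw [← h.range_graphMap he, ← h.measurableEmbedding_graphMap.map_comap,
    h.measurableEmbedding_graphMap.integral_map, h.comap_graphMap he,
    integral_withDensity_eq_integral_toReal_smul hc.measurable.ennreal_ofReal
      (Eventually.of_forall fun _ => ENNReal.ofReal_lt_top)]
  simp

/-- The divergence theorem on the subgraph of `g`. -/
theorem integral_euDiv_subgraph_eq (h : IsGraphChart Ω e g U)
    {Y : Eu (n + 1) → Eu (n + 1)} (hY : ContDiff ℝ ∞ Y) (hc : HasCompactSupport Y) :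
    ∫ x in {x | inner ℝ x e < g x}, euDiv Y x = ∫ x in {x | inner ℝ x e = g x},
      inner ℝ (Y x) (‖conormal e g x‖⁻¹ • conormal e g x) ∂μHE[n] := by
  obtain ⟨i, he⟩ := h.axis
  rw [h.integral_euDiv_subgraph he hY hc, h.setIntegral_graph he]
  refine integral_congr_ae (Eventually.of_forall fun y => ?_)
  have h1 : conormal e g (graphMap e g i y) = conormal e g (hyperplaneMap i y) :=
    h.conormal_add_smul _ _
  have h2 : ‖conormal e g (hyperplaneMap i y)‖ ≠ 0 := norm_ne_zero_iff.2 (h.conormal_ne_zero _)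
  simp only [h1, real_inner_smul_right]
  field_simp

end Graph

end IsGraphChart

/-! ### The area measure and the divergence theorem -/

theorem setIntegral_congr_of_ne_zero {α : Type} [MeasurableSpace α] {μ : Measure α} {s t : Set α}
    {f : α → ℝ} (hs : MeasurableSet s) (ht : MeasurableSet t) (h : ∀ x, f x ≠ 0 → (x ∈ s ↔ x ∈ t)) :
    ∫ x in s, f x ∂μ = ∫ x in t, f x ∂μ := by
  rw [← integral_indicator hs, ← integral_indicator ht]
  congr 1
  funext x
  by_cases h0 : f x = 0
  · simp [Set.indicator, h0]
  · classical
    rw [Set.indicator_apply, Set.indicator_apply]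
    exact if_congr (h x h0) rfl rfl

namespace IsGraphChart

variable {n : ℕ} {Ω : Set (Eu (n + 1))} {e : Eu (n + 1)} {g : Eu (n + 1) → ℝ}
  {U : Set (Eu (n + 1))} {p : Eu (n + 1)}

theorem image_preimage_graphMap_inter (h : IsGraphChart Ω e g U) (hΩ : IsOpen Ω) {i : Fin (n + 1)}
    (he : e = EuclideanSpace.single i (1 : ℝ) ∨ e = -EuclideanSpace.single i (1 : ℝ))
    (V : Set (Eu (n + 1))) :
    graphMap e g i '' (graphMap e g i ⁻¹' (U ∩ V)) = frontier Ω ∩ (U ∩ V) := by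
  rw [Set.image_preimage_eq_inter_range, h.range_graphMap he]
  ext x
  simp only [Set.mem_inter_iff, Set.mem_ofPred_eq]
  constructor
  · rintro ⟨⟨hU, hV⟩, hx⟩
    exact ⟨(h.mem_frontier_iff hΩ hU).2 hx, hU, hV⟩
  · rintro ⟨hx, hU, hV⟩
    exact ⟨⟨hU, hV⟩, (h.mem_frontier_iff hΩ hU).1 hx⟩

theorem measure_frontier_pos (h : IsGraphChart Ω e g U) (hΩ : IsOpen Ω) (hp : p ∈ U)
    (hpf : p ∈ frontier Ω) {V : Set (Eu (n + 1))} (hV : IsOpen V) (hpV : p ∈ V) :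
    0 < (μHE[n] : Measure (Eu (n + 1))) (frontier Ω ∩ V) := by
  obtain ⟨i, he⟩ := h.axis
  refine lt_of_lt_of_le ?_
    (measure_mono (Set.inter_subset_inter_right (frontier Ω) (Set.inter_subset_right (s := U))))
  rw [← h.image_preimage_graphMap_inter hΩ he, ← h.measurableEmbedding_graphMap.comap_apply,
    h.comap_graphMap he]
  have hc : Continuous fun y : Eu n => ‖conormal e g (hyperplaneMap i y)‖ :=
    (h.contDiff_conormal.continuous.comp (hyperplaneMap i).continuous).norm
  have hac : (volume : Measure (Eu n)) ≪ (volume : Measure (Eu n)).withDensity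
      fun y => ENNReal.ofReal ‖conormal e g (hyperplaneMap i y)‖ :=
    withDensity_absolutelyContinuous' hc.measurable.ennreal_ofReal.aemeasurable
      (Eventually.of_forall fun y =>
        (ENNReal.ofReal_pos.2 (norm_pos_iff.2 (h.conormal_ne_zero _))).ne')
  refine pos_iff_ne_zero.2 fun h0 => ?_
  have ho : IsOpen (graphMap e g i ⁻¹' (U ∩ V)) :=
    (h.isOpen.inter hV).preimage h.contDiff_graphMap.continuous
  refine (ho.measure_pos volume ?_).ne' (hac h0)
  have h1 : p ∈ graphMap e g i '' (graphMap e g i ⁻¹' (U ∩ V)) := by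
    rw [h.image_preimage_graphMap_inter hΩ he]; exact ⟨hpf, hp, hpV⟩
  obtain ⟨y, hy, _⟩ := h1
  exact ⟨y, hy⟩

theorem measure_frontier_lt_top (h : IsGraphChart Ω e g U) (hΩ : IsOpen Ω) :
    (μHE[n] : Measure (Eu (n + 1))) (frontier Ω ∩ (U ∩ Metric.ball p 1)) < ⊤ := by
  obtain ⟨i, he⟩ := h.axis
  rw [← h.image_preimage_graphMap_inter hΩ he, ← h.measurableEmbedding_graphMap.comap_apply,
    h.comap_graphMap he]
  have hc : Continuous fun y : Eu n => ‖conormal e g (hyperplaneMap i y)‖ :=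
    (h.contDiff_conormal.continuous.comp (hyperplaneMap i).continuous).norm
  have := IsLocallyFiniteMeasure.withDensity_ofReal (μ := (volume : Measure (Eu n))) hc
  set P : Eu (n + 1) → Eu n := fun x => WithLp.toLp 2 fun j => x (i.succAbove j) with hP
  have hPc : Continuous P := by fun_prop
  have hPG : ∀ y, P (graphMap e g i y) = y := by
    intro y
    ext j
    rcases he with rfl | rfl <;> simp [hP, graphMap, Fin.succAbove_ne]
  refine lt_of_le_of_lt (measure_mono ?_)
    ((isCompact_closedBall p 1).image hPc).measure_lt_top
  intro y hy
  exact ⟨graphMap e g i y, Metric.ball_subset_closedBall hy.2, hPG y⟩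

end IsGraphChart

theorem integrable_of_continuous_compactSpace {X : Type} [TopologicalSpace X] [CompactSpace X]
    [MeasurableSpace X] [OpensMeasurableSpace X] {μ : Measure X} [IsFiniteMeasure μ] {f : X → ℝ}
    (hf : Continuous f) : Integrable f μ :=
  hf.integrable_of_hasCompactSupport (HasCompactSupport.of_compactSpace f)

namespace IsSmoothBoundedDomain

variable {m : ℕ} {Ω : Set (Eu m)}

theorem frontier_eq_empty {Ω : Set (Eu 0)} (hΩ : IsSmoothBoundedDomain Ω) : frontier Ω = ∅ := by
  rw [(hΩ.isConnected.nonempty.eq_univ : Ω = Set.univ), frontier_univ]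

theorem compactSpace_closure (hΩ : IsSmoothBoundedDomain Ω) : CompactSpace (closure Ω) :=
  isCompact_iff_compactSpace.1 hΩ.isCompact_closure

theorem compactSpace_frontier (hΩ : IsSmoothBoundedDomain Ω) : CompactSpace (frontier Ω) :=
  isCompact_iff_compactSpace.1 hΩ.isCompact_frontier

theorem measure_frontier_lt_top (hΩ : IsSmoothBoundedDomain Ω) :
    (μHE[m - 1] : Measure (Eu m)) (frontier Ω) < ⊤ := by
  rcases m with _ | n
  · simp
  refine hΩ.isCompact_frontier.measure_lt_top_of_nhdsWithin fun p hp => ?_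
  obtain ⟨e, g, U, h, hpU⟩ := hΩ.smoothBoundary.exists_isGraphChart hp
  refine ⟨frontier Ω ∩ (U ∩ Metric.ball p 1), ?_, h.measure_frontier_lt_top hΩ.isOpen⟩
  exact inter_mem self_mem_nhdsWithin (nhdsWithin_le_nhds
    (inter_mem (h.isOpen.mem_nhds hpU) (Metric.ball_mem_nhds p one_pos)))

theorem isFiniteMeasure_areaMeasure (hΩ : IsSmoothBoundedDomain Ω) :
    IsFiniteMeasure (areaMeasure Ω) := by
  refine ⟨?_⟩
  rw [areaMeasure, comap_subtype_coe_apply isClosed_frontier.measurableSet, Set.image_univ,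
    Subtype.range_coe]
  exact hΩ.measure_frontier_lt_top

theorem isFiniteMeasure_bodyMeasure (hΩ : IsSmoothBoundedDomain Ω) :
    IsFiniteMeasure (bodyMeasure Ω) := by
  refine ⟨?_⟩
  rw [bodyMeasure, comap_subtype_coe_apply isClosed_closure.measurableSet, Set.image_univ,
    Subtype.range_coe]
  exact hΩ.isCompact_closure.measure_lt_top

theorem isOpenPosMeasure_areaMeasure (hΩ : IsSmoothBoundedDomain Ω) :
    (areaMeasure Ω).IsOpenPosMeasure := by
  refine ⟨fun V hV hne => ?_⟩
  obtain ⟨W, hW, rfl⟩ := isOpen_induced_iff.1 hV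
  obtain ⟨⟨p, hp⟩, hpW⟩ := hne
  rcases m with _ | n
  · rw [hΩ.frontier_eq_empty] at hp
    exact absurd hp (Set.notMem_empty p)
  obtain ⟨e, g, U, h, hpU⟩ := hΩ.smoothBoundary.exists_isGraphChart hp
  rw [areaMeasure, comap_subtype_coe_apply isClosed_frontier.measurableSet,
    Subtype.image_preimage_coe]
  exact (h.measure_frontier_pos hΩ.isOpen hpU hp hW hpW).ne'

/-- The boundary is a null set, since its `(m-1)`-dimensional measure is finite. -/
theorem volume_frontier (hΩ : IsSmoothBoundedDomain Ω) : volume (frontier Ω) = 0 := by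
  rcases m with _ | n
  · simp
  rcases Measure.euclideanHausdorffMeasure_zero_or_top (Nat.lt_succ_self n) (frontier Ω) with h | h
  · rwa [← EuclideanSpace.euclideanHausdorffMeasure_eq_volume]
  · exact absurd h hΩ.measure_frontier_lt_top.ne

theorem integral_bodyMeasure (hΩ : IsSmoothBoundedDomain Ω) (f : Eu m → ℝ) :
    ∫ x : closure Ω, f x ∂(bodyMeasure Ω) = ∫ x in Ω, f x := by
  rw [bodyMeasure, integral_subtype_comap isClosed_closure.measurableSet]
  refine setIntegral_congr_set ?_
  filter_upwards [measure_eq_zero_iff_ae_notMem.1 hΩ.volume_frontier] with x hx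
  refine propext ⟨fun h => ?_, fun h => subset_closure h⟩
  by_contra hxΩ
  exact hx (by rw [hΩ.isOpen.frontier_eq]; exact ⟨h, hxΩ⟩)

theorem integral_areaMeasure (f : Eu m → ℝ) :
    ∫ x : frontier Ω, f x ∂(areaMeasure Ω) = ∫ x in frontier Ω, f x ∂μHE[m - 1] :=
  integral_subtype_comap isClosed_frontier.measurableSet f

/-- The divergence theorem for vector fields supported in a graph chart. -/
theorem divergence_of_tsupport_subset (hΩ : IsSmoothBoundedDomain Ω) {e : Eu m} {g : Eu m → ℝ}
    {U : Set (Eu m)} (h : IsGraphChart Ω e g U) {Y : Eu m → Eu m} (hY : ContDiff ℝ ∞ Y)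
    (hc : HasCompactSupport Y) (hU : tsupport Y ⊆ U) :
    ∫ x in Ω, euDiv Y x = ∫ x in frontier Ω, inner ℝ (Y x) (outwardNormal Ω x) ∂μHE[m - 1] := by
  rcases m with _ | n
  · obtain ⟨i, _⟩ := h.axis
    exact i.elim0
  have hdivU : ∀ x, euDiv Y x ≠ 0 → x ∈ U := by
    intro x hx
    by_contra hxU
    refine hx (Finset.sum_eq_zero fun l _ => ?_)
    rw [fderiv_eq_zero_of_notMem_tsupport fun hx' => ?_]
    · rfl
    · exact hxU (hU (closure_mono (Function.support_comp_subset (g := fun v : Eu (n + 1) => v l)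
        rfl Y) hx'))
  have hYU : ∀ x, Y x ≠ 0 → x ∈ U := fun x hx => hU (subset_tsupport _ hx)
  have hge : Continuous g := h.smooth.continuous
  have h1 : ∫ x in Ω, euDiv Y x = ∫ x in {x | inner ℝ x e < g x}, euDiv Y x :=
    setIntegral_congr_of_ne_zero hΩ.isOpen.measurableSet
      (isOpen_lt (by fun_prop) hge).measurableSet fun x hx => h.mem_iff x (hdivU x hx)
  have h2 : ∫ x in frontier Ω, inner ℝ (Y x) (outwardNormal Ω x) ∂μHE[n] =
      ∫ x in frontier Ω, inner ℝ (Y x) (‖conormal e g x‖⁻¹ • conormal e g x) ∂μHE[n] := by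
    refine setIntegral_congr_fun isClosed_frontier.measurableSet fun x hx => ?_
    by_cases hx0 : Y x = 0
    · simp [hx0]
    · rw [h.outwardNormal_eq hΩ.isOpen (hYU x hx0) hx]
  rw [h1, h.integral_euDiv_subgraph_eq hY hc]
  refine Eq.trans ?_ h2.symm
  refine setIntegral_congr_of_ne_zero (isClosed_eq (by fun_prop) hge).measurableSet
    isClosed_frontier.measurableSet fun x hx => ?_
  refine (h.mem_frontier_iff hΩ.isOpen (hYU x fun h0 => hx ?_)).symm
  rw [h0, inner_zero_left]

theorem continuous_euDiv {X : Eu m → Eu m} (hX : ContDiff ℝ ∞ X) : Continuous (euDiv X) :=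
  continuous_finsetSum _ fun l _ =>
    (contDiff_infty_iff_fderiv.1 (contDiff_component hX l)).2.continuous.clm_apply continuous_const

theorem continuous_outwardNormal (hΩ : IsSmoothBoundedDomain Ω) :
    Continuous fun x : frontier Ω => outwardNormal Ω x := by
  obtain ⟨N, hN, h⟩ := hΩ.exists_smooth_normal
  exact (hN.continuous.comp continuous_subtype_val).congr fun x => h x x.2

/-- The divergence theorem. -/
theorem divergence_theorem (hΩ : IsSmoothBoundedDomain Ω) {X : Eu m → Eu m}
    (hX : ContDiff ℝ ∞ X) : ∫ x : closure Ω, euDiv X x ∂(bodyMeasure Ω) =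
      ∫ x : frontier Ω, inner ℝ (X x) (outwardNormal Ω x) ∂(areaMeasure Ω) := by
  classical
  have := hΩ.compactSpace_closure
  have := hΩ.compactSpace_frontier
  have := hΩ.isFiniteMeasure_areaMeasure
  have := hΩ.isFiniteMeasure_bodyMeasure
  have hloc : ∀ q : Eu m, ∃ V, q ∈ closure Ω → (IsOpen V ∧ q ∈ V ∧ ∀ Y : Eu m → Eu m,
      ContDiff ℝ ∞ Y → HasCompactSupport Y → tsupport Y ⊆ V →
      ∫ x in Ω, euDiv Y x =
        ∫ x in frontier Ω, inner ℝ (Y x) (outwardNormal Ω x) ∂μHE[m - 1]) := by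
    intro q
    by_cases hqΩ : q ∈ Ω
    · refine ⟨Ω, fun _ => ⟨hΩ.isOpen, hqΩ, fun Y hY hc hV => ?_⟩⟩
      rw [setIntegral_eq_integral_of_forall_compl_eq_zero fun x hx => ?_,
        integral_euDiv_eq_zero hY hc]
      · refine (setIntegral_eq_zero_of_forall_eq_zero fun x hx => ?_).symm
        rw [hΩ.isOpen.frontier_eq] at hx
        have h0 : Y x = 0 := image_eq_zero_of_notMem_tsupport fun hx' => hx.2 (hV hx')
        rw [h0, inner_zero_left]
      · refine Finset.sum_eq_zero fun l _ => ?_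
        rw [fderiv_eq_zero_of_notMem_tsupport fun hx' => ?_]
        · rfl
        · exact hx (hV (closure_mono (Function.support_comp_subset (g := fun v : Eu m => v l)
            rfl Y) hx'))
    · by_cases hq : q ∈ frontier Ω
      · obtain ⟨e, g, U, h, hqU⟩ := hΩ.smoothBoundary.exists_isGraphChart hq
        exact ⟨U, fun _ => ⟨h.isOpen, hqU, fun Y hY hc hV =>
          hΩ.divergence_of_tsupport_subset h hY hc hV⟩⟩
      · refine ⟨∅, fun hqc => absurd ?_ hq⟩
        rw [hΩ.isOpen.frontier_eq]
        exact ⟨hqc, hqΩ⟩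
  choose V hV using hloc
  obtain ⟨s, ρ, hρ, hsum⟩ := exists_finite_partition hΩ.isCompact_closure (U := V)
    fun x hx => ⟨(hV x hx).1, (hV x hx).2.1⟩
  have hYs : ∀ q ∈ s, ContDiff ℝ ∞ (fun x => ρ q x • X x) := fun q hq => (hρ q hq).2.1.smul hX
  have hpiece : ∀ q ∈ s, ∫ x : closure Ω, euDiv (fun x => ρ q x • X x) x ∂(bodyMeasure Ω) =
      ∫ x : frontier Ω, inner ℝ (ρ q x • X x) (outwardNormal Ω x) ∂(areaMeasure Ω) := by
    intro q hq
    rw [hΩ.integral_bodyMeasure, integral_areaMeasure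
      (fun x => inner ℝ (ρ q x • X x) (outwardNormal Ω x))]
    refine (hV q (hρ q hq).1).2.2 _ (hYs q hq) ((hρ q hq).2.2.1.smul_right) ?_
    exact (tsupport_smul_subset_left _ _).trans (hρ q hq).2.2.2
  have hdiv : ∫ x : closure Ω, euDiv X x ∂(bodyMeasure Ω) =
      ∫ x : closure Ω, ∑ q ∈ s, euDiv (fun x => ρ q x • X x) x ∂(bodyMeasure Ω) := by
    rw [hΩ.integral_bodyMeasure, hΩ.integral_bodyMeasure
      (fun x => ∑ q ∈ s, euDiv (fun x => ρ q x • X x) x)]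
    refine setIntegral_congr_fun hΩ.isOpen.measurableSet fun x hx => ?_
    simp only [euDiv]
    rw [Finset.sum_comm]
    refine Finset.sum_congr rfl fun l _ => ?_
    have h1 : (fun y => X y l) =ᶠ[𝓝 x] fun y => ∑ q ∈ s, (ρ q y • X y) l := by
      filter_upwards [hΩ.isOpen.mem_nhds hx] with y hy
      simp [← Finset.sum_mul, hsum y (subset_closure hy)]
    rw [h1.fderiv_eq, fderiv_fun_sum fun q hq =>
      (contDiff_infty_iff_fderiv.1 (contDiff_component (hYs q hq) l)).1 x]
    simp
  have hint : ∀ q ∈ s, Integrable (fun x : closure Ω => euDiv (fun x => ρ q x • X x) x)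
      (bodyMeasure Ω) := fun q hq => integrable_of_continuous_compactSpace
    ((continuous_euDiv (hYs q hq)).comp continuous_subtype_val)
  have hint' : ∀ q ∈ s, Integrable (fun x : frontier Ω => inner ℝ (ρ q x • X x)
      (outwardNormal Ω x)) (areaMeasure Ω) := fun q hq => integrable_of_continuous_compactSpace
    (((hYs q hq).continuous.comp continuous_subtype_val).inner hΩ.continuous_outwardNormal)
  rw [hdiv, integral_finsetSum _ hint, Finset.sum_congr rfl hpiece, ← integral_finsetSum _ hint']
  refine integral_congr_ae (Eventually.of_forall fun x => ?_)
  simp only [← sum_inner, ← Finset.sum_smul, hsum x (frontier_subset_closure x.2), one_smul]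

end IsSmoothBoundedDomain

/-! ### The pairing of `V⋆` with `V` -/

namespace CInf

variable {m : ℕ} {K : Set (Eu m)}

theorem continuous_integral [CompactSpace K] (μ : Measure K) [IsFiniteMeasure μ] :
    Continuous fun φ : CInf K => ∫ x, φ x ∂μ := by
  have h1 : Continuous fun φ : CInf K => (⟨φ.1, continuous_coe φ⟩ : C(K, ℝ)) :=
    ContinuousMap.continuous_of_continuous_uncurry _ continuous_eval
  have h2 := MeasureTheory.continuous_integral.comp
    ((ContinuousMap.toLp (E := ℝ) 1 μ ℝ).continuous.comp h1)
  refine h2.congr fun φ => ?_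
  exact integral_congr_ae (ContinuousMap.coeFn_toLp μ _)

/-- The pointwise product. -/
noncomputable def mul (φ ψ : CInf K) : CInf K :=
  nem (fun u : Fin 2 → ℝ => u 0 * u 1) (by fun_prop) ![φ, ψ]

@[simp] theorem mul_apply (φ ψ : CInf K) (x : K) : mul φ ψ x = φ x * ψ x := rfl

theorem continuous_mul : Continuous fun p : CInf K × CInf K => mul p.1 p.2 := by
  refine (continuous_nem _ _).comp (continuous_pi fun j => ?_)
  fin_cases j
  · exact continuous_fst
  · exact continuous_snd

theorem sum_apply {ι : Type} (s : Finset ι) (φ : ι → CInf K) (x : K) :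
    (∑ i ∈ s, φ i) x = ∑ i ∈ s, φ i x := by
  classical
  induction s using Finset.induction_on with
  | empty => rfl
  | insert a s ha ih => rw [Finset.sum_insert ha, Finset.sum_insert ha, add_apply, ih]

/-- The restriction `C^∞(𝓑) → C^∞(∂𝓑)`. -/
noncomputable def bdry (Ω : Set (Eu m)) : CInf (closure Ω) →L[ℝ] CInf (frontier Ω) where
  toFun φ := ⟨fun x => φ (bdryIncl x), φ.2.imp fun _ h => ⟨h.1, fun x => h.2 (bdryIncl x)⟩⟩
  map_add' _ _ := rfl
  map_smul' _ _ := rfl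
  cont := by
    refine isOpenQuotientMap_res.isQuotientMap.continuous_iff.2 ?_
    exact (isOpenQuotientMap_res (K := frontier Ω)).continuous

@[simp] theorem bdry_apply {Ω : Set (Eu m)} (φ : CInf (closure Ω)) (x : frontier Ω) :
    bdry Ω φ x = φ (bdryIncl x) := rfl

end CInf

namespace IsSmoothBoundedDomain

variable {m : ℕ} {Ω : Set (Eu m)}

theorem integrable_body (hΩ : IsSmoothBoundedDomain Ω) (φ : CInf (closure Ω)) :
    Integrable φ.1 (bodyMeasure Ω) := by
  have := hΩ.compactSpace_closure
  have := hΩ.isFiniteMeasure_bodyMeasure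
  exact integrable_of_continuous_compactSpace φ.continuous_coe

theorem integrable_area (hΩ : IsSmoothBoundedDomain Ω) (φ : CInf (frontier Ω)) :
    Integrable φ.1 (areaMeasure Ω) := by
  have := hΩ.compactSpace_frontier
  have := hΩ.isFiniteMeasure_areaMeasure
  exact integrable_of_continuous_compactSpace φ.continuous_coe

/-- The integral over the body, as a continuous linear functional. -/
noncomputable def integralBody (hΩ : IsSmoothBoundedDomain Ω) : CInf (closure Ω) →L[ℝ] ℝ where
  toFun φ := ∫ x, φ x ∂(bodyMeasure Ω)
  map_add' φ ψ := integral_add (hΩ.integrable_body φ) (hΩ.integrable_body ψ)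
  map_smul' c φ := integral_const_mul c φ.1
  cont := by
    have := hΩ.compactSpace_closure
    have := hΩ.isFiniteMeasure_bodyMeasure
    exact CInf.continuous_integral _

/-- The integral over the boundary, as a continuous linear functional. -/
noncomputable def integralArea (hΩ : IsSmoothBoundedDomain Ω) : CInf (frontier Ω) →L[ℝ] ℝ where
  toFun φ := ∫ x, φ x ∂(areaMeasure Ω)
  map_add' φ ψ := integral_add (hΩ.integrable_area φ) (hΩ.integrable_area ψ)
  map_smul' c φ := integral_const_mul c φ.1
  cont := by
    have := hΩ.compactSpace_frontier
    have := hΩ.isFiniteMeasure_areaMeasure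
    exact CInf.continuous_integral _

theorem pairing_eq (hΩ : IsSmoothBoundedDomain Ω) (a : RDual Ω) (φ : ConfSpace Ω) :
    pairing a φ = hΩ.integralBody (CInf.mul a.1 φ) +
      hΩ.integralArea (CInf.mul a.2 (CInf.bdry Ω φ)) := rfl

theorem continuous_pairing (hΩ : IsSmoothBoundedDomain Ω) :
    Continuous fun p : RDual Ω × ConfSpace Ω => pairing p.1 p.2 := by
  simp only [hΩ.pairing_eq]
  refine (hΩ.integralBody.continuous.comp (CInf.continuous_mul.comp
    (continuous_fst.fst.prodMk continuous_snd))).add ?_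
  exact hΩ.integralArea.continuous.comp (CInf.continuous_mul.comp
    (continuous_fst.snd.prodMk ((CInf.bdry Ω).continuous.comp continuous_snd)))

/-- The pairing as a bilinear form. -/
noncomputable def pairingForm (hΩ : IsSmoothBoundedDomain Ω) :
    RDual Ω →ₗ[ℝ] ConfSpace Ω →ₗ[ℝ] ℝ :=
  LinearMap.mk₂ ℝ pairing
    (fun a b φ => by
      simp only [hΩ.pairing_eq]
      rw [show CInf.mul (a + b).1 φ = CInf.mul a.1 φ + CInf.mul b.1 φ from
          CInf.ext fun x => add_mul _ _ _,
        show CInf.mul (a + b).2 (CInf.bdry Ω φ) =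
          CInf.mul a.2 (CInf.bdry Ω φ) + CInf.mul b.2 (CInf.bdry Ω φ) from
          CInf.ext fun x => add_mul _ _ _, map_add, map_add]
      ring)
    (fun c a φ => by
      simp only [hΩ.pairing_eq]
      rw [show CInf.mul (c • a).1 φ = c • CInf.mul a.1 φ from
          CInf.ext fun x => mul_assoc _ _ _,
        show CInf.mul (c • a).2 (CInf.bdry Ω φ) = c • CInf.mul a.2 (CInf.bdry Ω φ) from
          CInf.ext fun x => mul_assoc _ _ _, map_smul, map_smul, smul_add])
    (fun a φ ψ => by
      simp only [hΩ.pairing_eq, map_add]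
      rw [show CInf.mul a.1 (φ + ψ) = CInf.mul a.1 φ + CInf.mul a.1 ψ from
          CInf.ext fun x => mul_add _ _ _,
        show CInf.mul a.2 (CInf.bdry Ω φ + CInf.bdry Ω ψ) =
          CInf.mul a.2 (CInf.bdry Ω φ) + CInf.mul a.2 (CInf.bdry Ω ψ) from
          CInf.ext fun x => mul_add _ _ _, map_add, map_add]
      ring)
    (fun c a φ => by
      simp only [hΩ.pairing_eq, map_smul]
      rw [show CInf.mul a.1 (c • φ) = c • CInf.mul a.1 φ from
          CInf.ext fun x => mul_left_comm _ _ _,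
        show CInf.mul a.2 (c • CInf.bdry Ω φ) = c • CInf.mul a.2 (CInf.bdry Ω φ) from
          CInf.ext fun x => mul_left_comm _ _ _, map_smul, map_smul, smul_add])

@[simp] theorem pairingForm_apply (hΩ : IsSmoothBoundedDomain Ω) (a : RDual Ω)
    (φ : ConfSpace Ω) : hΩ.pairingForm a φ = pairing a φ := rfl

/-- A function of `C^∞(𝓑)` is determined by its values in the interior. -/
theorem eq_zero_of_forall_mem {f : closure Ω → ℝ} (hf : Continuous f)
    (h : ∀ x : closure Ω, (x : Eu m) ∈ Ω → f x = 0) (x : closure Ω) : f x = 0 := by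
  have hd : Dense {x : closure Ω | (x : Eu m) ∈ Ω} := by
    intro y
    rw [closure_subtype]
    convert y.2 using 2
    ext z
    simp only [Set.mem_image, Set.mem_ofPred_eq]
    exact ⟨by rintro ⟨w, hw, rfl⟩; exact hw, fun hz => ⟨⟨z, subset_closure hz⟩, hz, rfl⟩⟩
  exact congrFun (Continuous.ext_on hd hf continuous_const fun y hy => h y hy) x

theorem body_eq_zero_of_pairing (hΩ : IsSmoothBoundedDomain Ω) {a : RDual Ω}
    (h : ∀ φ : ConfSpace Ω, pairing a φ = 0) : a.1 = 0 := by
  obtain ⟨A, hA, hAa⟩ := a.1.2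
  have hae := hΩ.isOpen.ae_eq_zero_of_integral_contDiff_smul_eq_zero (μ := volume) (f := A)
    (hA.continuous.locallyIntegrable.locallyIntegrableOn _) fun g hg _ hgs => by
      have h1 := h (CInf.res _ ⟨g, hg⟩)
      have h0 : ∀ x, x ∉ Ω → g x = 0 := fun x hx =>
        image_eq_zero_of_notMem_tsupport fun hx' => hx (hgs hx')
      have h2 : ∫ x : frontier Ω, a.2 x * CInf.res (closure Ω) ⟨g, hg⟩ (bdryIncl x)
          ∂(areaMeasure Ω) = 0 := by
        refine integral_eq_zero_of_ae (Eventually.of_forall fun x => ?_)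
        have hx : (x : Eu m) ∉ Ω := (hΩ.isOpen.frontier_eq ▸ x.2 : (x : Eu m) ∈ closure Ω \ Ω).2
        exact mul_eq_zero_of_right _ (h0 x hx)
      rw [pairing, h2, add_zero] at h1
      rw [← h1, ← setIntegral_eq_integral_of_forall_compl_eq_zero (s := Ω)
        fun x hx => by rw [h0 x hx, zero_smul], ← hΩ.integral_bodyMeasure fun x => g x • A x]
      refine integral_congr_ae (Eventually.of_forall fun x => ?_)
      simp only [hAa x, smul_eq_mul]
      exact mul_comm _ _
  have hz : Set.EqOn A 0 Ω := Measure.eqOn_open_of_ae_eq (μ := volume)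
    ((ae_restrict_iff' hΩ.isOpen.measurableSet).2 hae) hΩ.isOpen hA.continuous.continuousOn
    continuousOn_const
  refine CInf.ext (eq_zero_of_forall_mem a.1.continuous_coe fun x hx => ?_)
  rw [← hAa x, hz hx]
  rfl

/-- The pairing is nondegenerate in `V⋆`. -/
theorem eq_zero_of_pairing (hΩ : IsSmoothBoundedDomain Ω) {a : RDual Ω}
    (h : ∀ φ : ConfSpace Ω, pairing a φ = 0) : a = 0 := by
  have h1 := hΩ.body_eq_zero_of_pairing h
  refine Prod.ext h1 ?_
  obtain ⟨A, hA, hAa⟩ := a.2.2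
  have h2 := h (CInf.res _ ⟨A, hA⟩)
  rw [pairing, h1] at h2
  have h3 : ∫ x : frontier Ω, a.2 x * a.2 x ∂(areaMeasure Ω) = 0 := by
    simp only [CInf.zero_apply, zero_mul, integral_zero, zero_add] at h2
    rw [← h2]
    refine integral_congr_ae (Eventually.of_forall fun x => ?_)
    exact congrArg (a.2 x * ·) (hAa x).symm
  have := hΩ.isOpenPosMeasure_areaMeasure
  have h4 := (integral_eq_zero_iff_of_nonneg (fun x => mul_self_nonneg (a.2 x))
    (hΩ.integrable_area (CInf.mul a.2 a.2))).1 h3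
  have h5 := Continuous.ae_eq_iff_eq (areaMeasure Ω)
    (a.2.continuous_coe.mul a.2.continuous_coe) continuous_const |>.1 h4
  exact CInf.ext fun x => mul_self_eq_zero.1 (congrFun h5 x)

/-- The pairing is nondegenerate in `V`. -/
theorem eq_zero_of_pairing_right (hΩ : IsSmoothBoundedDomain Ω) {ψ : ConfSpace Ω}
    (h : ∀ a : RDual Ω, pairing a ψ = 0) : ψ = 0 :=
  hΩ.body_eq_zero_of_pairing (a := (ψ, 0)) fun φ => by
    rw [← h (φ, 0)]
    simp [pairing, mul_comm]

end IsSmoothBoundedDomain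

/-! ### Functional derivatives of the Lagrangian -/

/-- The density `𝔏` as a function of the vector of its real arguments `(φ, ν, ∂₁φ, …, ∂ₘφ)`. -/
def jetDensity {m : ℕ} (𝔏 : ℝ → ℝ → Eu m → ℝ) (u : Fin 2 ⊕ Fin m → ℝ) : ℝ :=
  𝔏 (u (.inl 0)) (u (.inl 1)) (WithLp.toLp 2 fun i => u (.inr i))

theorem contDiff_jetDensity {m : ℕ} {𝔏 : ℝ → ℝ → Eu m → ℝ}
    (h𝔏 : ContDiff ℝ ∞ (fun q : ℝ × ℝ × Eu m => 𝔏 q.1 q.2.1 q.2.2)) :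
    ContDiff ℝ ∞ (jetDensity 𝔏) := by
  have h : ContDiff ℝ ∞ fun u : Fin 2 ⊕ Fin m → ℝ => (WithLp.toLp 2 fun i => u (.inr i) : Eu m) :=
    (PiLp.contDiff_toLp).comp (by fun_prop)
  have h2 : ContDiff ℝ ∞ fun u : Fin 2 ⊕ Fin m → ℝ =>
      (u (.inl 0), u (.inl 1), (WithLp.toLp 2 fun i => u (.inr i) : Eu m)) :=
    ContDiff.prodMk (by fun_prop) (ContDiff.prodMk (by fun_prop) h)
  exact h𝔏.comp h2

theorem contDiff_fderiv_single {ι : Type} [Fintype ι] [DecidableEq ι] {g : (ι → ℝ) → ℝ}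
    (hg : ContDiff ℝ ∞ g) (j : ι) : ContDiff ℝ ∞ fun u => fderiv ℝ g u (Pi.single j 1) :=
  (contDiff_infty_iff_fderiv.1 hg).2.clm_apply contDiff_const

theorem fderiv_apply_eq_sum {ι : Type} [Fintype ι] [DecidableEq ι] (g : (ι → ℝ) → ℝ)
    (u w : ι → ℝ) : fderiv ℝ g u w = ∑ j, fderiv ℝ g u (Pi.single j 1) * w j := by
  conv_lhs => rw [pi_eq_sum_univ' w, map_sum]
  refine Finset.sum_congr rfl fun j _ => ?_
  rw [map_smul, smul_eq_mul, mul_comm]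

/-- A derivative along a curve parametrized by all of `ℝ` is an ordinary derivative. -/
theorem HasTimeDeriv.hasDerivAt {f : ℝ → ℝ} {v t : ℝ} (h : HasTimeDeriv Set.univ f v t) :
    HasDerivAt f v t :=
  hasDerivWithinAt_univ.1 (hasDerivWithinAt_iff_tendsto_slope.2 h)

theorem HasTimeDeriv.add_smul_const {X : Type} [AddCommGroup X] [Module ℝ X] [TopologicalSpace X]
    [ContinuousSMul ℝ X] (x y : X) (ε : ℝ) :
    HasTimeDeriv Set.univ (fun s : ℝ => x + s • y) y ε := by
  have h : ∀ s ∈ Set.univ \ {ε}, y = slope (fun s : ℝ => x + s • y) ε s := by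
    intro s hs
    have h0 : s - ε ≠ 0 := sub_ne_zero.2 hs.2
    simp [slope_def_module, ← sub_smul, smul_smul, inv_mul_cancel₀ h0]
  exact tendsto_const_nhds.congr' (eventually_of_mem self_mem_nhdsWithin h)

namespace IsSmoothBoundedDomain

variable {m : ℕ} {Ω : Set (Eu m)} {𝔏 : ℝ → ℝ → Eu m → ℝ}

/-- The components of the outward unit normal, as elements of `C^∞(∂𝓑)`. -/
noncomputable def normalComp (hΩ : IsSmoothBoundedDomain Ω) (i : Fin m) : CInf (frontier Ω) :=
  ⟨fun x => outwardNormal Ω x i, by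
    obtain ⟨N, hN, h⟩ := hΩ.exists_smooth_normal
    exact ⟨fun x => N x i, contDiff_component hN i, fun x => by simp only [h x x.2]⟩⟩

theorem normalComp_apply (hΩ : IsSmoothBoundedDomain Ω) (i : Fin m) (x : frontier Ω) :
    hΩ.normalComp i x = outwardNormal Ω x i := rfl

/-- The normal component on `∂𝓑` of the vector field with components `p i`. -/
noncomputable def normalTrace (hΩ : IsSmoothBoundedDomain Ω) (p : Fin m → CInf (closure Ω)) :
    CInf (frontier Ω) :=
  ∑ i, CInf.mul (CInf.bdry Ω (p i)) (hΩ.normalComp i)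

/-- Integration by parts: `∫ p·∇ψ dx = ⟨(-div p, p·n), ψ⟩`. -/
theorem integral_sum_mul_partialDeriv (hΩ : IsSmoothBoundedDomain Ω)
    (p : Fin m → CInf (closure Ω)) (ψ : CInf (closure Ω)) :
    hΩ.integralBody (∑ i, CInf.mul (p i) (hΩ.partialDeriv i ψ)) =
      pairing (-∑ i, hΩ.partialDeriv i (p i), hΩ.normalTrace p) ψ := by
  choose P hP hPp using fun i => (p i).2
  obtain ⟨Ψ, hΨ, hΨψ⟩ := ψ.2
  have hX : ContDiff ℝ ∞ fun x => (WithLp.toLp 2 fun i => P i x * Ψ x : Eu m) :=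
    PiLp.contDiff_toLp.comp (contDiff_pi.2 fun i => (hP i).mul hΨ)
  have hdP := fun i => (contDiff_infty_iff_fderiv.1 (hP i)).1
  have hdΨ := (contDiff_infty_iff_fderiv.1 hΨ).1
  have h := hΩ.divergence_theorem hX
  have h1 : ∫ x : closure Ω, euDiv (fun x => (WithLp.toLp 2 fun i => P i x * Ψ x : Eu m)) x
      ∂(bodyMeasure Ω) = hΩ.integralBody (∑ i, CInf.mul (p i) (hΩ.partialDeriv i ψ) +
        CInf.mul (∑ i, hΩ.partialDeriv i (p i)) ψ) := by
    refine integral_congr_ae (Eventually.of_forall fun x => ?_)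
    simp only [euDiv, CInf.add_apply, CInf.mul_apply, CInf.sum_apply, Finset.sum_mul,
      ← Finset.sum_add_distrib]
    refine Finset.sum_congr rfl fun i _ => ?_
    rw [hΩ.partialDeriv_apply, hΩ.partialDeriv_apply, hΩ.bodyDeriv_eq hdΨ hΨψ,
      hΩ.bodyDeriv_eq (hdP i) (hPp i), fderiv_fun_mul (hdP i _) (hdΨ _), ← hPp, ← hΨψ]
    simp [mul_comm]
  have h2 : ∫ x : frontier Ω, inner ℝ (WithLp.toLp 2 fun i => P i x * Ψ x : Eu m)
      (outwardNormal Ω x) ∂(areaMeasure Ω) =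
        hΩ.integralArea (CInf.mul (hΩ.normalTrace p) (CInf.bdry Ω ψ)) := by
    refine integral_congr_ae (Eventually.of_forall fun x => ?_)
    simp only [normalTrace, CInf.mul_apply, CInf.sum_apply, Finset.sum_mul, PiLp.inner_apply,
      CInf.bdry_apply, normalComp_apply]
    refine Finset.sum_congr rfl fun i _ => ?_
    rw [← hPp, ← hΨψ]
    simp [bdryIncl]
    ring
  rw [h1, h2, map_add] at h
  rw [hΩ.pairing_eq, ← h]
  rw [show CInf.mul (-∑ i, hΩ.partialDeriv i (p i)) ψ =
    -CInf.mul (∑ i, hΩ.partialDeriv i (p i)) ψ from CInf.ext fun x => neg_mul _ _, map_neg]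
  ring

/-- The functions `φ, ν, ∂₁φ, …, ∂ₘφ` on which the Lagrangian density depends. -/
noncomputable def jet (hΩ : IsSmoothBoundedDomain Ω) (φ ν : ConfSpace Ω) :
    Fin 2 ⊕ Fin m → ConfSpace Ω :=
  Sum.elim ![φ, ν] fun i => hΩ.partialDeriv i φ

theorem continuous_jet (hΩ : IsSmoothBoundedDomain Ω) :
    Continuous fun q : ConfSpace Ω × ConfSpace Ω => hΩ.jet q.1 q.2 := by
  refine continuous_pi ?_
  rintro (j | j)
  · fin_cases j
    · exact continuous_fst
    · exact continuous_snd
  · exact (hΩ.partialDeriv j).continuous.comp continuous_fst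

theorem hasTimeDeriv_jet (hΩ : IsSmoothBoundedDomain Ω) (φ ν δφ δν : ConfSpace Ω) (ε : ℝ)
    (j : Fin 2 ⊕ Fin m) :
    HasTimeDeriv Set.univ (fun s => hΩ.jet (φ + s • δφ) (ν + s • δν) j) (hΩ.jet δφ δν j) ε := by
  rcases j with j | j
  · fin_cases j
    · exact HasTimeDeriv.add_smul_const φ δφ ε
    · exact HasTimeDeriv.add_smul_const ν δν ε
  · exact (HasTimeDeriv.add_smul_const φ δφ ε).map (hΩ.partialDeriv j)

theorem continuous_lagrangian (hΩ : IsSmoothBoundedDomain Ω)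
    (h𝔏 : ContDiff ℝ ∞ (fun q : ℝ × ℝ × Eu m => 𝔏 q.1 q.2.1 q.2.2)) :
    Continuous fun q : ConfSpace Ω × ConfSpace Ω => lagrangian 𝔏 q.1 q.2 :=
  hΩ.integralBody.continuous.comp ((CInf.continuous_nem _ (contDiff_jetDensity h𝔏)).comp
    hΩ.continuous_jet)

theorem pairing_zero_right (hΩ : IsSmoothBoundedDomain Ω) (a : RDual Ω) : pairing a 0 = 0 :=
  map_zero (hΩ.pairingForm a)

/-- The partial derivatives of the density along `(φ, ν)`: the element `inl 0` is `∂𝔏/∂φ`,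
`inl 1` is `∂𝔏/∂ν`, and `inr i` is the `i`-th component of `∂𝔏/∂∇φ`. -/
noncomputable def densityPartial (hΩ : IsSmoothBoundedDomain Ω)
    (h𝔏 : ContDiff ℝ ∞ (fun q : ℝ × ℝ × Eu m => 𝔏 q.1 q.2.1 q.2.2)) (j : Fin 2 ⊕ Fin m)
    (φ ν : ConfSpace Ω) : ConfSpace Ω :=
  CInf.nem _ (contDiff_fderiv_single (contDiff_jetDensity h𝔏) j) (hΩ.jet φ ν)

section

variable (hΩ : IsSmoothBoundedDomain Ω)
  (h𝔏 : ContDiff ℝ ∞ (fun q : ℝ × ℝ × Eu m => 𝔏 q.1 q.2.1 q.2.2))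

theorem continuous_densityPartial (j : Fin 2 ⊕ Fin m) :
    Continuous fun q : ConfSpace Ω × ConfSpace Ω => hΩ.densityPartial h𝔏 j q.1 q.2 :=
  (CInf.continuous_nem _ _).comp hΩ.continuous_jet

theorem hasDerivAt_jetDensity_line (φ ν : ConfSpace Ω) (x : closure Ω) (j : Fin 2 ⊕ Fin m)
    {c : ℝ → Fin 2 ⊕ Fin m → ℝ} {t : ℝ} (hc : c t = fun j => hΩ.jet φ ν j x)
    (hd : HasDerivAt c (Pi.single j 1) t) :
    HasDerivAt (fun s => jetDensity 𝔏 (c s)) (hΩ.densityPartial h𝔏 j φ ν x) t := by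
  have h := (contDiff_infty_iff_fderiv.1 (contDiff_jetDensity h𝔏)).1 (c t)
  have h2 := h.hasFDerivAt.comp_hasDerivAt t hd
  rw [hc] at h2
  exact h2

theorem densityPhi_eq (φ ν : ConfSpace Ω) (x : closure Ω) :
    densityPhi 𝔏 φ ν x = hΩ.densityPartial h𝔏 (.inl 0) φ ν x := by
  refine HasDerivAt.deriv (hasDerivAt_jetDensity_line hΩ h𝔏 φ ν x (.inl 0)
    (c := fun a => Sum.elim ![a, ν x] fun i => grad φ x i) ?_ ?_)
  · funext j
    rcases j with j | j
    · fin_cases j <;> rfl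
    · rfl
  · refine hasDerivAt_pi.2 fun j => ?_
    rcases j with j | j
    · fin_cases j
      · simpa using hasDerivAt_id' _
      · simpa using hasDerivAt_const _ _
    · simpa using hasDerivAt_const _ _

theorem densityNu_eq (φ ν : ConfSpace Ω) (x : closure Ω) :
    densityNu 𝔏 φ ν x = hΩ.densityPartial h𝔏 (.inl 1) φ ν x := by
  refine HasDerivAt.deriv (hasDerivAt_jetDensity_line hΩ h𝔏 φ ν x (.inl 1)
    (c := fun a => Sum.elim ![φ x, a] fun i => grad φ x i) ?_ ?_)
  · funext j
    rcases j with j | j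
    · fin_cases j <;> rfl
    · rfl
  · refine hasDerivAt_pi.2 fun j => ?_
    rcases j with j | j
    · fin_cases j
      · simpa using hasDerivAt_const _ _
      · simpa using hasDerivAt_id' _
    · simpa using hasDerivAt_const _ _

theorem densityGrad_eq (φ ν : ConfSpace Ω) (x : closure Ω) (i : Fin m) :
    densityGrad 𝔏 φ ν x i = hΩ.densityPartial h𝔏 (.inr i) φ ν x := by
  have hd : DifferentiableAt ℝ (fun c => 𝔏 (φ x) (ν x) c) (grad φ x) := by
    have h1 : ContDiff ℝ ∞ fun c : Eu m => 𝔏 (φ x) (ν x) c :=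
      h𝔏.comp (contDiff_const.prodMk (contDiff_const.prodMk contDiff_id))
    exact (contDiff_infty_iff_fderiv.1 h1).1 _
  have h1 : densityGrad 𝔏 φ ν x i =
      fderiv ℝ (fun c => 𝔏 (φ x) (ν x) c) (grad φ x) (EuclideanSpace.single i 1) := by
    rw [densityGrad, ← inner_gradient_left, EuclideanSpace.inner_single_right]
    simp
  rw [h1]
  have hline : HasDerivAt (fun s : ℝ => grad φ x + s • EuclideanSpace.single i (1 : ℝ))
      (EuclideanSpace.single i (1 : ℝ)) 0 := by
    simpa using ((hasDerivAt_id (0 : ℝ)).smul_const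
      (EuclideanSpace.single i (1 : ℝ) : Eu m)).const_add (grad φ x)
  have h2 : HasDerivAt (fun s : ℝ => 𝔏 (φ x) (ν x)
      (grad φ x + s • EuclideanSpace.single i (1 : ℝ)))
      (fderiv ℝ (fun c => 𝔏 (φ x) (ν x) c) (grad φ x) (EuclideanSpace.single i 1)) 0 := by
    refine HasFDerivAt.comp_hasDerivAt (0 : ℝ) (l := fun c => 𝔏 (φ x) (ν x) c) ?_ hline
    simpa using hd.hasFDerivAt
  refine h2.unique (hasDerivAt_jetDensity_line hΩ h𝔏 φ ν x (.inr i)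
    (c := fun s => Sum.elim ![φ x, ν x]
      fun l => (grad φ x + s • EuclideanSpace.single i (1 : ℝ) : Eu m) l) ?_ ?_)
  · funext j
    rcases j with j | j
    · fin_cases j <;> rfl
    · simp [jet, hΩ.grad_apply]
  · refine hasDerivAt_pi.2 fun j => ?_
    rcases j with j | j
    · fin_cases j
      · simpa using hasDerivAt_const _ _
      · simpa using hasDerivAt_const _ _
    · have h3 : HasDerivAt (fun s : ℝ => grad φ x j + s * (EuclideanSpace.single i (1 : ℝ) : Eu m) j)
          ((EuclideanSpace.single i (1 : ℝ) : Eu m) j) 0 := by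
        simpa using ((hasDerivAt_id (0 : ℝ)).mul_const
          ((EuclideanSpace.single i (1 : ℝ) : Eu m) j)).const_add (grad φ x j)
      simpa [Pi.single_apply, Sum.inr_injective.eq_iff] using h3

/-- The functional derivative `δL/δφ = (∂𝔏/∂φ - div ∂𝔏/∂∇φ, ∂𝔏/∂∇φ · n)`. -/
noncomputable def elPhi (φ ν : ConfSpace Ω) : RDual Ω :=
  (hΩ.densityPartial h𝔏 (.inl 0) φ ν -
      ∑ i, hΩ.partialDeriv i (hΩ.densityPartial h𝔏 (.inr i) φ ν),
    hΩ.normalTrace fun i => hΩ.densityPartial h𝔏 (.inr i) φ ν)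

/-- The functional derivative `δL/δν = (∂𝔏/∂ν, 0)`. -/
noncomputable def elNu (φ ν : ConfSpace Ω) : RDual Ω :=
  (hΩ.densityPartial h𝔏 (.inl 1) φ ν, 0)

theorem continuous_elPhi :
    Continuous fun q : ConfSpace Ω × ConfSpace Ω => hΩ.elPhi h𝔏 q.1 q.2 := by
  refine ((hΩ.continuous_densityPartial h𝔏 _).sub (continuous_finsetSum _ fun i _ =>
    (hΩ.partialDeriv i).continuous.comp (hΩ.continuous_densityPartial h𝔏 _))).prodMk ?_
  refine continuous_finsetSum _ fun i _ => CInf.continuous_mul.comp (Continuous.prodMk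
    ((CInf.bdry Ω).continuous.comp (hΩ.continuous_densityPartial h𝔏 _)) continuous_const)

theorem continuous_elNu :
    Continuous fun q : ConfSpace Ω × ConfSpace Ω => hΩ.elNu h𝔏 q.1 q.2 :=
  (hΩ.continuous_densityPartial h𝔏 _).prodMk continuous_const

theorem elPhi_fst_apply (φ ν : ConfSpace Ω) (x : closure Ω) :
    (hΩ.elPhi h𝔏 φ ν).1 x = densityPhi 𝔏 φ ν x - divergence (densityGrad 𝔏 φ ν) x := by
  have h : ∀ i, (fun y => densityGrad 𝔏 φ ν y i) = (hΩ.densityPartial h𝔏 (.inr i) φ ν).1 :=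
    fun i => funext fun y => hΩ.densityGrad_eq h𝔏 φ ν y i
  simp only [divergence, h]
  simp only [elPhi, CInf.sub_apply, CInf.sum_apply, hΩ.densityPhi_eq h𝔏, hΩ.partialDeriv_apply]

theorem elPhi_snd_apply (φ ν : ConfSpace Ω) (x : frontier Ω) :
    (hΩ.elPhi h𝔏 φ ν).2 x =
      inner ℝ (densityGrad 𝔏 φ ν (bdryIncl x)) (outwardNormal Ω x) := by
  simp only [elPhi, normalTrace, CInf.sum_apply, CInf.mul_apply, CInf.bdry_apply,
    normalComp_apply, PiLp.inner_apply, hΩ.densityGrad_eq h𝔏]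
  exact Finset.sum_congr rfl fun i _ => mul_comm _ _

/-- The first variation of the Lagrangian: the chain rule for Nemytskii operators, composed with the
integral, and integration by parts in space. -/
theorem hasDerivAt_lagrangian (φ ν δφ δν : ConfSpace Ω) (ε : ℝ) :
    HasDerivAt (fun s : ℝ => lagrangian 𝔏 (φ + s • δφ) (ν + s • δν))
      (pairing (hΩ.elPhi h𝔏 (φ + ε • δφ) (ν + ε • δν)) δφ +
        pairing (hΩ.elNu h𝔏 (φ + ε • δφ) (ν + ε • δν)) δν) ε := by
  set φ' := φ + ε • δφ
  set ν' := ν + ε • δν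
  have h := ((CInf.hasTimeDeriv_nem (contDiff_jetDensity h𝔏)
    (hΩ.hasTimeDeriv_jet φ ν δφ δν ε)).map hΩ.integralBody).hasDerivAt
  refine h.congr_deriv ?_
  have h1 : CInf.nem _ (CInf.contDiff_fderiv_apply (contDiff_jetDensity h𝔏))
      (Sum.elim (fun j => hΩ.jet φ' ν' j) (hΩ.jet δφ δν)) =
      CInf.mul (hΩ.densityPartial h𝔏 (.inl 0) φ' ν') δφ +
        CInf.mul (hΩ.densityPartial h𝔏 (.inl 1) φ' ν') δν +
        ∑ i, CInf.mul (hΩ.densityPartial h𝔏 (.inr i) φ' ν') (hΩ.partialDeriv i δφ) := by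
    ext x
    simp only [CInf.nem_apply, Sum.elim_inl, Sum.elim_inr, CInf.add_apply, CInf.mul_apply,
      CInf.sum_apply, densityPartial]
    refine (fderiv_apply_eq_sum _ _ _).trans ?_
    rw [Fintype.sum_sum_type, Fin.sum_univ_two]
    rfl
  rw [h1, map_add, map_add, hΩ.integral_sum_mul_partialDeriv]
  have h3 : hΩ.elPhi h𝔏 φ' ν' = (hΩ.densityPartial h𝔏 (.inl 0) φ' ν', 0) +
      (-∑ i, hΩ.partialDeriv i (hΩ.densityPartial h𝔏 (.inr i) φ' ν'),
        hΩ.normalTrace fun i => hΩ.densityPartial h𝔏 (.inr i) φ' ν') := by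
    simp [elPhi, sub_eq_add_neg]
  have h4 : ∀ (a ψ : ConfSpace Ω), pairing ((a, 0) : RDual Ω) ψ =
      hΩ.integralBody (CInf.mul a ψ) := by
    intro a ψ
    rw [hΩ.pairing_eq, show CInf.mul (0 : CInf (frontier Ω)) (CInf.bdry Ω ψ) = 0 from
      CInf.ext fun x => zero_mul _, map_zero, add_zero]
  rw [h3, ← hΩ.pairingForm_apply (_ + _), map_add, LinearMap.add_apply, pairingForm_apply,
    pairingForm_apply, h4, elNu, h4]
  ring

theorem functionalDeriv_eq (hΩ : IsSmoothBoundedDomain Ω) {G : ConfSpace Ω → ℝ} {φ : ConfSpace Ω} {a : RDual Ω}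
    (h : ∀ δφ : ConfSpace Ω, HasDerivAt (fun ε : ℝ => G (φ + ε • δφ)) (pairing a δφ) 0) :
    functionalDeriv G φ = a := by
  have hex : ∃ a : RDual Ω, ∀ δφ : ConfSpace Ω,
      HasDerivAt (fun ε : ℝ => G (φ + ε • δφ)) (pairing a δφ) 0 := ⟨a, h⟩
  rw [functionalDeriv, dif_pos hex]
  refine sub_eq_zero.1 (hΩ.eq_zero_of_pairing fun δφ => ?_)
  rw [← hΩ.pairingForm_apply, map_sub, LinearMap.sub_apply, pairingForm_apply, pairingForm_apply,
    (hex.choose_spec δφ).unique (h δφ), sub_self]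

/-- The functional derivative is determined by its values on variations, since the pairing is
nondegenerate; the boundary component comes from the divergence theorem. -/
theorem deltaPhi_lagrangian (φ ν : ConfSpace Ω) :
    deltaPhi (lagrangian 𝔏) φ ν = hΩ.elPhi h𝔏 φ ν := by
  refine hΩ.functionalDeriv_eq fun δφ => ?_
  have h := hΩ.hasDerivAt_lagrangian h𝔏 φ ν δφ 0 0
  simp only [smul_zero, zero_smul, add_zero, hΩ.pairing_zero_right] at h
  exact h

theorem deltaNu_lagrangian (φ ν : ConfSpace Ω) :
    deltaNu (lagrangian 𝔏) φ ν = hΩ.elNu h𝔏 φ ν := by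
  refine hΩ.functionalDeriv_eq fun δν => ?_
  have h := hΩ.hasDerivAt_lagrangian h𝔏 φ ν 0 δν 0
  simp only [smul_zero, zero_smul, add_zero, zero_add, hΩ.pairing_zero_right] at h
  exact h

-- `elPhi` is opaque to unification from here on: comparing two of its values by unfolding compares
-- all the Nemytskii operators in it.
attribute [irreducible] elPhi

end

end IsSmoothBoundedDomain

/-! ### The calculus of variations in time -/

/-- Differentiation under the integral sign, over a compact interval. -/
theorem hasDerivAt_intervalIntegral_of_continuousOn {f f' : ℝ → ℝ → ℝ} {a b : ℝ} (hab : a ≤ b)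
    (hf : ∀ ε, ContinuousOn (f ε) (Set.Icc a b))
    (hf' : ContinuousOn (fun p : ℝ × ℝ => f' p.1 p.2) (Set.univ ×ˢ Set.Icc a b))
    (h : ∀ t ∈ Set.Icc a b, ∀ ε, HasDerivAt (fun ε => f ε t) (f' ε t) ε) :
    HasDerivAt (fun ε => ∫ t in a..b, f ε t) (∫ t in a..b, f' 0 t) 0 := by
  obtain ⟨C, hC⟩ := ((isCompact_closedBall (0 : ℝ) 1).prod (isCompact_Icc (a := a) (b := b))
    ).exists_bound_of_continuousOn (hf'.mono (Set.prod_mono_left (Set.subset_univ _)))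
  have hI : ∀ {t}, t ∈ Set.uIoc a b → t ∈ Set.Icc a b := fun ht => by
    rw [Set.uIoc_of_le hab] at ht
    exact ⟨ht.1.le, ht.2⟩
  have hii : ∀ {u : ℝ → ℝ}, ContinuousOn u (Set.Icc a b) → IntervalIntegrable u volume a b :=
    fun hu => hu.intervalIntegrable_of_Icc hab
  have h0 : ContinuousOn (f' 0) (Set.Icc a b) :=
    hf'.comp (continuousOn_const.prodMk continuousOn_id) fun t ht => ⟨Set.mem_univ _, ht⟩
  exact (intervalIntegral.hasDerivAt_integral_of_dominated_loc_of_deriv_le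
    (s := Metric.closedBall 0 1) (bound := fun _ => C) (Metric.closedBall_mem_nhds _ one_pos)
    (Eventually.of_forall fun ε => (intervalIntegrable_iff.1 (hii (hf ε))).aestronglyMeasurable) (hii (hf 0))
    (intervalIntegrable_iff.1 (hii h0)).aestronglyMeasurable
    (Eventually.of_forall fun t ht ε hε => hC (ε, t) ⟨hε, hI ht⟩) intervalIntegrable_const
    (Eventually.of_forall fun t ht ε _ => h t (hI ht) ε)).2

theorem integral_congr_Icc {u v : ℝ → ℝ} {a b : ℝ} (hab : a ≤ b)
    (h : ∀ t ∈ Set.Icc a b, u t = v t) : ∫ t in a..b, u t = ∫ t in a..b, v t :=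
  intervalIntegral.integral_congr fun t ht => h t (by rwa [Set.uIcc_of_le hab] at ht)

/-- The fundamental lemma of the calculus of variations on a compact interval. -/
theorem eq_zero_of_integral_mul_eq_zero {u : ℝ → ℝ} {a b : ℝ} (hab : a < b)
    (hu : ContinuousOn u (Set.Icc a b))
    (h : ∀ χ : ℝ → ℝ, ContDiff ℝ ∞ χ → χ a = 0 → χ b = 0 → ∫ t in a..b, χ t * u t = 0) :
    ∀ t ∈ Set.Icc a b, u t = 0 := by
  have hae := isOpen_Ioo.ae_eq_zero_of_integral_contDiff_smul_eq_zero (U := Set.Ioo a b)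
    (μ := volume) (f := u)
    ((hu.mono Set.Ioo_subset_Icc_self).locallyIntegrableOn measurableSet_Ioo)
    fun χ hχ _ hs => by
      have h0 : ∀ t, t ∉ Set.Ioo a b → χ t = 0 := fun t ht =>
        image_eq_zero_of_notMem_tsupport fun ht' => ht (hs ht')
      rw [← h χ hχ (h0 a (by simp)) (h0 b (by simp)), intervalIntegral.integral_of_le hab.le,
        setIntegral_eq_integral_of_forall_compl_eq_zero]
      · rfl
      · intro t ht
        rw [h0 t fun ht' => ht ⟨ht'.1, ht'.2.le⟩, zero_mul]
  have hz : Set.EqOn u 0 (Set.Ioo a b) := Measure.eqOn_open_of_ae_eq (μ := volume)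
    ((ae_restrict_iff' measurableSet_Ioo).2 hae) isOpen_Ioo (hu.mono Set.Ioo_subset_Icc_self)
    continuousOn_const
  have := hz.of_subset_closure hu continuousOn_const Set.Ioo_subset_Icc_self
    (closure_Ioo hab.ne).ge
  exact fun t ht => this ht

theorem continuousOn_line {X : Type} [AddCommGroup X] [Module ℝ X] [TopologicalSpace X]
    [ContinuousAdd X] [ContinuousSMul ℝ X] {Z : Type} [TopologicalSpace Z] {s : Set Z}
    {c d : Z → X} (ε : ℝ) (hc : ContinuousOn c s) (hd : ContinuousOn d s) :
    ContinuousOn (fun t => c t + ε • d t) s :=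
  ContinuousOn.add hc (hd.const_smul ε)

section Curves

variable {X Y : Type} [AddCommGroup X] [Module ℝ X] [TopologicalSpace X]
  [AddCommGroup Y] [Module ℝ Y] [TopologicalSpace Y]
  {I : Set ℝ} {c : ℝ → X} {d : ℝ → Y} {v : X} {w : Y} {t : ℝ}

theorem HasTimeDeriv.prodMk (h : HasTimeDeriv I c v t) (h' : HasTimeDeriv I d w t) :
    HasTimeDeriv I (fun s => (c s, d s)) (v, w) t := by
  refine (Filter.Tendsto.prodMk_nhds h h').congr fun s => ?_
  simp [slope_def_module]

/-- The product rule for a continuous bilinear form. -/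
theorem HasTimeDeriv.bilin [IsTopologicalAddGroup Y] [ContinuousSMul ℝ Y]
    [IsTopologicalAddGroup X] [ContinuousSMul ℝ X] [T2Space Y]
    (B : X →ₗ[ℝ] Y →ₗ[ℝ] ℝ) (hB : Continuous fun p : X × Y => B p.1 p.2)
    (h : HasTimeDeriv I c v t) (h' : HasTimeDeriv I d w t) :
    HasDerivWithinAt (fun s => B (c s) (d s)) (B v (d t) + B (c t) w) I t := by
  refine hasDerivWithinAt_iff_tendsto_slope.2 ?_
  have h1 : Tendsto (fun s => B (slope c t s) (d s)) (𝓝[I \ {t}] t) (𝓝 (B v (d t))) :=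
    (hB.tendsto (v, d t)).comp (Filter.Tendsto.prodMk_nhds h
      (continuousWithinAt_sdiff_self.2 h'.continuousWithinAt))
  have h2 : Tendsto (fun s => B (c t) (slope d t s)) (𝓝[I \ {t}] t) (𝓝 (B (c t) w)) :=
    (hB.tendsto (c t, w)).comp (Filter.Tendsto.prodMk_nhds tendsto_const_nhds h')
  refine (h1.add h2).congr fun s => ?_
  simp only [slope_def_module, map_smul, map_sub, LinearMap.smul_apply, LinearMap.sub_apply,
    smul_eq_mul]
  ring

end Curves

namespace IsSmoothBoundedDomain

variable {m : ℕ} {Ω : Set (Eu m)} {t₀ t₁ : ℝ}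

theorem continuousOn_pairing (hΩ : IsSmoothBoundedDomain Ω) {Z : Type} [TopologicalSpace Z]
    {s : Set Z} {β : Z → RDual Ω} {ψ : Z → ConfSpace Ω} (hβ : ContinuousOn β s)
    (hψ : ContinuousOn ψ s) : ContinuousOn (fun z => pairing (β z) (ψ z)) s :=
  hΩ.continuous_pairing.comp_continuousOn (hβ.prodMk hψ)

theorem continuousOn_lagrangian (hΩ : IsSmoothBoundedDomain Ω) {𝔏 : ℝ → ℝ → Eu m → ℝ}
    (h𝔏 : ContDiff ℝ ∞ (fun q : ℝ × ℝ × Eu m => 𝔏 q.1 q.2.1 q.2.2)) {Z : Type}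
    [TopologicalSpace Z] {s : Set Z} {φ ν : Z → ConfSpace Ω} (hφ : ContinuousOn φ s)
    (hν : ContinuousOn ν s) : ContinuousOn (fun z => lagrangian 𝔏 (φ z) (ν z)) s :=
  (hΩ.continuous_lagrangian h𝔏).comp_continuousOn (hφ.prodMk hν)

theorem continuousOn_elPhi (hΩ : IsSmoothBoundedDomain Ω) {𝔏 : ℝ → ℝ → Eu m → ℝ}
    (h𝔏 : ContDiff ℝ ∞ (fun q : ℝ × ℝ × Eu m => 𝔏 q.1 q.2.1 q.2.2)) {Z : Type}
    [TopologicalSpace Z] {s : Set Z} {φ ν : Z → ConfSpace Ω} (hφ : ContinuousOn φ s)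
    (hν : ContinuousOn ν s) : ContinuousOn (fun z => hΩ.elPhi h𝔏 (φ z) (ν z)) s :=
  (hΩ.continuous_elPhi h𝔏).comp_continuousOn (hφ.prodMk hν)

theorem continuousOn_elNu (hΩ : IsSmoothBoundedDomain Ω) {𝔏 : ℝ → ℝ → Eu m → ℝ}
    (h𝔏 : ContDiff ℝ ∞ (fun q : ℝ × ℝ × Eu m => 𝔏 q.1 q.2.1 q.2.2)) {Z : Type}
    [TopologicalSpace Z] {s : Set Z} {φ ν : Z → ConfSpace Ω} (hφ : ContinuousOn φ s)
    (hν : ContinuousOn ν s) : ContinuousOn (fun z => hΩ.elNu h𝔏 (φ z) (ν z)) s :=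
  (hΩ.continuous_elNu h𝔏).comp_continuousOn (hφ.prodMk hν)

/-- Integration by parts in time, for a curve in `V⋆` and a curve in `V` that vanishes at the
ends. -/
theorem integral_pairing_deriv (hΩ : IsSmoothBoundedDomain Ω) (ht : t₀ ≤ t₁)
    {β β' : ℝ → RDual Ω} {ψ ψ' : ℝ → ConfSpace Ω}
    (hβ : ∀ t ∈ Set.Icc t₀ t₁, HasTimeDeriv (Set.Icc t₀ t₁) β (β' t) t)
    (hψ : ∀ t ∈ Set.Icc t₀ t₁, HasTimeDeriv (Set.Icc t₀ t₁) ψ (ψ' t) t)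
    (hβ' : ContinuousOn β' (Set.Icc t₀ t₁)) (hψ' : ContinuousOn ψ' (Set.Icc t₀ t₁))
    (h₀ : ψ t₀ = 0) (h₁ : ψ t₁ = 0) :
    ∫ t in t₀..t₁, (pairing (β' t) (ψ t) + pairing (β t) (ψ' t)) = 0 := by
  have hd : ∀ t ∈ Set.Icc t₀ t₁, HasDerivWithinAt (fun s => pairing (β s) (ψ s))
      (pairing (β' t) (ψ t) + pairing (β t) (ψ' t)) (Set.Icc t₀ t₁) t := fun t h =>
    HasTimeDeriv.bilin hΩ.pairingForm hΩ.continuous_pairing (hβ t h) (hψ t h)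
  have hβc : ContinuousOn β (Set.Icc t₀ t₁) := fun t h => (hβ t h).continuousWithinAt
  have hψc : ContinuousOn ψ (Set.Icc t₀ t₁) := fun t h => (hψ t h).continuousWithinAt
  rw [intervalIntegral.integral_eq_sub_of_hasDerivAt_of_le ht
    (fun t h => (hd t h).continuousWithinAt)
    (fun t h => (hd t (Set.Ioo_subset_Icc_self h)).hasDerivAt (Icc_mem_nhds h.1 h.2))
    (((hΩ.continuousOn_pairing hβ' hψc).add (hΩ.continuousOn_pairing hβc hψ')
      ).intervalIntegrable_of_Icc ht), h₀, h₁, hΩ.pairing_zero_right, hΩ.pairing_zero_right,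
    sub_zero]

theorem pairing_zero_left (hΩ : IsSmoothBoundedDomain Ω) (ψ : ConfSpace Ω) :
    pairing (0 : RDual Ω) ψ = 0 :=
  LinearMap.congr_fun (map_zero hΩ.pairingForm) ψ

/-- Integration by parts in the first variation: `a` is the momentum, `p` the derivative of the
Lagrangian in `φ`, `f` the force, and `k` collects the variations that carry no time derivative. -/
theorem integral_first_variation (hΩ : IsSmoothBoundedDomain Ω) (ht : t₀ ≤ t₁)
    {a a' p f : ℝ → RDual Ω} {ψ ψ' : ℝ → ConfSpace Ω} {k : ℝ → ℝ}
    (ha : ∀ t ∈ Set.Icc t₀ t₁, HasTimeDeriv (Set.Icc t₀ t₁) a (a' t) t)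
    (hψ : ∀ t ∈ Set.Icc t₀ t₁, HasTimeDeriv (Set.Icc t₀ t₁) ψ (ψ' t) t)
    (ha' : ContinuousOn a' (Set.Icc t₀ t₁)) (hψ' : ContinuousOn ψ' (Set.Icc t₀ t₁))
    (h₀ : ψ t₀ = 0) (h₁ : ψ t₁ = 0) (hp : ContinuousOn p (Set.Icc t₀ t₁))
    (hf : ContinuousOn f (Set.Icc t₀ t₁)) (hk : ContinuousOn k (Set.Icc t₀ t₁)) :
    (∫ t in t₀..t₁, (pairing (p t) (ψ t) + pairing (a t) (ψ' t) + k t)) +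
        ∫ t in t₀..t₁, pairing (f t) (ψ t) =
      ∫ t in t₀..t₁, (pairing (p t + f t - a' t) (ψ t) + k t) := by
  have hac : ContinuousOn a (Set.Icc t₀ t₁) := fun t h => (ha t h).continuousWithinAt
  have hψc : ContinuousOn ψ (Set.Icc t₀ t₁) := fun t h => (hψ t h).continuousWithinAt
  have c1 := hΩ.continuousOn_pairing hp hψc
  have c2 := hΩ.continuousOn_pairing hac hψ'
  have c3 := hΩ.continuousOn_pairing hf hψc
  have c4 := hΩ.continuousOn_pairing ha' hψc
  have e1 : IntervalIntegrable (fun t => pairing (p t) (ψ t) + pairing (a t) (ψ' t) + k t) volume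
    t₀ t₁ := (ContinuousOn.add (ContinuousOn.add c1 c2) hk).intervalIntegrable_of_Icc ht
  have e2 : IntervalIntegrable (fun t => pairing (f t) (ψ t)) volume t₀ t₁ :=
    c3.intervalIntegrable_of_Icc ht
  have e3 : IntervalIntegrable (fun t => pairing (a' t) (ψ t) + pairing (a t) (ψ' t)) volume
    t₀ t₁ := (ContinuousOn.add c4 c2).intervalIntegrable_of_Icc ht
  rw [← intervalIntegral.integral_add e1 e2, ← sub_zero (∫ t in t₀..t₁, _),
    ← hΩ.integral_pairing_deriv ht ha hψ ha' hψ' h₀ h₁,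
    ← intervalIntegral.integral_sub (e1.add e2) e3]
  refine integral_congr_Icc ht fun t _ => ?_
  simp only [← hΩ.pairingForm_apply, map_add, map_sub, LinearMap.add_apply, LinearMap.sub_apply]
  ring

/-- The fundamental lemma for curves in `V⋆`. -/
theorem eq_zero_of_integral_pairing (hΩ : IsSmoothBoundedDomain Ω) (ht : t₀ < t₁)
    {β : ℝ → RDual Ω} (hβ : ContinuousOn β (Set.Icc t₀ t₁))
    (h : ∀ (χ : ℝ → ℝ) (ψ : ConfSpace Ω), ContDiff ℝ ∞ χ → χ t₀ = 0 → χ t₁ = 0 →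
      ∫ t in t₀..t₁, pairing (β t) (χ t • ψ) = 0) :
    ∀ t ∈ Set.Icc t₀ t₁, β t = 0 := by
  refine fun t htI => hΩ.eq_zero_of_pairing fun ψ => ?_
  refine eq_zero_of_integral_mul_eq_zero (u := fun t => pairing (β t) ψ) ht
    (hΩ.continuousOn_pairing hβ continuousOn_const) (fun χ hχ h₀ h₁ => ?_) t htI
  rw [← h χ ψ hχ h₀ h₁]
  simp only [← hΩ.pairingForm_apply, map_smul, smul_eq_mul]

/-- The fundamental lemma for curves in `V`. -/
theorem eq_zero_of_integral_pairing_right (hΩ : IsSmoothBoundedDomain Ω) (ht : t₀ < t₁)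
    {ψ : ℝ → ConfSpace Ω} (hψ : ContinuousOn ψ (Set.Icc t₀ t₁))
    (h : ∀ (χ : ℝ → ℝ) (a : RDual Ω), ContDiff ℝ ∞ χ → χ t₀ = 0 → χ t₁ = 0 →
      ∫ t in t₀..t₁, pairing (χ t • a) (ψ t) = 0) :
    ∀ t ∈ Set.Icc t₀ t₁, ψ t = 0 := by
  refine fun t htI => hΩ.eq_zero_of_pairing_right fun a => ?_
  refine eq_zero_of_integral_mul_eq_zero (u := fun t => pairing a (ψ t)) ht
    (hΩ.continuousOn_pairing continuousOn_const hψ) (fun χ hχ h₀ h₁ => ?_) t htI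
  rw [← h χ a hχ h₀ h₁]
  simp only [← hΩ.pairingForm_apply, map_smul, LinearMap.smul_apply, smul_eq_mul]

variable {𝔏 : ℝ → ℝ → Eu m → ℝ} {φ ν δφ δν : ℝ → ConfSpace Ω} {α δα : ℝ → RDual Ω}
  {τ δτ : ℝ → ConfSpace Ω}

/-- The first variation of the action. -/
theorem hasDerivAt_action (hΩ : IsSmoothBoundedDomain Ω)
    (h𝔏 : ContDiff ℝ ∞ (fun q : ℝ × ℝ × Eu m => 𝔏 q.1 q.2.1 q.2.2)) (ht : t₀ ≤ t₁)
    (hφ : ContinuousOn φ (Set.Icc t₀ t₁)) (hν : ContinuousOn ν (Set.Icc t₀ t₁))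
    (hδφ : ContinuousOn δφ (Set.Icc t₀ t₁)) (hδν : ContinuousOn δν (Set.Icc t₀ t₁)) :
    HasDerivAt (fun ε : ℝ => ∫ t in t₀..t₁, lagrangian 𝔏 (φ t + ε • δφ t) (ν t + ε • δν t))
      (∫ t in t₀..t₁, (pairing (hΩ.elPhi h𝔏 (φ t) (ν t)) (δφ t) +
        pairing (hΩ.elNu h𝔏 (φ t) (ν t)) (δν t))) 0 := by
  have hline : ∀ {c d : ℝ → ConfSpace Ω}, ContinuousOn c (Set.Icc t₀ t₁) →
      ContinuousOn d (Set.Icc t₀ t₁) → ContinuousOn (fun p : ℝ × ℝ => c p.2 + p.1 • d p.2)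
        (Set.univ ×ˢ Set.Icc t₀ t₁) := fun hc hd =>
    ContinuousOn.add (hc.comp continuousOn_snd fun p hp => hp.2)
      (continuousOn_fst.smul (hd.comp continuousOn_snd fun p hp => hp.2))
  have h := hasDerivAt_intervalIntegral_of_continuousOn ht
    (f := fun ε t => lagrangian 𝔏 (φ t + ε • δφ t) (ν t + ε • δν t))
    (f' := fun ε t => pairing (hΩ.elPhi h𝔏 (φ t + ε • δφ t) (ν t + ε • δν t)) (δφ t) +
        pairing (hΩ.elNu h𝔏 (φ t + ε • δφ t) (ν t + ε • δν t)) (δν t)) (fun ε => ?_) ?_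
    fun t _ ε => hΩ.hasDerivAt_lagrangian h𝔏 (φ t) (ν t) (δφ t) (δν t) ε
  · simpa only [zero_smul, add_zero] using h
  · exact hΩ.continuousOn_lagrangian h𝔏 (continuousOn_line ε hφ hδφ) (continuousOn_line ε hν hδν)
  · have h1 : ContinuousOn (fun p : ℝ × ℝ => δφ p.2) (Set.univ ×ˢ Set.Icc t₀ t₁) :=
      hδφ.comp continuousOn_snd fun p hp => hp.2
    have h2 : ContinuousOn (fun p : ℝ × ℝ => δν p.2) (Set.univ ×ˢ Set.Icc t₀ t₁) :=
      hδν.comp continuousOn_snd fun p hp => hp.2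
    have h3 := hΩ.continuousOn_pairing (hΩ.continuousOn_elPhi h𝔏 (hline hφ hδφ) (hline hν hδν)) h1
    have h4 := hΩ.continuousOn_pairing (hΩ.continuousOn_elNu h𝔏 (hline hφ hδφ) (hline hν hδν)) h2
    exact h3.add h4

/-- The first variation of the constraint term `∫ ⟨α, φ̇ - ν⟩ dt`, for curves `τ = φ̇`. -/
theorem hasDerivAt_constraint (hΩ : IsSmoothBoundedDomain Ω) (ht : t₀ ≤ t₁)
    (hα : ContinuousOn α (Set.Icc t₀ t₁)) (hδα : ContinuousOn δα (Set.Icc t₀ t₁))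
    (hτ : ContinuousOn τ (Set.Icc t₀ t₁)) (hδτ : ContinuousOn δτ (Set.Icc t₀ t₁)) :
    HasDerivAt (fun ε : ℝ => ∫ t in t₀..t₁, pairing (α t + ε • δα t) (τ t + ε • δτ t))
      (∫ t in t₀..t₁, (pairing (δα t) (τ t) + pairing (α t) (δτ t))) 0 := by
  have hexp : ∀ t ε, pairing (α t + ε • δα t) (τ t + ε • δτ t) = pairing (α t) (τ t) +
      ε * (pairing (δα t) (τ t) + pairing (α t) (δτ t)) + ε ^ 2 * pairing (δα t) (δτ t) := by
    intro t ε
    simp only [← hΩ.pairingForm_apply, map_add, map_smul, LinearMap.add_apply,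
      LinearMap.smul_apply, smul_eq_mul]
    ring
  have hc1 := hΩ.continuousOn_pairing hα hτ
  have hc2 := (hΩ.continuousOn_pairing hδα hτ).add (hΩ.continuousOn_pairing hα hδτ)
  have hc3 := hΩ.continuousOn_pairing hδα hδτ
  have h := hasDerivAt_intervalIntegral_of_continuousOn ht
    (f := fun ε t => pairing (α t + ε • δα t) (τ t + ε • δτ t))
    (f' := fun ε t => (pairing (δα t) (τ t) + pairing (α t) (δτ t)) +
      2 * ε * pairing (δα t) (δτ t)) (fun ε => ?_) ?_ fun t _ ε => ?_
  · simpa only [mul_zero, zero_mul, add_zero] using h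
  · simp only [hexp]
    exact (hc1.add (continuousOn_const.mul hc2)).add (continuousOn_const.mul hc3)
  · exact (hc2.comp continuousOn_snd fun p hp => hp.2).add
      ((continuousOn_const.mul continuousOn_fst).mul
        (hc3.comp continuousOn_snd fun p hp => hp.2))
  · simp only [hexp]
    refine ((((hasDerivAt_id' ε).mul_const _).const_add _).add
      (((hasDerivAt_id' ε).pow 2).mul_const _)).congr_deriv ?_
    simp

theorem hasDerivAt_action_add_constraint (hΩ : IsSmoothBoundedDomain Ω)
    (h𝔏 : ContDiff ℝ ∞ (fun q : ℝ × ℝ × Eu m => 𝔏 q.1 q.2.1 q.2.2)) (ht : t₀ ≤ t₁)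
    (hφ : ContinuousOn φ (Set.Icc t₀ t₁)) (hν : ContinuousOn ν (Set.Icc t₀ t₁))
    (hδφ : ContinuousOn δφ (Set.Icc t₀ t₁)) (hδν : ContinuousOn δν (Set.Icc t₀ t₁))
    (hα : ContinuousOn α (Set.Icc t₀ t₁)) (hδα : ContinuousOn δα (Set.Icc t₀ t₁))
    (hτ : ContinuousOn τ (Set.Icc t₀ t₁)) (hδτ : ContinuousOn δτ (Set.Icc t₀ t₁)) :
    HasDerivAt (fun ε : ℝ => ∫ t in t₀..t₁, (lagrangian 𝔏 (φ t + ε • δφ t) (ν t + ε • δν t) +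
        pairing (α t + ε • δα t) (τ t + ε • δτ t)))
      (∫ t in t₀..t₁, ((pairing (hΩ.elPhi h𝔏 (φ t) (ν t)) (δφ t) +
        pairing (hΩ.elNu h𝔏 (φ t) (ν t)) (δν t)) +
        (pairing (δα t) (τ t) + pairing (α t) (δτ t)))) 0 := by
  have hii : ∀ {u : ℝ → ℝ}, ContinuousOn u (Set.Icc t₀ t₁) → IntervalIntegrable u volume t₀ t₁ :=
    fun hu => hu.intervalIntegrable_of_Icc ht
  have e1 : IntervalIntegrable (fun t => pairing (hΩ.elPhi h𝔏 (φ t) (ν t)) (δφ t) +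
      pairing (hΩ.elNu h𝔏 (φ t) (ν t)) (δν t)) volume t₀ t₁ := hii (ContinuousOn.add
    (hΩ.continuousOn_pairing (hΩ.continuousOn_elPhi h𝔏 hφ hν) hδφ)
    (hΩ.continuousOn_pairing (hΩ.continuousOn_elNu h𝔏 hφ hν) hδν))
  have e2 : IntervalIntegrable (fun t => pairing (δα t) (τ t) + pairing (α t) (δτ t)) volume
      t₀ t₁ := hii (ContinuousOn.add (hΩ.continuousOn_pairing hδα hτ)
    (hΩ.continuousOn_pairing hα hδτ))
  rw [intervalIntegral.integral_add e1 e2]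
  refine ((hΩ.hasDerivAt_action h𝔏 ht hφ hν hδφ hδν).add
    (hΩ.hasDerivAt_constraint ht hα hδα hτ hδτ)).congr_of_eventuallyEq
    (Eventually.of_forall fun ε => ?_)
  have e3 := hii (hΩ.continuousOn_lagrangian h𝔏 (continuousOn_line ε hφ hδφ)
    (continuousOn_line ε hν hδν))
  have e4 := hii (hΩ.continuousOn_pairing (continuousOn_line ε hα hδα)
    (continuousOn_line ε hτ hδτ))
  exact intervalIntegral.integral_add e3 e4

end IsSmoothBoundedDomain

/-! ### The implicit equations of motion -/

/-- The evaluation at a point. -/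
noncomputable def CInf.evalAt {m : ℕ} {K : Set (Eu m)} (x : K) : CInf K →L[ℝ] ℝ where
  toFun φ := φ x
  map_add' _ _ := rfl
  map_smul' _ _ := rfl
  cont := CInf.continuous_apply x

theorem HasTimeDeriv.hasDerivWithinAt_apply {m : ℕ} {K : Set (Eu m)} {I : Set ℝ}
    {c : ℝ → CInf K} {v : CInf K} {t : ℝ} (h : HasTimeDeriv I c v t) (x : K) :
    HasDerivWithinAt (fun s => c s x) (v x) I t :=
  hasDerivWithinAt_iff_tendsto_slope.2 (h.map (CInf.evalAt x))

namespace IsSmoothBoundedDomain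

variable {m : ℕ} {Ω : Set (Eu m)} {𝔏 : ℝ → ℝ → Eu m → ℝ}

/-- The equations of motion in `V` and `V⋆`: `φ̇ = ν`, `(α, α_∂) = δL/δν` and
`(α̇, α̇_∂) = δL/δφ + F`. -/
def IsSolution (hΩ : IsSmoothBoundedDomain Ω)
    (h𝔏 : ContDiff ℝ ∞ (fun q : ℝ × ℝ × Eu m => 𝔏 q.1 q.2.1 q.2.2))
    (F : ConfSpace Ω → ConfSpace Ω → RDual Ω) (t₀ t₁ : ℝ)
    (φ ν α : ℝ → CInf (closure Ω)) (αb : ℝ → CInf (frontier Ω)) : Prop :=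
  ∀ t ∈ Set.Icc t₀ t₁, timeDeriv (Set.Icc t₀ t₁) φ t = ν t ∧
    (α t, αb t) = hΩ.elNu h𝔏 (φ t) (ν t) ∧
    (timeDeriv (Set.Icc t₀ t₁) α t, timeDeriv (Set.Icc t₀ t₁) αb t) =
      hΩ.elPhi h𝔏 (φ t) (ν t) + F (φ t) (ν t)

section

variable (hΩ : IsSmoothBoundedDomain Ω)
  (h𝔏 : ContDiff ℝ ∞ (fun q : ℝ × ℝ × Eu m => 𝔏 q.1 q.2.1 q.2.2))
  {F : ConfSpace Ω → ConfSpace Ω → RDual Ω} {t₀ t₁ : ℝ} {r : ℕ∞}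
  {φ ν α : ℝ → CInf (closure Ω)} {αb : ℝ → CInf (frontier Ω)}

theorem eq_elNu_iff {φ ν α : CInf (closure Ω)} {αb : CInf (frontier Ω)} :
    (α, αb) = hΩ.elNu h𝔏 φ ν ↔ (∀ x, α x = densityNu 𝔏 φ ν x) ∧ αb = 0 := by
  rw [elNu, Prod.mk.injEq]
  refine and_congr_left fun _ => ?_
  simp only [hΩ.densityNu_eq h𝔏]
  exact ⟨fun h x => by rw [h], CInf.ext⟩

theorem eq_elPhi_add_iff {φ ν α : CInf (closure Ω)} {αb : CInf (frontier Ω)} {f : RDual Ω} :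
    (α, αb) = hΩ.elPhi h𝔏 φ ν + f ↔
      (∀ x, α x = densityPhi 𝔏 φ ν x - divergence (densityGrad 𝔏 φ ν) x + f.1 x) ∧
      ∀ x, αb x = inner ℝ (densityGrad 𝔏 φ ν (bdryIncl x)) (outwardNormal Ω x) + f.2 x := by
  simp only [← hΩ.elPhi_fst_apply h𝔏, ← hΩ.elPhi_snd_apply h𝔏]
  constructor
  · intro h
    exact ⟨fun x => congrArg (fun a : RDual Ω => a.1 x) h,
      fun x => congrArg (fun a : RDual Ω => a.2 x) h⟩
  · rintro ⟨h, h'⟩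
    exact Prod.ext (CInf.ext h) (CInf.ext h')

theorem ldAPEquations_iff :
    LdAPEquations 𝔏 F t₀ t₁ φ ν α αb ↔ hΩ.IsSolution h𝔏 F t₀ t₁ φ ν α αb := by
  refine forall₂_congr fun t _ => ?_
  rw [hΩ.eq_elNu_iff h𝔏, hΩ.eq_elPhi_add_iff h𝔏]
  tauto

/-- The reconstruction conditions are the first two equations of `IsSolution`. -/
theorem isReconstructed_iff : IsReconstructed (lagrangian 𝔏) t₀ t₁ φ ν α αb ↔
    ∀ t ∈ Set.Icc t₀ t₁, timeDeriv (Set.Icc t₀ t₁) φ t = ν t ∧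
      (α t, αb t) = hΩ.elNu h𝔏 (φ t) (ν t) := by
  refine forall₂_congr fun t _ => ?_
  rw [legendre, hΩ.deltaNu_lagrangian h𝔏, Prod.mk.injEq]
  simp only [true_and, eq_comm]

/-- The canonical two-form is the canonical symplectic form of the pairing. -/
theorem canonicalTwoForm_eq (hΩ : IsSmoothBoundedDomain Ω) (z u w : TStar Ω) :
    canonicalTwoForm z u w = pairing w.2 u.1 - pairing u.2 w.1 := by
  have h : ∀ u w : TStar Ω, HasDerivAt (fun ε : ℝ => canonicalOneForm (z + ε • u) w)
      (pairing u.2 w.1) 0 := by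
    intro u w
    have h1 : (fun ε : ℝ => canonicalOneForm (z + ε • u) w) =
        fun ε => pairing z.2 w.1 + ε * pairing u.2 w.1 := by
      funext ε
      simp only [canonicalOneForm, Prod.snd_add, Prod.smul_snd, ← hΩ.pairingForm_apply, map_add,
        map_smul, LinearMap.add_apply, LinearMap.smul_apply, smul_eq_mul]
    rw [h1]
    simpa using ((hasDerivAt_id' (0 : ℝ)).mul_const (pairing u.2 w.1)).const_add (pairing z.2 w.1)
  rw [canonicalTwoForm, (h u w).deriv, (h w u).deriv]
  ring

/-- Membership in the canonical Dirac structure is an identity between continuous linear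
functionals of a tangent vector; its components in `V` and `V⋆` are separated by nondegeneracy of
the pairing. -/
theorem lagrangeDirac_iff :
    LagrangeDirac (lagrangian 𝔏) F t₀ t₁ φ ν α αb ↔ hΩ.IsSolution h𝔏 F t₀ t₁ φ ν α αb := by
  refine forall₂_congr fun t _ => ?_
  set φ' := timeDeriv (Set.Icc t₀ t₁) φ t
  set a' : RDual Ω := (timeDeriv (Set.Icc t₀ t₁) α t, timeDeriv (Set.Icc t₀ t₁) αb t)
  have h1 : (((φ t, (α t, αb t)), (φ', a')),
      fiberSub (diracDiff (lagrangian 𝔏) (φ t) (ν t)) (forceField (lagrangian 𝔏) F (φ t) (ν t))) ∈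
        canonicalDirac Ω ↔ (φ t, hΩ.elNu h𝔏 (φ t) (ν t)) = (φ t, (α t, αb t)) ∧
      ∀ w : TStar Ω, pairing (-hΩ.elPhi h𝔏 (φ t) (ν t) - F (φ t) (ν t)) w.1 +
        pairing w.2 (ν t - 0) = pairing w.2 φ' - pairing a' w.1 := by
    simp only [canonicalDirac, Set.mem_ofPred_eq, hΩ.canonicalTwoForm_eq, fiberSub, diracDiff,
      tulczyjewGamma, lagDiff, forceField, covectorApply, hΩ.deltaPhi_lagrangian h𝔏,
      hΩ.deltaNu_lagrangian h𝔏, Prod.fst_sub, Prod.snd_sub]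
  rw [h1, Prod.mk.injEq, eq_comm (a := hΩ.elNu h𝔏 (φ t) (ν t))]
  simp only [true_and, sub_zero, ← hΩ.pairingForm_apply]
  constructor
  · rintro ⟨hα, h⟩
    refine ⟨(sub_eq_zero.1 (hΩ.eq_zero_of_pairing_right fun b => ?_)), hα,
      sub_eq_zero.1 (hΩ.eq_zero_of_pairing fun ψ => ?_)⟩
    · have h2 := h (0, b)
      simp only [map_zero, zero_add, sub_zero] at h2
      rw [← hΩ.pairingForm_apply, map_sub, h2, sub_self]
    · have h2 := h (ψ, 0)
      simp only [map_zero, LinearMap.zero_apply, add_zero, zero_sub, map_sub, map_neg,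
        LinearMap.sub_apply, LinearMap.neg_apply] at h2
      rw [← hΩ.pairingForm_apply, map_sub, map_add, LinearMap.sub_apply, LinearMap.add_apply]
      linarith
  · rintro ⟨hφ, hα, ha⟩
    refine ⟨hα, fun w => ?_⟩
    rw [hφ, ha]
    simp only [map_sub, map_neg, map_add, LinearMap.sub_apply, LinearMap.neg_apply,
      LinearMap.add_apply]
    ring

theorem timeDeriv_line (ht : t₀ < t₁)
    {φ δφ : ℝ → CInf (closure Ω)} (hφ : IsCurve (Set.Icc t₀ t₁) (r + 1) φ)
    (hδφ : IsCurve (Set.Icc t₀ t₁) (r + 1) δφ) (ε : ℝ) {t : ℝ} (h : t ∈ Set.Icc t₀ t₁) :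
    timeDeriv (Set.Icc t₀ t₁) (fun s => φ s + ε • δφ s) t =
      timeDeriv (Set.Icc t₀ t₁) φ t + ε • timeDeriv (Set.Icc t₀ t₁) δφ t :=
  have hn := nhdsWithin_Icc_diff_neBot ht t h
  ((hφ.hasTimeDeriv le_add_self h hn).add
    ((hδφ.hasTimeDeriv le_add_self h hn).const_smul ε)).timeDeriv_eq hn

/-- For a curve `φ` along which `δL/δν` has the continuous time derivative `a'`, the
Lagrange–d'Alembert principle is the equation `a' = δL/δφ + F`. -/
theorem ldAPrinciple_iff (hF : Continuous fun q : ConfSpace Ω × ConfSpace Ω => F q.1 q.2)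
    (ht : t₀ < t₁) (hφ : IsCurve (Set.Icc t₀ t₁) (r + 1) φ) {a a' : ℝ → RDual Ω}
    (ha : ∀ t ∈ Set.Icc t₀ t₁, a t = hΩ.elNu h𝔏 (φ t) (timeDeriv (Set.Icc t₀ t₁) φ t))
    (ha' : ∀ t ∈ Set.Icc t₀ t₁, HasTimeDeriv (Set.Icc t₀ t₁) a (a' t) t)
    (hc : ContinuousOn a' (Set.Icc t₀ t₁)) :
    LdAPrinciple (lagrangian 𝔏) F t₀ t₁ r φ ↔ ∀ t ∈ Set.Icc t₀ t₁,
      a' t = hΩ.elPhi h𝔏 (φ t) (timeDeriv (Set.Icc t₀ t₁) φ t) +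
        F (φ t) (timeDeriv (Set.Icc t₀ t₁) φ t) := by
  have hI := nhdsWithin_Icc_diff_neBot ht
  have hφc := hφ.continuousOn
  have hφ'c := hφ.timeDeriv.continuousOn
  have hFc : ContinuousOn (fun t => F (φ t) (timeDeriv (Set.Icc t₀ t₁) φ t)) (Set.Icc t₀ t₁) :=
    hF.comp_continuousOn (hφc.prodMk hφ'c)
  have hvar : ∀ δφ : ℝ → ConfSpace Ω, IsCurve (Set.Icc t₀ t₁) (r + 1) δφ → δφ t₀ = 0 → δφ t₁ = 0 →
      ∃ d : ℝ, HasDerivAt (fun ε : ℝ => ∫ t in t₀..t₁, lagrangian 𝔏 (φ t + ε • δφ t)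
        (timeDeriv (Set.Icc t₀ t₁) (fun s => φ s + ε • δφ s) t)) d 0 ∧
      d + (∫ t in t₀..t₁, pairing (F (φ t) (timeDeriv (Set.Icc t₀ t₁) φ t)) (δφ t)) =
        ∫ t in t₀..t₁, (pairing (hΩ.elPhi h𝔏 (φ t) (timeDeriv (Set.Icc t₀ t₁) φ t) +
          F (φ t) (timeDeriv (Set.Icc t₀ t₁) φ t) - a' t) (δφ t) + 0) := by
    intro δφ hδφ h₀ h₁
    have hδ'c := hδφ.timeDeriv.continuousOn
    refine ⟨_, (hΩ.hasDerivAt_action h𝔏 ht.le hφc hφ'c hδφ.continuousOn hδ'c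
      ).congr_of_eventuallyEq (Eventually.of_forall fun ε =>
        integral_congr_Icc ht.le fun t h => ?_), ?_⟩
    · rw [timeDeriv_line ht hφ hδφ ε h]
    · refine Eq.trans ?_ (hΩ.integral_first_variation ht.le ha'
        (fun t h => hδφ.hasTimeDeriv le_add_self h (hI t h)) hc hδ'c h₀ h₁
        (hΩ.continuousOn_elPhi h𝔏 hφc hφ'c) hFc (continuousOn_const (c := (0 : ℝ))))
      congr 1
      exact integral_congr_Icc ht.le fun t h => by rw [ha t h, add_zero]
  constructor
  · intro h t htI
    refine (sub_eq_zero.1 (hΩ.eq_zero_of_integral_pairing ht (ContinuousOn.sub (ContinuousOn.add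
      (hΩ.continuousOn_elPhi h𝔏 hφc hφ'c) hFc) hc) (fun χ ψ hχ h₀ h₁ => ?_) t htI)).symm
    have hδ : IsCurve (Set.Icc t₀ t₁) (r + 1) fun t => χ t • ψ := IsCurve.smul_const hI hχ ψ
    have hδ₀ : χ t₀ • ψ = 0 := by rw [h₀, zero_smul]
    have hδ₁ : χ t₁ • ψ = 0 := by rw [h₁, zero_smul]
    obtain ⟨d, hd, hd0⟩ := h _ hδ hδ₀ hδ₁
    obtain ⟨d', hd', hd0'⟩ := hvar _ hδ hδ₀ hδ₁
    rw [← hd.unique hd', hd0] at hd0'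
    simp only [add_zero] at hd0'
    exact hd0'.symm
  · intro h δφ hδ hδ₀ hδ₁
    obtain ⟨d, hd, hd0⟩ := hvar δφ hδ hδ₀ hδ₁
    refine ⟨d, hd, hd0.trans ?_⟩
    rw [integral_congr_Icc (v := fun _ => 0) ht.le fun t htI => ?_, intervalIntegral.integral_zero]
    rw [h t htI, sub_self, hΩ.pairing_zero_left, add_zero]

theorem hasTimeDeriv_prod (ht : t₀ < t₁) (hr : 1 ≤ r) (hα : IsCurve (Set.Icc t₀ t₁) r α)
    (hαb : IsCurve (Set.Icc t₀ t₁) r αb) : ∀ t ∈ Set.Icc t₀ t₁,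
      HasTimeDeriv (Set.Icc t₀ t₁) (fun t => ((α t, αb t) : RDual Ω))
        (timeDeriv (Set.Icc t₀ t₁) α t, timeDeriv (Set.Icc t₀ t₁) αb t) t := fun t h =>
  (hα.hasTimeDeriv hr h (nhdsWithin_Icc_diff_neBot ht t h)).prodMk
    (hαb.hasTimeDeriv hr h (nhdsWithin_Icc_diff_neBot ht t h))

/-- The first variation of the Pontryagin action, after integration by parts in time. -/
theorem exists_hasDerivAt_pontryaginAction
    (hF : Continuous fun q : ConfSpace Ω × ConfSpace Ω => F q.1 q.2)
    (ht : t₀ < t₁) (hr : 1 ≤ r) (h : IsPontryaginCurve t₀ t₁ r φ ν α αb)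
    {δφ δν δα : ℝ → CInf (closure Ω)} {δαb : ℝ → CInf (frontier Ω)}
    (hδ : IsPontryaginCurve t₀ t₁ r δφ δν δα δαb) (h₀ : δφ t₀ = 0) (h₁ : δφ t₁ = 0) :
    ∃ d : ℝ, HasDerivAt (fun ε : ℝ => ∫ t in t₀..t₁,
        (lagrangian 𝔏 (φ t + ε • δφ t) (ν t + ε • δν t) +
          pairing (α t + ε • δα t, αb t + ε • δαb t)
            (timeDeriv (Set.Icc t₀ t₁) (fun s => φ s + ε • δφ s) t - (ν t + ε • δν t)))) d 0 ∧
      d + (∫ t in t₀..t₁, pairing (F (φ t) (ν t)) (δφ t)) =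
        ∫ t in t₀..t₁, (pairing (hΩ.elPhi h𝔏 (φ t) (ν t) + F (φ t) (ν t) -
            (timeDeriv (Set.Icc t₀ t₁) α t, timeDeriv (Set.Icc t₀ t₁) αb t)) (δφ t) +
          (pairing (hΩ.elNu h𝔏 (φ t) (ν t) - (α t, αb t)) (δν t) +
          pairing (δα t, δαb t) (timeDeriv (Set.Icc t₀ t₁) φ t - ν t))) := by
  obtain ⟨hφ, hν, hα, hαb⟩ := h
  obtain ⟨hδφ, hδν, hδα, hδαb⟩ := hδ
  have hI := nhdsWithin_Icc_diff_neBot ht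
  have hac : ContinuousOn (fun t => ((α t, αb t) : RDual Ω)) (Set.Icc t₀ t₁) :=
    hα.continuousOn.prodMk hαb.continuousOn
  have hδac : ContinuousOn (fun t => ((δα t, δαb t) : RDual Ω)) (Set.Icc t₀ t₁) :=
    hδα.continuousOn.prodMk hδαb.continuousOn
  have hnc := hΩ.continuousOn_elNu h𝔏 hφ.continuousOn hν.continuousOn
  have hFc : ContinuousOn (fun t => F (φ t) (ν t)) (Set.Icc t₀ t₁) :=
    hF.comp_continuousOn (hφ.continuousOn.prodMk hν.continuousOn)
  have hτc : ContinuousOn (fun t => timeDeriv (Set.Icc t₀ t₁) φ t - ν t) (Set.Icc t₀ t₁) :=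
    ContinuousOn.sub hφ.timeDeriv.continuousOn hν.continuousOn
  have hδτc : ContinuousOn (fun t => timeDeriv (Set.Icc t₀ t₁) δφ t - δν t) (Set.Icc t₀ t₁) :=
    ContinuousOn.sub hδφ.timeDeriv.continuousOn hδν.continuousOn
  refine ⟨_, (hΩ.hasDerivAt_action_add_constraint h𝔏 ht.le hφ.continuousOn hν.continuousOn
    hδφ.continuousOn hδν.continuousOn hac hδac hτc hδτc).congr_of_eventuallyEq
      (Eventually.of_forall fun ε => integral_congr_Icc ht.le fun t h => ?_), ?_⟩
  · rw [timeDeriv_line ht hφ hδφ ε h, add_sub_add_comm, smul_sub]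
    rfl
  · have hk : ContinuousOn (fun t => pairing (hΩ.elNu h𝔏 (φ t) (ν t) - (α t, αb t)) (δν t) +
        pairing (δα t, δαb t) (timeDeriv (Set.Icc t₀ t₁) φ t - ν t)) (Set.Icc t₀ t₁) :=
      ContinuousOn.add (hΩ.continuousOn_pairing (ContinuousOn.sub hnc hac) hδν.continuousOn)
        (hΩ.continuousOn_pairing hδac hτc)
    refine Eq.trans ?_ (hΩ.integral_first_variation ht.le (hasTimeDeriv_prod ht hr hα hαb)
      (fun t h => hδφ.hasTimeDeriv le_add_self h (hI t h))
      ((hα.continuousOn_timeDeriv hr).prodMk (hαb.continuousOn_timeDeriv hr))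
      hδφ.timeDeriv.continuousOn h₀ h₁
      (hΩ.continuousOn_elPhi h𝔏 hφ.continuousOn hν.continuousOn) hFc hk)
    congr 1
    refine integral_congr_Icc ht.le fun t h => ?_
    simp only [← hΩ.pairingForm_apply, map_sub, LinearMap.sub_apply]
    ring

/-- The variations `δφ = χ ψ`, `δν = χ ψ` and `(δα, δα_∂) = χ a`, taken one at a time, give the three
equations. -/
theorem ldAPPrinciple_iff (hF : Continuous fun q : ConfSpace Ω × ConfSpace Ω => F q.1 q.2)
    (ht : t₀ < t₁) (hr : 1 ≤ r) (h : IsPontryaginCurve t₀ t₁ r φ ν α αb) :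
    LdAPPrinciple (lagrangian 𝔏) F t₀ t₁ r φ ν α αb ↔ hΩ.IsSolution h𝔏 F t₀ t₁ φ ν α αb := by
  have hc := h
  obtain ⟨hφ, hν, hα, hαb⟩ := hc
  have hI := nhdsWithin_Icc_diff_neBot ht
  have hac : ContinuousOn (fun t => ((α t, αb t) : RDual Ω)) (Set.Icc t₀ t₁) :=
    hα.continuousOn.prodMk hαb.continuousOn
  have ha'c : ContinuousOn (fun t => ((timeDeriv (Set.Icc t₀ t₁) α t,
      timeDeriv (Set.Icc t₀ t₁) αb t) : RDual Ω)) (Set.Icc t₀ t₁) :=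
    (hα.continuousOn_timeDeriv hr).prodMk (hαb.continuousOn_timeDeriv hr)
  have hFc : ContinuousOn (fun t => F (φ t) (ν t)) (Set.Icc t₀ t₁) :=
    hF.comp_continuousOn (hφ.continuousOn.prodMk hν.continuousOn)
  constructor
  · intro hP
    have key : ∀ (δφ δν δα : ℝ → CInf (closure Ω)) (δαb : ℝ → CInf (frontier Ω)),
        IsPontryaginCurve t₀ t₁ r δφ δν δα δαb → δφ t₀ = 0 → δφ t₁ = 0 →
        ∫ t in t₀..t₁, (pairing (hΩ.elPhi h𝔏 (φ t) (ν t) + F (φ t) (ν t) -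
            (timeDeriv (Set.Icc t₀ t₁) α t, timeDeriv (Set.Icc t₀ t₁) αb t)) (δφ t) +
          (pairing (hΩ.elNu h𝔏 (φ t) (ν t) - (α t, αb t)) (δν t) +
          pairing (δα t, δαb t) (timeDeriv (Set.Icc t₀ t₁) φ t - ν t))) = 0 := by
      intro δφ δν δα δαb hδ h₀ h₁
      obtain ⟨d, hd, hd0⟩ := hP δφ δν δα δαb hδ h₀ h₁
      obtain ⟨d', hd', hd0'⟩ := hΩ.exists_hasDerivAt_pontryaginAction h𝔏 hF ht hr h hδ h₀ h₁
      rw [← hd.unique hd', hd0] at hd0'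
      exact hd0'.symm
    have p0 : ∀ ψ : ConfSpace Ω, pairing ((0 : CInf (closure Ω)), (0 : CInf (frontier Ω))) ψ = 0 :=
      hΩ.pairing_zero_left
    refine fun t htI => ⟨?_, ?_, ?_⟩
    · refine sub_eq_zero.1 (hΩ.eq_zero_of_integral_pairing_right ht
        (ContinuousOn.sub hφ.timeDeriv.continuousOn hν.continuousOn)
        (fun χ b hχ _ _ => ?_) t htI)
      have := key (fun _ => 0) (fun _ => 0) (fun t => χ t • b.1) (fun t => χ t • b.2)
        ⟨IsCurve.const_zero hI, IsCurve.const_zero hI, IsCurve.smul_const hI hχ _,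
          IsCurve.smul_const hI hχ _⟩ rfl rfl
      simp only [hΩ.pairing_zero_right, zero_add] at this
      exact this
    · refine (sub_eq_zero.1 (hΩ.eq_zero_of_integral_pairing ht (ContinuousOn.sub
        (hΩ.continuousOn_elNu h𝔏 hφ.continuousOn hν.continuousOn) hac)
        (fun χ ψ hχ _ _ => ?_) t htI)).symm
      have := key (fun _ => 0) (fun t => χ t • ψ) (fun _ => 0) (fun _ => 0)
        ⟨IsCurve.const_zero hI, IsCurve.smul_const hI hχ _, IsCurve.const_zero hI,
          IsCurve.const_zero hI⟩ rfl rfl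
      simp only [hΩ.pairing_zero_right, zero_add, p0, add_zero] at this
      exact this
    · refine (sub_eq_zero.1 (hΩ.eq_zero_of_integral_pairing ht (ContinuousOn.sub (ContinuousOn.add
        (hΩ.continuousOn_elPhi h𝔏 hφ.continuousOn hν.continuousOn) hFc) ha'c)
        (fun χ ψ hχ h₀ h₁ => ?_) t htI)).symm
      have := key (fun t => χ t • ψ) (fun _ => 0) (fun _ => 0) (fun _ => 0)
        ⟨IsCurve.smul_const hI hχ _, IsCurve.const_zero hI, IsCurve.const_zero hI,
          IsCurve.const_zero hI⟩ (by rw [h₀, zero_smul]) (by rw [h₁, zero_smul])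
      simp only [hΩ.pairing_zero_right, p0, add_zero] at this
      exact this
  · intro hS δφ δν δα δαb hδ h₀ h₁
    obtain ⟨d, hd, hd0⟩ := hΩ.exists_hasDerivAt_pontryaginAction h𝔏 hF ht hr h hδ h₀ h₁
    refine ⟨d, hd, hd0.trans ?_⟩
    rw [integral_congr_Icc (v := fun _ => 0) ht.le fun t htI => ?_, intervalIntegral.integral_zero]
    obtain ⟨h1, h2, h3⟩ := hS t htI
    rw [h1, h2, h3, sub_self, sub_self, sub_self, hΩ.pairing_zero_left, hΩ.pairing_zero_left,
      hΩ.pairing_zero_right, add_zero, add_zero]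

/-- The Lagrange–d'Alembert equations, with the momenta reconstructed from `φ`. On the boundary
`α_∂ = 0`, hence `α̇_∂ = 0`, and the boundary equation is a boundary condition. -/
theorem ldAEquations_and_iff (ht : t₀ < t₁) (hr : 1 ≤ r)
    (h : IsPontryaginCurve t₀ t₁ r φ ν α αb) :
    LdAEquations 𝔏 F t₀ t₁ φ ∧ IsReconstructed (lagrangian 𝔏) t₀ t₁ φ ν α αb ↔
      hΩ.IsSolution h𝔏 F t₀ t₁ φ ν α αb := by
  obtain ⟨hφ, hν, hα, hαb⟩ := h
  have hI := nhdsWithin_Icc_diff_neBot ht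
  rw [hΩ.isReconstructed_iff h𝔏]
  have key : (∀ t ∈ Set.Icc t₀ t₁, timeDeriv (Set.Icc t₀ t₁) φ t = ν t ∧
      (α t, αb t) = hΩ.elNu h𝔏 (φ t) (ν t)) → (LdAEquations 𝔏 F t₀ t₁ φ ↔
      ∀ t ∈ Set.Icc t₀ t₁, (timeDeriv (Set.Icc t₀ t₁) α t, timeDeriv (Set.Icc t₀ t₁) αb t) =
        hΩ.elPhi h𝔏 (φ t) (ν t) + F (φ t) (ν t)) := by
    intro hR
    refine forall₂_congr fun t htI => ?_
    have hb : timeDeriv (Set.Icc t₀ t₁) αb t = 0 := by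
      have h0 : HasTimeDeriv (Set.Icc t₀ t₁) (fun _ => (0 : CInf (frontier Ω))) 0 t := by
        simpa using HasTimeDeriv.smul_const (I := Set.Icc t₀ t₁) (hasDerivAt_const t (0 : ℝ))
          (0 : CInf (frontier Ω))
      exact (h0.congr htI fun s hs =>
        ((hΩ.eq_elNu_iff h𝔏).1 (hR s hs).2).2.symm).timeDeriv_eq (hI t htI)
    have hx : ∀ (x : closure Ω) (y : ℝ), HasDerivWithinAt
        (fun s => densityNu 𝔏 (φ s) (timeDeriv (Set.Icc t₀ t₁) φ s) x) y (Set.Icc t₀ t₁) t ↔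
        timeDeriv (Set.Icc t₀ t₁) α t x = y := by
      intro x y
      have h1 := ((hα.hasTimeDeriv hr htI (hI t htI)).hasDerivWithinAt_apply x)
      have h2 : ∀ s ∈ Set.Icc t₀ t₁,
          densityNu 𝔏 (φ s) (timeDeriv (Set.Icc t₀ t₁) φ s) x = α s x := fun s hs => by
        rw [(hR s hs).1, ((hΩ.eq_elNu_iff h𝔏).1 (hR s hs).2).1 x]
      have h3 := h1.congr h2 (h2 t htI)
      exact ⟨fun h => (uniqueDiffOn_Icc ht t htI).eq_deriv _ h3 h, fun h => h ▸ h3⟩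
    rw [hΩ.eq_elPhi_add_iff h𝔏, hb, (hR t htI).1]
    refine and_congr (forall_congr' fun x => ?_) (forall_congr' fun x => ?_)
    · rw [← hx]
    · rw [CInf.zero_apply]
      constructor <;> intro h <;> linarith
  constructor
  · rintro ⟨h1, hR⟩ t htI
    exact ⟨(hR t htI).1, (hR t htI).2, (key hR).1 h1 t htI⟩
  · intro h
    have hR := fun t htI => And.intro (h t htI).1 (h t htI).2.1
    exact ⟨(key hR).2 fun t htI => (h t htI).2.2, hR⟩

/-- Under the reconstruction conditions the momentum is the curve `δL/δν`, whose regularity allows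
integration by parts in time. -/
theorem ldAPrinciple_and_iff (hF : Continuous fun q : ConfSpace Ω × ConfSpace Ω => F q.1 q.2)
    (ht : t₀ < t₁) (hr : 1 ≤ r) (h : IsPontryaginCurve t₀ t₁ r φ ν α αb) :
    LdAPrinciple (lagrangian 𝔏) F t₀ t₁ r φ ∧ IsReconstructed (lagrangian 𝔏) t₀ t₁ φ ν α αb ↔
      hΩ.IsSolution h𝔏 F t₀ t₁ φ ν α αb := by
  obtain ⟨hφ, hν, hα, hαb⟩ := h
  rw [hΩ.isReconstructed_iff h𝔏]
  have key := fun hR => hΩ.ldAPrinciple_iff h𝔏 hF ht hφ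
    (a := fun t => (α t, αb t)) hR (hasTimeDeriv_prod ht hr hα hαb)
    ((hα.continuousOn_timeDeriv hr).prodMk (hαb.continuousOn_timeDeriv hr))
  constructor
  · rintro ⟨h1, hR⟩ t htI
    refine ⟨(hR t htI).1, (hR t htI).2, ?_⟩
    rw [← (hR t htI).1]
    exact (key fun s hs => by rw [(hR s hs).1, (hR s hs).2]).1 h1 t htI
  · intro h
    refine ⟨(key fun s hs => by rw [(h s hs).1, (h s hs).2.1]).2 fun t htI => ?_,
      fun t htI => ⟨(h t htI).1, (h t htI).2.1⟩⟩
    rw [(h t htI).1]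
    exact (h t htI).2.2

theorem tfae_of_isPontryaginCurve (hΩ : IsSmoothBoundedDomain Ω)
    (h𝔏 : ContDiff ℝ ∞ (fun q : ℝ × ℝ × Eu m => 𝔏 q.1 q.2.1 q.2.2))
    (hF : Continuous fun q : ConfSpace Ω × ConfSpace Ω => F q.1 q.2)
    (ht : t₀ < t₁) (hr : 1 ≤ r) (h : IsPontryaginCurve t₀ t₁ r φ ν α αb) :
    List.TFAE [
      LdAPrinciple (lagrangian 𝔏) F t₀ t₁ r φ ∧ IsReconstructed (lagrangian 𝔏) t₀ t₁ φ ν α αb,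
      LdAEquations 𝔏 F t₀ t₁ φ ∧ IsReconstructed (lagrangian 𝔏) t₀ t₁ φ ν α αb,
      LdAPPrinciple (lagrangian 𝔏) F t₀ t₁ r φ ν α αb,
      LdAPEquations 𝔏 F t₀ t₁ φ ν α αb,
      LagrangeDirac (lagrangian 𝔏) F t₀ t₁ φ ν α αb] := by
  rw [hΩ.ldAPrinciple_and_iff h𝔏 hF ht hr h, hΩ.ldAEquations_and_iff h𝔏 ht hr h,
    hΩ.ldAPPrinciple_iff h𝔏 hF ht hr h, hΩ.ldAPEquations_iff h𝔏, hΩ.lagrangeDirac_iff h𝔏]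
  tfae_finish

/-- The reconstructed curves are `ν = φ̇`, `α = ∂𝔏/∂ν` and `α_∂ = 0`. The class `C^r` of `α` comes from
the chain rule for Nemytskii operators. -/
theorem exists_isReconstructed (hΩ : IsSmoothBoundedDomain Ω)
    (h𝔏 : ContDiff ℝ ∞ (fun q : ℝ × ℝ × Eu m => 𝔏 q.1 q.2.1 q.2.2)) (ht : t₀ < t₁) (hφ : IsCurve (Set.Icc t₀ t₁) (r + 1) φ) :
    ∃ (ν α : ℝ → CInf (closure Ω)) (αb : ℝ → CInf (frontier Ω)),
      IsPontryaginCurve t₀ t₁ r φ ν α αb ∧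
        IsReconstructed (lagrangian 𝔏) t₀ t₁ φ ν α αb := by
  have hI := nhdsWithin_Icc_diff_neBot ht
  set φ' := timeDeriv (Set.Icc t₀ t₁) φ
  refine ⟨φ', fun t => hΩ.densityPartial h𝔏 (.inl 1) (φ t) (φ' t), fun _ => 0,
    ⟨hφ, hφ.timeDeriv, ?_, IsCurve.const_zero hI⟩, ?_⟩
  · refine CInf.isCurve_nem hI _ (c := fun j t => hΩ.jet (φ t) (φ' t) j) ?_
    rintro (j | j)
    · fin_cases j
      · exact hφ.of_succ
      · exact hφ.timeDeriv
    · exact hφ.of_succ.map hI (hΩ.partialDeriv j)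
  · exact (hΩ.isReconstructed_iff h𝔏).2 fun t _ => ⟨rfl, rfl⟩

end

end IsSmoothBoundedDomain

theorem theorem3p21 {m : ℕ} (Ω : Set (Eu m)) (hΩ : IsSmoothBoundedDomain Ω)
    (𝔏 : ℝ → ℝ → Eu m → ℝ)
    (h𝔏 : ContDiff ℝ ∞ (fun q : ℝ × ℝ × Eu m => 𝔏 q.1 q.2.1 q.2.2))
    (L : ConfSpace Ω → ConfSpace Ω → ℝ) (hL : L = lagrangian 𝔏)
    (F : ConfSpace Ω → ConfSpace Ω → RDual Ω)
    (hF : Continuous (fun q : ConfSpace Ω × ConfSpace Ω => F q.1 q.2))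
    (t₀ t₁ : ℝ) (ht : t₀ < t₁) (r : ℕ∞) (hr : 1 ≤ r) :
    (∀ (φ ν α : ℝ → CInf (closure Ω)) (αb : ℝ → CInf (frontier Ω)),
      IsPontryaginCurve t₀ t₁ r φ ν α αb →
      List.TFAE [
        LdAPrinciple L F t₀ t₁ r φ ∧ IsReconstructed L t₀ t₁ φ ν α αb,
        LdAEquations 𝔏 F t₀ t₁ φ ∧ IsReconstructed L t₀ t₁ φ ν α αb,
        LdAPPrinciple L F t₀ t₁ r φ ν α αb,
        LdAPEquations 𝔏 F t₀ t₁ φ ν α αb,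
        LagrangeDirac L F t₀ t₁ φ ν α αb]) ∧
    (∀ φ : ℝ → CInf (closure Ω), IsCurve (Set.Icc t₀ t₁) (r + 1) φ →
      List.TFAE [
        LdAPrinciple L F t₀ t₁ r φ,
        LdAEquations 𝔏 F t₀ t₁ φ,
        ∃ (ν α : ℝ → CInf (closure Ω)) (αb : ℝ → CInf (frontier Ω)),
          IsPontryaginCurve t₀ t₁ r φ ν α αb ∧ LdAPPrinciple L F t₀ t₁ r φ ν α αb,
        ∃ (ν α : ℝ → CInf (closure Ω)) (αb : ℝ → CInf (frontier Ω)),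
          IsPontryaginCurve t₀ t₁ r φ ν α αb ∧ LdAPEquations 𝔏 F t₀ t₁ φ ν α αb,
        ∃ (ν α : ℝ → CInf (closure Ω)) (αb : ℝ → CInf (frontier Ω)),
          IsPontryaginCurve t₀ t₁ r φ ν α αb ∧ LagrangeDirac L F t₀ t₁ φ ν α αb]) := by
  subst hL
  refine ⟨fun φ ν α αb h => hΩ.tfae_of_isPontryaginCurve h𝔏 hF ht hr h, fun φ hφ => ?_⟩
  obtain ⟨ν, α, αb, hc, hR⟩ := hΩ.exists_isReconstructed h𝔏 ht hφ
  tfae_have 1 → 2 := fun h => ((hΩ.ldAEquations_and_iff h𝔏 ht hr hc).2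
    ((hΩ.ldAPrinciple_and_iff h𝔏 hF ht hr hc).1 ⟨h, hR⟩)).1
  tfae_have 2 → 3 := fun h => ⟨ν, α, αb, hc, (hΩ.ldAPPrinciple_iff h𝔏 hF ht hr hc).2
    ((hΩ.ldAEquations_and_iff h𝔏 ht hr hc).1 ⟨h, hR⟩)⟩
  tfae_have 3 → 4 := fun ⟨ν, α, αb, hc, h⟩ => ⟨ν, α, αb, hc, (hΩ.ldAPEquations_iff h𝔏).2
    ((hΩ.ldAPPrinciple_iff h𝔏 hF ht hr hc).1 h)⟩
  tfae_have 4 → 5 := fun ⟨ν, α, αb, hc, h⟩ => ⟨ν, α, αb, hc, (hΩ.lagrangeDirac_iff h𝔏).2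
    ((hΩ.ldAPEquations_iff h𝔏).1 h)⟩
  tfae_have 5 → 1 := fun ⟨ν, α, αb, hc, h⟩ => ((hΩ.ldAPrinciple_and_iff h𝔏 hF ht hr hc).2
    ((hΩ.lagrangeDirac_iff h𝔏).1 h)).1
  tfae_finish
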